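/- **Setting.** Let $D$ be a self-adjoint (possibly unbounded) operator on a complex Hilbert space $\mathcal H$, let $\mathcal K$ be a bounded self-adjoint operator on $\mathcal H$, let $\beta>0$, and assume $\|\mathcal K\|<\beta^{-1}$. Put $$F_\pm=\frac{\mp1}{1+e^{\pm\beta D}},\qquad \mathcal K_{iu}=e^{-uD}\mathcal K e^{uD},$$ let $\sigma(s)$ be the sign of $s$, and for $\bar u\in[0,\beta]$ let $$T(\bar u)=\frac1{1+e^{-\beta D}}+\sum_{n>0}(-1)^n\int_{(0,\bar u)^n}F_-\Big(\prod_{j=1}^{n-1}\mathcal K_{iu_j}F_{\sigma(u_j-u_{j+1})}\Big)\mathcal K_{iu_n}F_+\,d^nu ,$$ where the factors $e^{\pm uD}$ are always composed with the neighbouring Fermi factors, so that the integrand is a product of the bounded operators $F_-e^{-u_1D}$, $\mathcal K$, $e^{(u_j-u_{j+1})D}F_{\sigma(u_j-u_{j+1})}$ and $e^{u_nD}F_+$. Let $\mathfrak A$ be the CAR algebra over $\mathcal H$, that is, the (nonzero) unital C*-algebra generated by elements $\psi(f)$, $f\in\mathcal H$, antilinear in $f$, with $(\psi(f)+\psi(f)^*)^2=\langle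 f,f\rangle$. Let $\tau_t$ and $\tau^K_t$ be the automorphisms of $\mathfrak A$ with $\tau_t(\psi(f))=\psi(e^{itD}f)$ and $\tau^K_t(\psi(f))=\psi(e^{it(D+\mathcal K)}f)$. Let $$K=-\sum_i\big(\psi(f_i)\psi(\mathcal Kf_i)^*+c_i\big)$$ with an orthonormal basis $(f_i)$ of $\mathcal H$ and real constants $c_i$. For the $(\tau,\beta)$-KMS state $\omega^\beta$, Araki's perturbed expectation values are $$\omega^{\beta K}(B)=\omega^\beta(B)+\sum_{n>0}(-1)^n\int_{0<u_1<\dots<u_n<\beta}\omega^\beta_c\big(B,\tau_{iu_1}(K),\dots,\tau_{iu_n}(K)\big)\,d^nu ,$$ where $\omega^\beta_c$ denotes the connected (truncated) correlation functions, analytically continued in the times; the connected functions of $K$ are the pointwise limits of those of the finite partial sums of $K$. **Theorem.** 1. For every $\bar u\in[0,\beta]$ the integrals exist as integrals in $B(\mathcal H)$, and the series defining $T(\bar u)$ converges absolutely in operator norm (also after replacing each integrand by its norm), so that $T(\bar u)$ is a bounded operator. 2. $\displaystyle T(\beta)=\frac1{1+e^{-\beta(D+\mathcal K)}}$. 3.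 The automorphisms $\tau_t$ and $\tau^K_t$ exist, and there are a unique $(\tau,\beta)$-KMS state $\omega^\beta$ and a unique $(\tau^K,\beta)$-KMS state on $\mathfrak A$. For all $f,g\in\mathcal H$ the expansion of $\omega^{\beta K}(\psi(f)\psi(g)^*)$ converges, and $$\omega^{\beta K}(\psi(f)\psi(g)^*)=\langle f,T(\beta)g\rangle .$$ This is the two-point function of the unique $(\tau^K,\beta)$-KMS state, which is the quasifree state with $$\psi(f_1)\cdots\psi(f_n)\psi(g_m)^*\cdots\psi(g_1)^*\;\mapsto\;\delta_{nm}\det\big(\langle f_i,T(\beta)g_j\rangle\big)_{i,j}.$$ -/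

import Mathlib

open scoped InnerProductSpace ComplexOrder BoundedContinuousFunction Topology
open MeasureTheory Filter

noncomputable section

namespace FermiKMS

section FunctionalCalculus

variable {H : Type*} [NormedAddCommGroup H] [InnerProductSpace ℂ H] [CompleteSpace H]

/-- The bounded continuous function `x ↦ (x + i)⁻¹` on the real line. -/
def resolventFn : ℝ →ᵇ ℂ :=
  BoundedContinuousFunction.ofNormedAddCommGroup (fun x : ℝ => ((x : ℂ) + Complex.I)⁻¹)
    (by
      refine Continuous.inv₀ (by fun_prop) (fun x h => ?_)
      have := congrArg Complex.im h
      simp at this)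
    1
    (by
      intro x
      rw [norm_inv]
      refine inv_le_one_of_one_le₀ ?_
      have h := Complex.abs_im_le_norm ((x : ℂ) + Complex.I)
      simpa using h)

/-- `Φ` is the functional calculus `f ↦ f(D)` of the (possibly unbounded) operator `D` on bounded
continuous functions: a unital `*`-homomorphism that sends `(x + i)⁻¹` to `(D + i)⁻¹`.
For self-adjoint `D` there is exactly one such `Φ`: on functions vanishing at infinity it is fixed
by the resolvent, and in general by `f(D) (D + i)⁻¹ = (f · (x + i)⁻¹)(D)`, as the range of
`(D + i)⁻¹` is the dense domain of `D`. -/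
def IsFunctionalCalculus (D : H →ₗ.[ℂ] H) (Φ : (ℝ →ᵇ ℂ) →⋆ₐ[ℂ] (H →L[ℂ] H)) : Prop :=
  ∀ x : H, ∃ h : Φ resolventFn x ∈ D.domain,
    D ⟨Φ resolventFn x, h⟩ + Complex.I • Φ resolventFn x = x

open Classical in
/-- `f(D)` for a self-adjoint operator `D` and a bounded continuous function `f : ℝ → ℂ`
(and `0` when `f` is not bounded and continuous or when `D` has no functional calculus). -/
def opFun (D : H →ₗ.[ℂ] H) (f : ℝ → ℂ) : H →L[ℂ] H :=
  if h : (∃ Φ, IsFunctionalCalculus D Φ) ∧ Continuous f ∧ ∃ C : ℝ, ∀ x, ‖f x‖ ≤ C then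
    h.1.choose
      (BoundedContinuousFunction.ofNormedAddCommGroup f h.2.1 h.2.2.choose h.2.2.choose_spec)
  else 0

/-- The operator sum `D + 𝒦` of an unbounded operator and a bounded one, on the domain of `D`. -/
def perturbed (D : H →ₗ.[ℂ] H) (𝒦 : H →L[ℂ] H) : H →ₗ.[ℂ] H :=
  (𝒦 : H →ₗ[ℂ] H) +ᵥ D

/-- The unitary group `e^{itD}`. -/
def unitaryGroup (D : H →ₗ.[ℂ] H) (t : ℝ) : H →L[ℂ] H :=
  opFun D (fun x => Complex.exp (Complex.I * t * x))

/-- The function `F₊(x) = -1 / (1 + e^{βx})`. -/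
def fermiPlus (β x : ℝ) : ℝ := -1 / (1 + Real.exp (β * x))

/-- The function `F₋(x) = 1 / (1 + e^{-βx})`. -/
def fermiMinus (β x : ℝ) : ℝ := 1 / (1 + Real.exp (-β * x))

/-- `F_{σ(s)}`, where `σ(s)` is the sign of `s` (the value at `s = 0` only matters on a null set). -/
def fermiSign (β s x : ℝ) : ℝ := if 0 < s then fermiPlus β x else fermiMinus β x

/-- The integrand of the term of order `m + 1` of the series,
`F₋ (∏_{j=1}^{m} 𝒦_{iu_j} F_{σ(u_j - u_{j+1})}) 𝒦_{iu_{m+1}} F₊` with `𝒦_{iu} = e^{-uD} 𝒦 e^{uD}`.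
The exponentials `e^{± uD}` are combined with the neighbouring Fermi factors into the bounded
operators `F₋ e^{-u_1 D}`, `e^{(u_j - u_{j+1}) D} F_{σ(u_j - u_{j+1})}` and `e^{u_{m+1} D} F₊`. -/
def seriesIntegrand (D : H →ₗ.[ℂ] H) (𝒦 : H →L[ℂ] H) (β : ℝ) (m : ℕ) (u : Fin (m + 1) → ℝ) :
    H →L[ℂ] H :=
  opFun D (fun x => ((fermiMinus β x * Real.exp (-u 0 * x) : ℝ) : ℂ)) * 𝒦 *
    (List.ofFn fun j : Fin m =>
      opFun D (fun x => ((Real.exp ((u j.castSucc - u j.succ) * x) *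
        fermiSign β (u j.castSucc - u j.succ) x : ℝ) : ℂ)) * 𝒦).prod *
    opFun D (fun x => ((Real.exp (u (Fin.last m) * x) * fermiPlus β x : ℝ) : ℂ))

/-- The open cube `(0, r)^n`. -/
def openCube (n : ℕ) (r : ℝ) : Set (Fin n → ℝ) := {u | ∀ i, u i ∈ Set.Ioo 0 r}

/-- The term of order `m + 1` of the series defining `T(r)`. -/
def seriesTerm (D : H →ₗ.[ℂ] H) (𝒦 : H →L[ℂ] H) (β r : ℝ) (m : ℕ) : H →L[ℂ] H :=
  (-1 : ℂ) ^ (m + 1) • ∫ u in openCube (m + 1) r, seriesIntegrand D 𝒦 β m u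

/-- `T(r) = (1 + e^{-βD})⁻¹ + ∑_{n > 0} (-1)^n ∫_{(0,r)^n} …`. -/
def T (D : H →ₗ.[ℂ] H) (𝒦 : H →L[ℂ] H) (β r : ℝ) : H →L[ℂ] H :=
  opFun D (fun x => ((fermiMinus β x : ℝ) : ℂ)) + ∑' m : ℕ, seriesTerm D 𝒦 β r m

end FunctionalCalculus

section CAR

variable {H : Type*} [NormedAddCommGroup H] [InnerProductSpace ℂ H] [CompleteSpace H]
variable {𝔄 : Type*} [CStarAlgebra 𝔄]

/-- `(𝔄, ψ)` is the CAR algebra over `H`: the (nonzero) unital C*-algebra generated by elements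
`ψ(f)`, `f ∈ H`, depending antilinearly on `f`, with `(ψ(f) + ψ(f)*)² = ⟨f, f⟩ 1`. Such a pair is
unique up to isomorphism. Replacing `f` by `e^{iθ} f` and polarizing, the relation is equivalent to
`{ψ(f), ψ(g)} = 0` and `{ψ(f), ψ(g)*} = ⟨f, g⟩ 1`. -/
structure IsCARAlgebra (ψ : H →ₗ⋆[ℂ] 𝔄) : Prop where
  nontrivial : Nontrivial 𝔄
  relation : ∀ f : H, (ψ f + star (ψ f)) ^ 2 = algebraMap ℂ 𝔄 ⟪f, f⟫_ℂ
  generates : (StarAlgebra.adjoin ℂ (Set.range ψ)).topologicalClosure = ⊤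

open Classical in
/-- The automorphism of the CAR algebra with `ψ(f) ↦ ψ(U f)`
(the identity if there is no such automorphism). -/
def bogoliubov (ψ : H →ₗ⋆[ℂ] 𝔄) (U : H →L[ℂ] H) : 𝔄 ≃⋆ₐ[ℂ] 𝔄 :=
  if h : ∃ α : 𝔄 ≃⋆ₐ[ℂ] 𝔄, ∀ f, α (ψ f) = ψ (U f) then h.choose else StarAlgEquiv.refl ℂ 𝔄

/-- The time evolution with one-particle Hamiltonian `D`: `τ_t(ψ(f)) = ψ(e^{itD} f)`. -/
def evolution (ψ : H →ₗ⋆[ℂ] 𝔄) (D : H →ₗ.[ℂ] H) (t : ℝ) : 𝔄 ≃⋆ₐ[ℂ] 𝔄 :=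
  bogoliubov ψ (unitaryGroup D t)

/-- `ω` is a state of the C*-algebra `𝔄`. -/
def IsState (ω : 𝔄 →L[ℂ] ℂ) : Prop :=
  ω 1 = 1 ∧ ∀ a : 𝔄, 0 ≤ ω (star a * a)

/-- `ω` is a KMS state for `τ` at inverse temperature `β`: for all `a, b` there is a bounded
continuous function `F` on the strip `0 ≤ Im z ≤ β`, analytic in its interior, with
`F(t) = ω(a τ_t(b))` and `F(t + iβ) = ω(τ_t(b) a)`. -/
def IsKMSState (τ : ℝ → (𝔄 ≃⋆ₐ[ℂ] 𝔄)) (β : ℝ) (ω : 𝔄 →L[ℂ] ℂ) : Prop :=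
  IsState ω ∧ ∀ a b : 𝔄, ∃ F : ℂ → ℂ,
    ContinuousOn F {z | 0 ≤ z.im ∧ z.im ≤ β} ∧
    DifferentiableOn ℂ F {z | 0 < z.im ∧ z.im < β} ∧
    (∃ C : ℝ, ∀ z : ℂ, 0 ≤ z.im → z.im ≤ β → ‖F z‖ ≤ C) ∧
    ∀ t : ℝ, F t = ω (a * τ t b) ∧ F (t + Complex.I * β) = ω (τ t b * a)

/-- `ω` is the (gauge invariant) quasifree functional with two-point function
`ω(ψ(f) ψ(g)*) = ⟨f, S g⟩`, that is,
`ω(ψ(f_1) ⋯ ψ(f_n) ψ(g_m)* ⋯ ψ(g_1)*) = δ_{nm} det ⟨f_i, S g_j⟩`. -/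
def IsQuasifree (ψ : H →ₗ⋆[ℂ] 𝔄) (S : H →L[ℂ] H) (ω : 𝔄 →L[ℂ] ℂ) : Prop :=
  (∀ (n : ℕ) (f g : Fin n → H),
    ω ((List.ofFn fun i => ψ (f i)).prod * (List.ofFn fun j => star (ψ (g j))).reverse.prod) =
      (Matrix.of fun i j => ⟪f i, S (g j)⟫_ℂ).det) ∧
  ∀ (n m : ℕ) (f : Fin n → H) (g : Fin m → H), n ≠ m →
    ω ((List.ofFn fun i => ψ (f i)).prod * (List.ofFn fun j => star (ψ (g j))).reverse.prod) = 0

end CAR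

section Araki

variable {𝔄 : Type*} [CStarAlgebra 𝔄]

/-- `v = ω(τ_{iu_1}(a_1) ⋯ τ_{iu_n}(a_n))`, the value at `(iu_1, …, iu_n)` of the (unique) function
`G` that is bounded and continuous on the tube
`Im z_1 ≤ ⋯ ≤ Im z_n ≤ Im z_1 + β`, analytic in its interior, and equal to
`ω(τ_{s_1}(a_1) ⋯ τ_{s_n}(a_n))` at real points. -/
def HasImaginaryTimeValue (ω : 𝔄 →L[ℂ] ℂ) (τ : ℝ → (𝔄 ≃⋆ₐ[ℂ] 𝔄)) (β : ℝ) {n : ℕ}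
    (a : Fin n → 𝔄) (u : Fin n → ℝ) (v : ℂ) : Prop :=
  ∃ G : (Fin n → ℂ) → ℂ,
    ContinuousOn G {z | ∀ i j, i ≤ j → (z i).im ≤ (z j).im ∧ (z j).im ≤ (z i).im + β} ∧
    DifferentiableOn ℂ G {z | ∀ i j, i < j → (z i).im < (z j).im ∧ (z j).im < (z i).im + β} ∧
    (∃ C : ℝ, ∀ z : Fin n → ℂ,
      (∀ i j, i ≤ j → (z i).im ≤ (z j).im ∧ (z j).im ≤ (z i).im + β) → ‖G z‖ ≤ C) ∧
    (∀ s : Fin n → ℝ, G (fun i => (s i : ℂ)) = ω (List.ofFn fun i => τ (s i) (a i)).prod) ∧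
    G (fun i => Complex.I * u i) = v

/-- `v` is the connected (truncated) function `ω_c(τ_{iu_1}(a_1), …, τ_{iu_n}(a_n))`. The truncated
functions `κ` are determined recursively by `m(S) = ∑_P ∏_{b ∈ P} κ(b)`, the sum over all
partitions `P` of `S`, where `m(S)` is the correlation function of the factors in `S`, in order. -/
def HasConnectedValue (ω : 𝔄 →L[ℂ] ℂ) (τ : ℝ → (𝔄 ≃⋆ₐ[ℂ] 𝔄)) (β : ℝ) {n : ℕ}
    (a : Fin n → 𝔄) (u : Fin n → ℝ) (v : ℂ) : Prop :=
  ∃ m κ : Finset (Fin n) → ℂ,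
    (∀ S : Finset (Fin n), HasImaginaryTimeValue ω τ β
      (fun i : Fin S.card => a (S.orderEmbOfFin rfl i))
      (fun i : Fin S.card => u (S.orderEmbOfFin rfl i)) (m S)) ∧
    (∀ S : Finset (Fin n), m S = ∑ P : Finpartition S, ∏ b ∈ P.parts, κ b) ∧
    κ Finset.univ = v

/-- The open simplex `0 < u_1 < ⋯ < u_n < β`. -/
def openSimplex (n : ℕ) (β : ℝ) : Set (Fin n → ℝ) :=
  {u | StrictMono u ∧ ∀ i, u i ∈ Set.Ioo 0 β}

/-- `v = ω^{βK}(B)`, the value at `B` of Araki's perturbation of the KMS state `ω` by the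
interaction `K`, given by the convergent expansion
`ω(B) + ∑_{n>0} (-1)^n ∫_{0<u_1<⋯<u_n<β} ω_c(B, τ_{iu_1}(K), …, τ_{iu_n}(K)) du`
(the term `n = 0` of the sum below is `ω_c(B) = ω(B)`). The interaction `K` need not be an element
of the algebra: it is the formal limit of elements `K_k` along a filter `l`, and
`ω_c(B, τ_{iu_1}(K), …, τ_{iu_n}(K))` is the limit of `ω_c(B, τ_{iu_1}(K_k), …, τ_{iu_n}(K_k))`. -/
def HasArakiValue (ω : 𝔄 →L[ℂ] ℂ) (τ : ℝ → (𝔄 ≃⋆ₐ[ℂ] 𝔄)) (β : ℝ) {ι : Type*}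
    (K : ι → 𝔄) (l : Filter ι) (B : 𝔄) (v : ℂ) : Prop :=
  ∃ (c : ι → ∀ n : ℕ, (Fin n → ℝ) → ℂ) (cLim : ∀ n : ℕ, (Fin n → ℝ) → ℂ),
    (∀ k n, ∀ u ∈ openSimplex n β,
      HasConnectedValue ω τ β (Fin.cons B fun _ => K k : Fin (n + 1) → 𝔄)
        (Fin.cons 0 u : Fin (n + 1) → ℝ) (c k n u)) ∧
    (∀ n, ∀ u ∈ openSimplex n β, Tendsto (fun k => c k n u) l (𝓝 (cLim n u))) ∧
    (∀ n, IntegrableOn (cLim n) (openSimplex n β)) ∧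
    HasSum (fun n : ℕ => (-1 : ℂ) ^ n * ∫ u in openSimplex n β, cLim n u) v

variable {H : Type*} [NormedAddCommGroup H] [InnerProductSpace ℂ H] [CompleteSpace H]

/-- The partial sums of the second quantization
`K = -∑_i (ψ(f_i) ψ(𝒦 f_i)* + c_i)` of the one-particle operator `𝒦`, where `(f_i)` is an
orthonormal basis and the `c_i` are constants (normal ordering). -/
def interaction {ι : Type*} (ψ : H →ₗ⋆[ℂ] 𝔄) (𝒦 : H →L[ℂ] H) (b : HilbertBasis ι ℂ H) (c : ι → ℝ)
    (s : Finset ι) : 𝔄 :=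
  -∑ i ∈ s, (ψ (b i) * star (ψ (𝒦 (b i))) + algebraMap ℂ 𝔄 (c i : ℂ))

end Araki

end FermiKMS

end

open scoped InnerProductSpace ComplexOrder BoundedContinuousFunction Topology
open MeasureTheory Filter

noncomputable section

namespace FermiKMS

set_option linter.unusedSectionVars false

/-! ### Self-adjoint operators: bounded perturbations and the resolvents at ±i. -/

section Resolvent

variable {H : Type*} [NormedAddCommGroup H] [InnerProductSpace ℂ H] [CompleteSpace H]

/-! Write A = D + 𝒦 and X_D(s) = e^{sD}(1 + e^{βD})⁻¹, a contraction for 0 ≤ s ≤ β (`fermiOp`). The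
kernel G(s) = e^{sD}F_{σ(s)} is, up to sign, the Green's function of d/ds − D on [0, β] with
antiperiodic boundary conditions: it equals −X_D(s) for s > 0 and X_D(β + s) for s < 0, jumps by the
identity at 0, and has norm at most 1. Since X_A solves the same equation with D + 𝒦 in place of D,
the fundamental theorem of calculus gives X_A(s) = X_D(s) − ∫₀^β G(s − t) 𝒦 X_A(t) dt (`duhamel`).
Iterating N times leaves a remainder of norm at most (β‖𝒦‖)^N. At s = 0 the iterated integrals are
the terms of the series, and X(0) + X(β) = 1 for both operators then identifies T(β) with X_A(β)
(`T_beta_eq`). All of this uses only bounded functions of D, whose calculus is built from the Cayley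
transform.

On the CAR algebra, put S = (1 + e^{-βD})⁻¹. The KMS condition is equivalent to the bounded identity
ω(ψ(Sh)* a) = ω(a ψ(h − Sh)*) (`IsKMSState.isAlgKMS`, `IsAlgKMS.isKMSState`). States with this
property are made by resetting finitely many modes to prescribed occupations and taking a weak-*
limit (`exists_algKMS`). They are unique because the identity, with the anticommutation relations,
reduces every word in the fields to shorter ones (`LinKMS.word_eq_zero`); the same reduction is the
Laplace expansion of the determinant (`IsAlgKMS.isQuasifree`). The automorphisms exist because on
finitely many modes they are implemented by unitaries of the algebra
(`norm_eq_of_mem_adjoin_pairs`).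

For products of quadratic elements, carrying one field around the product produces sums over paths
through the factors, with a propagator on each edge; the connected functions are the sums over
closed paths through all factors (`omega_ordProd_quad`). Their continuation to times iu has
propagator G(u_i − u_j). A closed path through the observable and n copies of K is an ordering of
the copies, so the connected function is a sum over permutations, and its integral over the simplex
is the integral of one chain over the cube (`integral_openSimplex_sum_perm`). Hence Araki's
expansion is, term by term, the matrix element of the series for T(β). -/

theorem selfAdjoint_inner {D : H →ₗ.[ℂ] H} (hD : IsSelfAdjoint D) (x y : D.domain) :
    ⟪D x, (y : H)⟫_ℂ = ⟪(x : H), D y⟫_ℂ := by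
  have h := LinearPMap.adjoint_isFormalAdjoint hD.dense_domain
  rw [LinearPMap.isSelfAdjoint_def.mp hD] at h
  exact h x y

theorem selfAdjoint_mem_domain {D : H →ₗ.[ℂ] H} (hD : IsSelfAdjoint D) {y w : H}
    (h : ∀ x : D.domain, ⟪w, (x : H)⟫_ℂ = ⟪y, D x⟫_ℂ) :
    ∃ hy : y ∈ D.domain, D ⟨y, hy⟩ = w := by
  have key : ∃ hy : y ∈ D.adjoint.domain, D.adjoint ⟨y, hy⟩ = w :=
    ⟨LinearPMap.mem_adjoint_domain_of_exists y ⟨w, h⟩,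
      LinearPMap.adjoint_apply_eq hD.dense_domain _ h⟩
  rw [LinearPMap.isSelfAdjoint_def.mp hD] at key
  exact key

/-- As 𝒦 is bounded and symmetric, subtracting 𝒦y turns a vector representing the adjoint of D + 𝒦
at y into one for the adjoint of D, so both adjoints have the same domain. -/
theorem perturbed_isSelfAdjoint {D : H →ₗ.[ℂ] H} (hD : IsSelfAdjoint D) {𝒦 : H →L[ℂ] H}
    (h𝒦 : IsSelfAdjoint 𝒦) : IsSelfAdjoint (perturbed D 𝒦) := by
  have hsymm : ∀ x y : H, ⟪𝒦 x, y⟫_ℂ = ⟪x, 𝒦 y⟫_ℂ := fun x y => by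
    rw [← ContinuousLinearMap.adjoint_inner_right, h𝒦.adjoint_eq]
  have hdense : Dense ((perturbed D 𝒦).domain : Set H) := hD.dense_domain
  rw [LinearPMap.isSelfAdjoint_def]
  apply le_antisymm
  · refine ⟨fun y hy => ?_, ?_⟩
    · have h1 := LinearPMap.adjoint_isFormalAdjoint hdense ⟨y, hy⟩
      refine (selfAdjoint_mem_domain hD (w := (perturbed D 𝒦).adjoint ⟨y, hy⟩ - 𝒦 y) ?_).1
      intro x
      have h2 := h1 x
      have h3 : perturbed D 𝒦 x = 𝒦 x + D x := rfl
      rw [h3, inner_add_right] at h2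
      rw [inner_sub_left, h2, hsymm]
      simp
    · intro x y hxy
      refine LinearPMap.adjoint_apply_eq hdense x fun z => ?_
      have h3 : perturbed D 𝒦 y = 𝒦 y + D y := rfl
      have h4 : perturbed D 𝒦 z = 𝒦 z + D z := rfl
      rw [h3, h4, inner_add_left, inner_add_right, hsymm, hxy]
      congr 1
      exact selfAdjoint_inner hD y z
  · refine LinearPMap.IsFormalAdjoint.le_adjoint hdense fun x y => ?_
    have h3 : perturbed D 𝒦 y = 𝒦 y + D y := rfl
    have h4 : perturbed D 𝒦 x = 𝒦 x + D x := rfl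
    rw [h3, h4, inner_add_left, inner_add_right, hsymm]
    congr 1
    exact selfAdjoint_inner hD x y

/-- `D + c` as a linear map on the domain of `D`. -/
def shift (D : H →ₗ.[ℂ] H) (c : ℂ) : D.domain →ₗ[ℂ] H := D.toFun + c • D.domain.subtype

theorem shift_apply (D : H →ₗ.[ℂ] H) (c : ℂ) (x : D.domain) : shift D c x = D x + c • (x : H) := rfl

/-- The cross term is twice the real part of c⟨Dx, x⟩, which vanishes because c is purely imaginary
and ⟨Dx, x⟩ is real. -/
theorem norm_sq_shift {D : H →ₗ.[ℂ] H} (hD : IsSelfAdjoint D) {c : ℂ} (hc : star c = -c)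
    (x : D.domain) : ‖shift D c x‖ ^ 2 = ‖D x‖ ^ 2 + ‖c‖ ^ 2 * ‖(x : H)‖ ^ 2 := by
  rw [shift_apply, @norm_add_sq ℂ]
  have h : ⟪D x, c • (x : H)⟫_ℂ = c * ⟪D x, (x : H)⟫_ℂ := inner_smul_right _ _ _
  have h2 : (⟪D x, (x : H)⟫_ℂ).im = 0 := by
    have := selfAdjoint_inner hD x x
    have h3 := inner_conj_symm (𝕜 := ℂ) (x : H) (D x)
    rw [← this] at h3
    exact Complex.conj_eq_iff_im.mp h3
  have hc' : c.re = 0 := by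
    have := congrArg Complex.re hc
    simp at this
    linarith
  rw [h, norm_smul]
  simp [h2, hc']
  ring

theorem norm_le_shift {D : H →ₗ.[ℂ] H} (hD : IsSelfAdjoint D) {c : ℂ} (hc : star c = -c)
    (hc1 : ‖c‖ = 1) (x : D.domain) : ‖(x : H)‖ ≤ ‖shift D c x‖ := by
  have := norm_sq_shift hD hc x
  rw [hc1] at this
  nlinarith [norm_nonneg (D x), norm_nonneg (x : H), norm_nonneg (shift D c x)]

theorem norm_le_shift' {D : H →ₗ.[ℂ] H} (hD : IsSelfAdjoint D) {c : ℂ} (hc : star c = -c)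
    (x : D.domain) : ‖D x‖ ≤ ‖shift D c x‖ := by
  have := norm_sq_shift hD hc x
  have h2 : 0 ≤ ‖c‖ ^ 2 * ‖(x : H)‖ ^ 2 := by positivity
  exact (sq_le_sq₀ (norm_nonneg _) (norm_nonneg _)).mp (by linarith)

/-- The range is closed because x and Dx are both controlled by (D + c)x. A vector y orthogonal to
the range lies in the domain with Dy = cy, and the norm identity for −c then gives 0 = 2‖y‖². -/
theorem shift_surjective {D : H →ₗ.[ℂ] H} (hD : IsSelfAdjoint D) {c : ℂ} (hc : star c = -c)
    (hc1 : ‖c‖ = 1) : Function.Surjective (shift D c) := by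
  rw [← LinearMap.range_eq_top]
  have hclosed : IsClosed ((LinearMap.range (shift D c) : Submodule ℂ H) : Set H) := by
    rw [← isSeqClosed_iff_isClosed]
    intro y y₀ hy hlim
    choose x hx using hy
    have hcau : CauchySeq y := hlim.cauchySeq
    have hsub : ∀ m n, shift D c (x m - x n) = y m - y n := fun m n => by
      rw [map_sub, hx, hx]
    have hx1 : CauchySeq fun n => (x n : H) := by
      rw [Metric.cauchySeq_iff] at hcau ⊢
      intro ε hε
      obtain ⟨N, hN⟩ := hcau ε hε
      refine ⟨N, fun m hm n hn => lt_of_le_of_lt ?_ (hN m hm n hn)⟩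
      rw [dist_eq_norm, dist_eq_norm, ← hsub]
      exact norm_le_shift hD hc hc1 (x m - x n)
    have hx2 : CauchySeq fun n => D (x n) := by
      rw [Metric.cauchySeq_iff] at hcau ⊢
      intro ε hε
      obtain ⟨N, hN⟩ := hcau ε hε
      refine ⟨N, fun m hm n hn => lt_of_le_of_lt ?_ (hN m hm n hn)⟩
      rw [dist_eq_norm, dist_eq_norm, ← hsub, ← LinearPMap.map_sub]
      exact norm_le_shift' hD hc (x m - x n)
    obtain ⟨x₀, hx₀⟩ := cauchySeq_tendsto_of_complete hx1
    obtain ⟨w, hw⟩ := cauchySeq_tendsto_of_complete hx2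
    -- Self-adjoint operators are closed: the symmetry relation passes to the limit pair (x₀, w).
    obtain ⟨hmem, hval⟩ := selfAdjoint_mem_domain hD (y := x₀) (w := w) (by
      intro z
      have h1 : Tendsto (fun n => ⟪D (x n), (z : H)⟫_ℂ) atTop (𝓝 ⟪w, (z : H)⟫_ℂ) :=
        hw.inner tendsto_const_nhds
      have h2 : Tendsto (fun n => ⟪(x n : H), D z⟫_ℂ) atTop (𝓝 ⟪x₀, D z⟫_ℂ) :=
        hx₀.inner tendsto_const_nhds
      refine tendsto_nhds_unique h1 (h2.congr fun n => (selfAdjoint_inner hD _ _).symm))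
    refine ⟨⟨x₀, hmem⟩, ?_⟩
    rw [shift_apply, hval]
    refine tendsto_nhds_unique ((hw.add (hx₀.const_smul c)).congr fun n => ?_) hlim
    rw [← hx n, shift_apply]
  have : CompleteSpace (LinearMap.range (shift D c)) := hclosed.completeSpace_coe
  rw [← Submodule.orthogonal_eq_bot_iff, Submodule.eq_bot_iff]
  intro y hy
  rw [Submodule.mem_orthogonal'] at hy
  obtain ⟨hmem, hval⟩ := selfAdjoint_mem_domain hD (y := y) (w := c • y) (by
    intro x
    have h := hy _ ⟨x, rfl⟩
    rw [shift_apply, inner_add_right, inner_smul_right] at h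
    rw [inner_smul_left]
    have : (starRingEnd ℂ) c = -c := hc
    rw [this]
    linear_combination -h)
  have hz := norm_sq_shift hD (c := -c) (by rw [star_neg, hc]) ⟨y, hmem⟩
  rw [shift_apply, hval] at hz
  simp only [neg_smul, add_neg_cancel, norm_zero, norm_neg, hc1, norm_smul] at hz
  have : ‖y‖ ^ 2 = 0 := by nlinarith [sq_nonneg ‖y‖]
  simpa using this

/-- The resolvent `(D + c)⁻¹`, for `c = ± i`. -/
theorem exists_resolvent {D : H →ₗ.[ℂ] H} (hD : IsSelfAdjoint D) {c : ℂ} (hc : star c = -c)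
    (hc1 : ‖c‖ = 1) : ∃ R : H →L[ℂ] H, (∀ x : D.domain, R (shift D c x) = x) ∧
      ∀ y, ∃ h : R y ∈ D.domain, shift D c ⟨R y, h⟩ = y := by
  have hinj : Function.Injective (shift D c) := by
    rw [injective_iff_map_eq_zero]
    intro x hx
    have := norm_le_shift hD hc hc1 x
    rw [hx, norm_zero] at this
    exact Subtype.ext (norm_le_zero_iff.mp this)
  let e := LinearEquiv.ofBijective (shift D c) ⟨hinj, shift_surjective hD hc hc1⟩
  have he : ∀ x, e x = shift D c x := fun _ => rfl
  let R : H →L[ℂ] H := (D.domain.subtype ∘ₗ e.symm.toLinearMap).mkContinuous 1 (by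
    intro y
    obtain ⟨x, rfl⟩ := e.surjective y
    have := norm_le_shift hD hc hc1 x
    rw [← he] at this
    simpa using this)
  have hR : ∀ y, R y = (e.symm y : H) := fun _ => rfl
  refine ⟨R, fun x => ?_, fun y => ?_⟩
  · rw [hR, ← he, e.symm_apply_apply]
  · refine ⟨by rw [hR]; exact (e.symm y).2, ?_⟩
    have : (⟨R y, by rw [hR]; exact (e.symm y).2⟩ : D.domain) = e.symm y := rfl
    rw [this, ← he, e.apply_symm_apply]

end Resolvent

/-! ### The Cayley transform between the unit circle and the real line. -/

section Cayley

/-- The inverse Cayley transform of a point of the unit circle. -/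
def invCayley (w : ℂ) : ℝ := (Complex.I * (1 + w) / (1 - w)).re

/-- The function on the circle that corresponds to `4 f(x) / (x² + 1)` on the line. -/
def cayleyFn (f : ℝ → ℂ) (w : ℂ) : ℂ := f (invCayley w) * (star (1 - w) * (1 - w))

/-- Infinity on the line corresponds to w = 1, where f has no limit in general; the factor |1 − w|²
forces the value 0 there because f is bounded. -/
theorem cayleyFn_continuous {f : ℝ → ℂ} (hf : Continuous f) (hb : ∃ C : ℝ, ∀ x, ‖f x‖ ≤ C) :
    Continuous (cayleyFn f) := by
  obtain ⟨C, hC⟩ := hb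
  rw [continuous_iff_continuousAt]
  intro w
  by_cases hw : w = 1
  · subst hw
    have h0 : cayleyFn f 1 = 0 := by simp [cayleyFn]
    rw [ContinuousAt, h0, tendsto_zero_iff_norm_tendsto_zero]
    have h1 : Tendsto (fun w : ℂ => C * (‖star (1 - w) * (1 - w)‖)) (𝓝 1) (𝓝 0) := by
      have : Continuous fun w : ℂ => C * (‖star (1 - w) * (1 - w)‖) := by fun_prop
      have h2 := this.tendsto 1
      simpa using h2
    refine squeeze_zero (fun _ => norm_nonneg _) (fun w => ?_) h1
    rw [cayleyFn, norm_mul]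
    gcongr
    exact hC _
  · have h1 : ContinuousAt invCayley w := by
      unfold invCayley
      have : (1 - w) ≠ 0 := sub_ne_zero.mpr (Ne.symm hw)
      refine Complex.continuous_re.continuousAt.comp ?_
      fun_prop (disch := assumption)
    unfold cayleyFn
    have h2 : ContinuousAt (fun w => f (invCayley w)) w := hf.continuousAt.comp h1
    have h3 : ContinuousAt (fun w : ℂ => star (1 - w) * (1 - w)) w := by fun_prop
    exact h2.mul h3

/-- On the circle i(1 + w)/(1 − w) is real, so taking the real part changes nothing, and x + i =
2i/(1 − w). -/
theorem cayleyFn_resolventFn {w : ℂ} (hw : w ∈ Metric.sphere (0 : ℂ) 1) :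
    cayleyFn resolventFn w = (1 - w) / (2 * Complex.I) * cayleyFn 1 w := by
  have hr : ∀ x, resolventFn x = ((x : ℂ) + Complex.I)⁻¹ := fun _ => rfl
  by_cases h1 : w = 1
  · simp [cayleyFn, h1]
  have h2 : (1 - w) ≠ 0 := sub_ne_zero.mpr (Ne.symm h1)
  have hw' : w * (starRingEnd ℂ) w = 1 := by
    rw [Complex.mul_conj, Complex.normSq_eq_norm_sq]
    simp at hw
    simp [hw]
  have hx : (invCayley w : ℂ) = Complex.I * (1 + w) / (1 - w) := by
    unfold invCayley
    apply Complex.conj_eq_iff_re.mp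
    have h3 : (1 - (starRingEnd ℂ) w) ≠ 0 := by
      intro h
      apply h2
      have := congrArg (starRingEnd ℂ) h
      simpa using this
    simp only [map_div₀, map_mul, map_add, map_sub, map_one, Complex.conj_I]
    rw [div_eq_div_iff h3 h2]
    linear_combination 2 * Complex.I * hw'
  rw [cayleyFn, cayleyFn, hr, hx]
  have : Complex.I * (1 + w) / (1 - w) + Complex.I = 2 * Complex.I / (1 - w) := by
    field_simp
    ring
  rw [this, inv_div]
  simp

end Cayley

/-! ### Functional calculus of an unbounded self-adjoint operator. -/

section Construction

variable {H : Type*} [NormedAddCommGroup H] [InnerProductSpace ℂ H] [CompleteSpace H]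

/-- `4 f(D) / (D² + 1)` in terms of the Cayley transform `U` of `D`. -/
def cayleyOp (U : H →L[ℂ] H) (f : ℝ → ℂ) : H →L[ℂ] H := cfc (cayleyFn f) U

/-- Bounded continuous functions, as a predicate. -/
def BddCont (f : ℝ → ℂ) : Prop := Continuous f ∧ ∃ C : ℝ, ∀ x, ‖f x‖ ≤ C

theorem BddCont.cayley {f : ℝ → ℂ} (hf : BddCont f) (s : Set ℂ) : ContinuousOn (cayleyFn f) s :=
  (cayleyFn_continuous hf.1 hf.2).continuousOn

theorem bddCont_coe (f : ℝ →ᵇ ℂ) : BddCont f := ⟨f.continuous, ‖f‖, f.norm_coe_le_norm⟩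

theorem bddCont_one : BddCont 1 := ⟨continuous_const, 1, by simp⟩

/-- Multiplicativity in weighted form: each side carries the weight |1 − w|² twice. -/
theorem cayleyOp_mul (U : H →L[ℂ] H) {f g : ℝ → ℂ} (hf : BddCont f) (hg : BddCont g) :
    cayleyOp U f * cayleyOp U g = cayleyOp U (f * g) * cayleyOp U 1 := by
  have hfg : BddCont (f * g) := by
    obtain ⟨h1, C, hC⟩ := hf
    obtain ⟨h2, C', hC'⟩ := hg
    refine ⟨h1.mul h2, C * C', fun x => ?_⟩
    rw [Pi.mul_apply, norm_mul]
    exact mul_le_mul (hC x) (hC' x) (norm_nonneg _) ((norm_nonneg _).trans (hC x))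
  unfold cayleyOp
  rw [← cfc_mul _ _ _ (hf.cayley _) (hg.cayley _), ← cfc_mul _ _ _ (hfg.cayley _) (bddCont_one.cayley _)]
  congr 1
  ext w
  simp only [cayleyFn, Pi.mul_apply, Pi.one_apply]
  ring

theorem cayleyOp_comm (U : H →L[ℂ] H) (f g : ℝ → ℂ) :
    cayleyOp U f * cayleyOp U g = cayleyOp U g * cayleyOp U f :=
  cfc_commute_cfc _ _ _

theorem cayleyOp_star (U : H →L[ℂ] H) (f : ℝ → ℂ) :
    star (cayleyOp U f) = cayleyOp U (star f) := by
  unfold cayleyOp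
  rw [← cfc_star]
  congr 1
  ext w
  simp only [cayleyFn, Pi.star_apply, star_mul, star_star]
  ring

theorem cayleyOp_add (U : H →L[ℂ] H) {f g : ℝ → ℂ} (hf : BddCont f) (hg : BddCont g) :
    cayleyOp U (f + g) = cayleyOp U f + cayleyOp U g := by
  unfold cayleyOp
  rw [← cfc_add _ _ _ (hf.cayley _) (hg.cayley _)]
  congr 1
  ext w
  simp only [cayleyFn, Pi.add_apply]
  ring

theorem cayleyOp_smul (U : H →L[ℂ] H) (c : ℂ) {f : ℝ → ℂ} (hf : BddCont f) :
    cayleyOp U (c • f) = c • cayleyOp U f := by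
  unfold cayleyOp
  rw [← cfc_smul _ _ _ (hf.cayley _)]
  congr 1
  ext w
  simp only [cayleyFn, Pi.smul_apply, smul_eq_mul]
  ring

/-- With g = √(C² − |f|²) the weighted operators satisfy f*f + g*g = C²·1*1, so ‖f x‖² + ‖g x‖² =
C²‖1 x‖². This bound lets f(D) be extended from the range of the weight. -/
theorem norm_cayleyOp_apply_le (U : H →L[ℂ] H) {f : ℝ → ℂ} (hf : Continuous f) {C : ℝ}
    (hC : ∀ x, ‖f x‖ ≤ C) (x : H) : ‖cayleyOp U f x‖ ≤ C * ‖cayleyOp U 1 x‖ := by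
  have hC0 : 0 ≤ C := (norm_nonneg _).trans (hC 0)
  let g : ℝ → ℂ := fun t => (Real.sqrt (C ^ 2 - ‖f t‖ ^ 2) : ℂ)
  have hg : BddCont g := by
    refine ⟨by fun_prop, C, fun t => ?_⟩
    simp only [g, Complex.norm_real, Real.norm_eq_abs, abs_of_nonneg (Real.sqrt_nonneg _)]
    exact Real.sqrt_le_iff.mpr ⟨hC0, by nlinarith [norm_nonneg (f t)]⟩
  have hf' : BddCont f := ⟨hf, C, hC⟩
  have hsum : star (cayleyOp U f) * cayleyOp U f + star (cayleyOp U g) * cayleyOp U g =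
      ((C : ℂ) ^ 2) • (star (cayleyOp U 1) * cayleyOp U 1) := by
    unfold cayleyOp
    simp only [← cfc_star]
    have hc : ∀ {k : ℝ → ℂ}, BddCont k →
        ContinuousOn (fun w => star (cayleyFn k w) * cayleyFn k w) (spectrum ℂ U) :=
      fun hk => ((hk.cayley _).star).mul (hk.cayley _)
    rw [← cfc_mul _ _ _ ((hf'.cayley _).star) (hf'.cayley _),
      ← cfc_mul _ _ _ ((hg.cayley _).star) (hg.cayley _),
      ← cfc_mul _ _ _ ((bddCont_one.cayley _).star) (bddCont_one.cayley _),
      ← cfc_add _ _ _ (hc hf') (hc hg), ← cfc_smul _ _ _ (hc bddCont_one)]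
    congr 1
    ext w
    have h1 : star (f (invCayley w)) * f (invCayley w) + star (g (invCayley w)) * g (invCayley w)
        = (C : ℂ) ^ 2 := by
      have h2 : star (f (invCayley w)) * f (invCayley w) = ((‖f (invCayley w)‖ ^ 2 : ℝ) : ℂ) := by
        rw [mul_comm]
        simpa using Complex.mul_conj' (f (invCayley w))
      have h3 : star (g (invCayley w)) * g (invCayley w) =
          ((C ^ 2 - ‖f (invCayley w)‖ ^ 2 : ℝ) : ℂ) := by
        simp only [g, RCLike.star_def, Complex.conj_ofReal]
        rw [← Complex.ofReal_mul, Real.mul_self_sqrt]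
        have := hC (invCayley w)
        nlinarith [norm_nonneg (f (invCayley w))]
      rw [h2, h3]
      push_cast
      ring
    simp only [cayleyFn, star_mul, star_star, smul_eq_mul, Pi.one_apply, star_one]
    linear_combination ((1 - w) * star (1 - w) * (star (1 - w) * (1 - w))) * h1
  have h2 := congrArg (fun A : H →L[ℂ] H => (⟪x, A x⟫_ℂ).re) hsum
  simp only [_root_.add_apply, _root_.smul_apply,
    mul_apply_eq_comp, ContinuousLinearMap.star_eq_adjoint, inner_add_right,
    inner_smul_right, ContinuousLinearMap.adjoint_inner_right] at h2
  simp only [inner_self_eq_norm_sq_to_K, Complex.coe_algebraMap] at h2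
  simp only [Complex.add_re, Complex.mul_re, ← Complex.ofReal_pow, Complex.ofReal_re,
    Complex.ofReal_im] at h2
  have h3 : ‖cayleyOp U f x‖ ^ 2 ≤ (C * ‖cayleyOp U 1 x‖) ^ 2 := by
    rw [mul_pow]
    nlinarith [sq_nonneg ‖cayleyOp U g x‖]
  exact (sq_le_sq₀ (norm_nonneg _) (by positivity)).mp h3

/-- The functional calculus of a unitary operator without eigenvalue `1`, pulled back to the real
line. -/
theorem exists_calculus_of_unitary {U R : H →L[ℂ] H} (hU : U ∈ unitary (H →L[ℂ] H))
    (hR : R = (2 * Complex.I)⁻¹ • (1 - U)) (hdense : DenseRange (star R * R)) :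
    ∃ Φ : (ℝ →ᵇ ℂ) →⋆ₐ[ℂ] (H →L[ℂ] H), Φ resolventFn = R := by
  have hnU : IsStarNormal U := ⟨by
    rw [commute_iff_eq, hU.1, hU.2]⟩
  have hc : ContinuousOn (fun w : ℂ => (2 * Complex.I)⁻¹ * (1 - w)) (spectrum ℂ U) := by fun_prop
  have hRcfc : R = cfc (fun w => (2 * Complex.I)⁻¹ * (1 - w)) U := by
    have h1 : ContinuousOn (fun w : ℂ => 1 - w) (spectrum ℂ U) := by fun_prop
    rw [cfc_const_mul _ _ _ h1, cfc_sub (fun _ => 1) (fun w => w) U, cfc_const_one ℂ U, cfc_id' ℂ U, hR]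
  have hc' : ContinuousOn (fun w : ℂ => star ((2 * Complex.I)⁻¹ * (1 - w)) *
      ((2 * Complex.I)⁻¹ * (1 - w))) (spectrum ℂ U) := hc.star.mul hc
  have hone : cayleyOp U 1 = (4 : ℂ) • (star R * R) := by
    rw [hRcfc, ← cfc_star, ← cfc_mul _ _ _ hc.star hc, ← cfc_smul _ _ _ hc', cayleyOp]
    congr 1
    ext w
    simp only [cayleyFn, Pi.one_apply, star_mul, smul_eq_mul]
    simp
    ring_nf
    simp
    ring
  have hd : DenseRange (cayleyOp U 1) := by
    refine hdense.mono ?_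
    rintro _ ⟨x, rfl⟩
    refine ⟨(4 : ℂ)⁻¹ • x, ?_⟩
    rw [hone, map_smul, _root_.smul_apply, smul_smul]
    norm_num
  have hd2 : DenseRange (cayleyOp U 1 * cayleyOp U 1) := by
    have : ⇑(cayleyOp U 1 * cayleyOp U 1) = cayleyOp U 1 ∘ cayleyOp U 1 := rfl
    rw [this]
    exact hd.comp hd (cayleyOp U 1).continuous
  -- The weight a = `cayleyOp U 1` has dense range, hence so has a². All algebraic identities are
  -- therefore checked after multiplication by a² from the right.
  have hext : ∀ {A B : H →L[ℂ] H}, A * (cayleyOp U 1 * cayleyOp U 1) =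
      B * (cayleyOp U 1 * cayleyOp U 1) → A = B := fun {A B} h => by
    ext x
    refine congrFun (hd2.equalizer A.continuous B.continuous ?_) x
    ext y
    exact congrArg (fun C : H →L[ℂ] H => C y) h
  -- f(D) is the bounded operator with f(D) a = `cayleyOp U f`, determined on the dense range of a.
  let Φ₀ : (ℝ →ᵇ ℂ) → (H →L[ℂ] H) := fun f =>
    LinearMap.extendOfNorm (cayleyOp U f : H →ₗ[ℂ] H) (cayleyOp U 1 : H →ₗ[ℂ] H)
  have hΦ : ∀ f, Φ₀ f * cayleyOp U 1 = cayleyOp U f := fun f => by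
    ext x
    exact LinearMap.extendOfNorm_eq (f := (cayleyOp U f : H →ₗ[ℂ] H))
      (e := (cayleyOp U 1 : H →ₗ[ℂ] H)) hd
      ⟨‖f‖, norm_cayleyOp_apply_le U f.continuous f.norm_coe_le_norm⟩ x
  have hΦ2 : ∀ f, Φ₀ f * (cayleyOp U 1 * cayleyOp U 1) = cayleyOp U f * cayleyOp U 1 := fun f => by
    rw [← mul_assoc, hΦ]
  refine ⟨
    { toFun := Φ₀
      map_one' := hext ?_
      map_mul' := fun f g => hext ?_
      map_zero' := hext ?_
      map_add' := fun f g => hext ?_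
      commutes' := fun c => hext ?_
      map_star' := fun f => ?_ }, hext ?_⟩
  · rw [hΦ2, one_mul]; rfl
  · rw [hΦ2, mul_assoc, ← mul_assoc (Φ₀ g), hΦ, cayleyOp_comm U g, ← mul_assoc, hΦ,
      cayleyOp_mul U (bddCont_coe f) (bddCont_coe g)]
    rfl
  · rw [hΦ2, zero_mul]
    have : cayleyOp U ((0 : ℝ →ᵇ ℂ) : ℝ → ℂ) = 0 := by
      have := cayleyOp_smul U 0 (bddCont_coe 0)
      simpa using this
    rw [this, zero_mul]
  · rw [hΦ2, add_mul, hΦ2, hΦ2, ← add_mul, ← cayleyOp_add U (bddCont_coe f) (bddCont_coe g)]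
    rfl
  · rw [hΦ2, Algebra.algebraMap_eq_smul_one, Algebra.algebraMap_eq_smul_one, smul_mul_assoc,
      one_mul, ← smul_mul_assoc, ← cayleyOp_smul U c bddCont_one]
    rfl
  · refine hext ?_
    -- Taking adjoints puts the self-adjoint weight a on the left; it is cancelled there by taking
    -- adjoints once more.
    have h1 : cayleyOp U 1 * star (Φ₀ f) = cayleyOp U (star f) := by
      have h2 := congrArg star (hΦ f)
      rw [star_mul, cayleyOp_star, cayleyOp_star] at h2
      simpa using h2
    have hs : star (cayleyOp U (1 : ℝ → ℂ)) = cayleyOp U 1 := by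
      rw [cayleyOp_star, star_one]
    have h3 : cayleyOp U 1 * (star (Φ₀ f) * cayleyOp U 1) = cayleyOp U 1 * cayleyOp U (star f) := by
      rw [← mul_assoc, h1, cayleyOp_comm]
    have hinj : ∀ {A B : H →L[ℂ] H}, cayleyOp U 1 * A = cayleyOp U 1 * B → A = B := fun {A B} h => by
      have h5 : star A * (cayleyOp U 1 * cayleyOp U 1) = star B * (cayleyOp U 1 * cayleyOp U 1) := by
        have h4 := congrArg star h
        rw [star_mul, star_mul, hs] at h4
        rw [← mul_assoc, h4, mul_assoc]
      exact star_injective (hext h5)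
    rw [hΦ2, ← mul_assoc, hinj h3]
    rfl
  · change Φ₀ resolventFn * _ = _
    rw [hΦ2, ← mul_assoc]
    congr 1
    rw [hRcfc, cayleyOp, cayleyOp, ← cfc_mul _ _ _ hc (bddCont_one.cayley _)]
    refine cfc_congr fun w hw => ?_
    rw [cayleyFn_resolventFn (spectrum.subset_circle_of_unitary hU hw)]
    ring

/-- The resolvents R = (D + i)⁻¹ and R' = (D − i)⁻¹ are adjoint to each other, and R − R' = −2i R'R
= −2i RR' is exactly the unitarity of U = 1 − 2iR. Both have range dom D, so R'R has dense range. -/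
theorem exists_functionalCalculus {D : H →ₗ.[ℂ] H} (hD : IsSelfAdjoint D) :
    ∃ Φ, IsFunctionalCalculus D Φ := by
  obtain ⟨R, hR1, hR2⟩ := exists_resolvent hD (c := Complex.I) (by simp) (by simp)
  obtain ⟨R', hR'1, hR'2⟩ := exists_resolvent hD (c := -Complex.I) (by simp) (by simp)
  have hadj : star R = R' := by
    rw [ContinuousLinearMap.star_eq_adjoint, eq_comm, ContinuousLinearMap.eq_adjoint_iff]
    intro a b
    obtain ⟨ha, ha'⟩ := hR'2 a
    obtain ⟨hb, hb'⟩ := hR2 b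
    conv_rhs => rw [← ha']
    conv_lhs => rw [← hb']
    have := selfAdjoint_inner hD ⟨R' a, ha⟩ ⟨R b, hb⟩
    rw [shift_apply, shift_apply, inner_add_left, inner_add_right, inner_smul_left, inner_smul_right,
      this]
    simp
  have hc1 : R - R' = (-2 * Complex.I) • (R' * R) := by
    ext b
    obtain ⟨hb, hb'⟩ := hR2 b
    have h2 : shift D (-Complex.I) ⟨R b, hb⟩ = b - (2 * Complex.I) • R b := by
      conv_rhs => rw [← hb']
      rw [hb', shift_apply]
      rw [shift_apply] at hb'
      rw [eq_sub_iff_add_eq]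
      conv_rhs => rw [← hb']
      module
    have h3 := hR'1 ⟨R b, hb⟩
    rw [h2, map_sub, map_smul] at h3
    have h3' : R' b - (2 * Complex.I) • R' (R b) = R b := h3
    simp only [_root_.sub_apply, _root_.smul_apply,
      mul_apply_eq_comp]
    rw [← h3']
    conv_rhs => rw [h3']
    module
  have hc2 : R - R' = (-2 * Complex.I) • (R * R') := by
    ext b
    obtain ⟨hb, hb'⟩ := hR'2 b
    have h2 : shift D Complex.I ⟨R' b, hb⟩ = b + (2 * Complex.I) • R' b := by
      rw [shift_apply]
      rw [shift_apply] at hb'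
      calc _ = (D ⟨R' b, hb⟩ + -Complex.I • R' b) + (2 * Complex.I) • R' b := by module
        _ = _ := by rw [hb']
    have h3 := hR1 ⟨R' b, hb⟩
    rw [h2, map_add, map_smul] at h3
    have h3' : R b + (2 * Complex.I) • R (R' b) = R' b := h3
    simp only [_root_.sub_apply, _root_.smul_apply,
      mul_apply_eq_comp]
    rw [← h3']
    conv_rhs => rw [h3']
    module
  have hsU : star (1 - (2 * Complex.I) • R) = 1 + (2 * Complex.I) • R' := by
    rw [star_sub, star_one, star_smul, hadj]
    simp
  have hI : (2 * Complex.I) * (2 * Complex.I) = -4 := by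
    linear_combination 4 * Complex.I_mul_I
  obtain ⟨Φ, hΦ⟩ := exists_calculus_of_unitary (U := 1 - (2 * Complex.I) • R) (R := R) (by
      rw [Unitary.mem_iff, hsU]
      constructor
      · have : (1 + (2 * Complex.I) • R') * (1 - (2 * Complex.I) • R) =
            1 - (2 * Complex.I) • (R - R') - ((2 * Complex.I) * (2 * Complex.I)) • (R' * R) := by
          simp only [add_mul, mul_sub, one_mul, mul_one, smul_mul_smul_comm, smul_sub]
          abel
        rw [this, hc1, smul_smul]
        have h4 : 2 * Complex.I * (-2 * Complex.I) = 4 := by linear_combination -hI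
        rw [h4, hI]
        module
      · have : (1 - (2 * Complex.I) • R) * (1 + (2 * Complex.I) • R') =
            1 - (2 * Complex.I) • (R - R') - ((2 * Complex.I) * (2 * Complex.I)) • (R * R') := by
          simp only [sub_mul, mul_add, one_mul, mul_one, smul_mul_smul_comm, smul_sub]
          abel
        rw [this, hc2, smul_smul]
        have h4 : 2 * Complex.I * (-2 * Complex.I) = 4 := by linear_combination -hI
        rw [h4, hI]
        module) (by
      rw [sub_sub_cancel, smul_smul, inv_mul_cancel₀ (by simp), one_smul]) (by
      have hrange : ∀ T : H →L[ℂ] H, ∀ c : ℂ, (∀ x : D.domain, T (shift D c x) = x) → DenseRange T :=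
        fun T c hT => hD.dense_domain.mono fun x hx => ⟨_, hT ⟨x, hx⟩⟩
      rw [hadj]
      exact (hrange R' _ hR'1).comp (hrange R _ hR1) R'.continuous)
  exact ⟨Φ, fun x => by rw [hΦ]; exact hR2 x⟩

end Construction

/-! ### Algebraic rules and strong continuity of f(D). -/

section OpFun

theorem BddCont.mul {f g : ℝ → ℂ} (hf : BddCont f) (hg : BddCont g) :
    BddCont (fun x => f x * g x) := by
  obtain ⟨h1, C, hC⟩ := hf
  obtain ⟨h2, C', hC'⟩ := hg
  refine ⟨h1.mul h2, C * C', fun x => ?_⟩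
  rw [norm_mul]
  exact mul_le_mul (hC x) (hC' x) (norm_nonneg _) ((norm_nonneg _).trans (hC x))

theorem BddCont.add {f g : ℝ → ℂ} (hf : BddCont f) (hg : BddCont g) :
    BddCont (fun x => f x + g x) := by
  obtain ⟨h1, C, hC⟩ := hf
  obtain ⟨h2, C', hC'⟩ := hg
  exact ⟨h1.add h2, C + C', fun x => (norm_add_le _ _).trans (add_le_add (hC x) (hC' x))⟩

theorem bddCont_const (c : ℂ) : BddCont (fun _ => c) := ⟨continuous_const, ‖c‖, fun _ => le_rfl⟩

theorem BddCont.const_mul (c : ℂ) {f : ℝ → ℂ} (hf : BddCont f) : BddCont (fun x => c * f x) :=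
  (bddCont_const c).mul hf

theorem BddCont.sub {f g : ℝ → ℂ} (hf : BddCont f) (hg : BddCont g) :
    BddCont (fun x => f x - g x) := by
  simpa [sub_eq_add_neg] using hf.add (hg.const_mul (-1))

theorem BddCont.star {f : ℝ → ℂ} (hf : BddCont f) : BddCont (fun x => star (f x)) := by
  obtain ⟨h1, C, hC⟩ := hf
  exact ⟨h1.star, C, fun x => by simpa using hC x⟩

theorem bddCont_resolventFn : BddCont (fun x : ℝ => ((x : ℂ) + Complex.I)⁻¹) :=
  bddCont_coe resolventFn

variable {H : Type*} [NormedAddCommGroup H] [InnerProductSpace ℂ H] [CompleteSpace H]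
variable {D : H →ₗ.[ℂ] H}

/-- A bounded continuous function as an element of the algebra of those functions. -/
def BddCont.toBCF {f : ℝ → ℂ} (hf : BddCont f) : ℝ →ᵇ ℂ :=
  BoundedContinuousFunction.ofNormedAddCommGroup f hf.1 hf.2.choose hf.2.choose_spec

theorem opFun_eq (hD : IsSelfAdjoint D) {f : ℝ → ℂ} (hf : BddCont f) :
    opFun D f = (exists_functionalCalculus hD).choose hf.toBCF := by
  have h : (∃ Φ, IsFunctionalCalculus D Φ) ∧ Continuous f ∧ ∃ C : ℝ, ∀ x, ‖f x‖ ≤ C :=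
    ⟨exists_functionalCalculus hD, hf⟩
  rw [opFun, dif_pos h]
  rfl

theorem opFun_mul (hD : IsSelfAdjoint D) {f g : ℝ → ℂ} (hf : BddCont f) (hg : BddCont g) :
    opFun D (fun x => f x * g x) = opFun D f * opFun D g := by
  rw [opFun_eq hD hf, opFun_eq hD hg, opFun_eq hD (hf.mul hg), ← map_mul]
  rfl

theorem opFun_add (hD : IsSelfAdjoint D) {f g : ℝ → ℂ} (hf : BddCont f) (hg : BddCont g) :
    opFun D (fun x => f x + g x) = opFun D f + opFun D g := by
  rw [opFun_eq hD hf, opFun_eq hD hg, opFun_eq hD (hf.add hg), ← map_add]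
  rfl

theorem opFun_const_mul (hD : IsSelfAdjoint D) (c : ℂ) {f : ℝ → ℂ} (hf : BddCont f) :
    opFun D (fun x => c * f x) = c • opFun D f := by
  rw [opFun_eq hD hf, opFun_eq hD (hf.const_mul c), ← map_smul]
  rfl

theorem opFun_one (hD : IsSelfAdjoint D) : opFun D (fun _ => 1) = 1 := by
  rw [opFun_eq hD (bddCont_const 1), ← map_one (exists_functionalCalculus hD).choose]
  rfl

theorem opFun_sub (hD : IsSelfAdjoint D) {f g : ℝ → ℂ} (hf : BddCont f) (hg : BddCont g) :
    opFun D (fun x => f x - g x) = opFun D f - opFun D g := by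
  rw [opFun_eq hD hf, opFun_eq hD hg, opFun_eq hD (hf.sub hg), ← map_sub]
  rfl

theorem opFun_neg (hD : IsSelfAdjoint D) {f : ℝ → ℂ} (hf : BddCont f) :
    opFun D (fun x => -f x) = -opFun D f := by
  have := opFun_const_mul hD (-1) hf
  simpa using this

theorem opFun_star (hD : IsSelfAdjoint D) {f : ℝ → ℂ} (hf : BddCont f) :
    opFun D (fun x => star (f x)) = star (opFun D f) := by
  rw [opFun_eq hD hf, opFun_eq hD hf.star, ← map_star]
  rfl

theorem norm_opFun_le (hD : IsSelfAdjoint D) {f : ℝ → ℂ} (hf : Continuous f) {C : ℝ}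
    (hC : ∀ x, ‖f x‖ ≤ C) : ‖opFun D f‖ ≤ C := by
  have hf' : BddCont f := ⟨hf, C, hC⟩
  rw [opFun_eq hD hf']
  refine (NonUnitalStarAlgHom.norm_apply_le _ _).trans ?_
  exact (BoundedContinuousFunction.norm_le ((norm_nonneg _).trans (hC 0))).mpr hC

theorem opFun_inner (hD : IsSelfAdjoint D) {f : ℝ → ℂ} (hf : BddCont f) (x y : H) :
    ⟪opFun D f x, y⟫_ℂ = ⟪x, opFun D (fun t => star (f t)) y⟫_ℂ := by
  rw [opFun_star hD hf, ContinuousLinearMap.star_eq_adjoint,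
    ContinuousLinearMap.adjoint_inner_right]

theorem opFun_resolvent_mem (hD : IsSelfAdjoint D) (y : H) :
    ∃ h : opFun D (fun x : ℝ => ((x : ℂ) + Complex.I)⁻¹) y ∈ D.domain,
      D ⟨_, h⟩ = y - Complex.I • opFun D (fun x : ℝ => ((x : ℂ) + Complex.I)⁻¹) y := by
  rw [opFun_eq hD bddCont_resolventFn]
  obtain ⟨h, h'⟩ := (exists_functionalCalculus hD).choose_spec y
  exact ⟨h, eq_sub_of_add_eq h'⟩

theorem opFun_resolvent_apply (hD : IsSelfAdjoint D) (y : D.domain) :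
    opFun D (fun x : ℝ => ((x : ℂ) + Complex.I)⁻¹) (D y + Complex.I • (y : H)) = y := by
  obtain ⟨h, h'⟩ := opFun_resolvent_mem hD (D y + Complex.I • (y : H))
  set z : D.domain := ⟨_, h⟩
  have h2 : shift D Complex.I (z - y) = 0 := by
    rw [map_sub, shift_apply, shift_apply, h']
    simp only [z]
    abel
  have := norm_le_shift hD (c := Complex.I) (by simp) (by simp) (z - y)
  rw [h2, norm_zero] at this
  have h3 : z - y = 0 := Subtype.ext (norm_le_zero_iff.mp this)
  exact congrArg Subtype.val (sub_eq_zero.mp h3)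

theorem denseRange_resolvent (hD : IsSelfAdjoint D) :
    DenseRange (opFun D (fun x : ℝ => ((x : ℂ) + Complex.I)⁻¹)) :=
  hD.dense_domain.mono fun x hx => ⟨_, opFun_resolvent_apply hD ⟨x, hx⟩⟩

theorem add_I_ne_zero (x : ℝ) : (x : ℂ) + Complex.I ≠ 0 := fun h => by
  have := congrArg Complex.im h
  simp at this

/-- `D f(D) = (x f)(D)` if `f` and `x f` are bounded. -/
theorem opFun_mem_domain (hD : IsSelfAdjoint D) {f : ℝ → ℂ} (hf : BddCont f)
    (hxf : BddCont (fun x : ℝ => (x : ℂ) * f x)) (y : H) :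
    ∃ h : opFun D f y ∈ D.domain, D ⟨_, h⟩ = opFun D (fun x : ℝ => (x : ℂ) * f x) y := by
  have hg : BddCont (fun x : ℝ => (x : ℂ) * f x + Complex.I * f x) :=
    hxf.add (hf.const_mul Complex.I)
  have h1 : opFun D f y = opFun D (fun x : ℝ => ((x : ℂ) + Complex.I)⁻¹)
      (opFun D (fun x : ℝ => (x : ℂ) * f x + Complex.I * f x) y) := by
    rw [← mul_apply_eq_comp, ← opFun_mul hD bddCont_resolventFn hg]
    congr 2
    ext x
    rw [← add_mul, inv_mul_cancel_left₀ (add_I_ne_zero x)]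
  obtain ⟨h, h'⟩ := opFun_resolvent_mem hD (opFun D (fun x : ℝ => (x : ℂ) * f x + Complex.I * f x) y)
  rw [← h1] at h
  refine ⟨h, ?_⟩
  have h2 : D ⟨opFun D f y, h⟩ = D ⟨opFun D (fun x : ℝ => ((x : ℂ) + Complex.I)⁻¹)
      (opFun D (fun x : ℝ => (x : ℂ) * f x + Complex.I * f x) y), h1 ▸ h⟩ := by
    congr 1
    exact Subtype.ext h1
  rw [h2, h', ← h1, opFun_add hD hxf (hf.const_mul _), opFun_const_mul hD _ hf]
  simp

/-- Writing y = (D + i)⁻¹w makes Dy = (1 − i(D + i)⁻¹)w, and what remains is an identity between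
bounded functions of D. -/
theorem opFun_apply_D (hD : IsSelfAdjoint D) {f : ℝ → ℂ} (hf : BddCont f)
    (hxf : BddCont (fun x : ℝ => (x : ℂ) * f x)) (y : D.domain) :
    opFun D f (D y) = opFun D (fun x : ℝ => (x : ℂ) * f x) y := by
  set w := D y + Complex.I • (y : H) with hw
  have hy := opFun_resolvent_apply hD y
  rw [← hw] at hy
  have h1 : D y = w - Complex.I • (y : H) := by rw [hw]; abel
  have h2 : BddCont (fun x : ℝ => Complex.I * ((x : ℂ) + Complex.I)⁻¹) :=
    bddCont_resolventFn.const_mul _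
  have h3 : (w - Complex.I • (y : H)) =
      opFun D (fun x : ℝ => 1 - Complex.I * ((x : ℂ) + Complex.I)⁻¹) w := by
    rw [opFun_sub hD (bddCont_const 1) h2, opFun_one hD, opFun_const_mul hD _ bddCont_resolventFn]
    simp [hy]
  rw [h1, h3]
  rw [← hy]
  rw [← mul_apply_eq_comp, ← mul_apply_eq_comp, ← opFun_mul hD hf ((bddCont_const 1).sub h2),
    ← opFun_mul hD hxf bddCont_resolventFn]
  congr 2
  ext x
  field_simp [add_I_ne_zero x]
  ring

/-- Strong continuity of the functional calculus. -/
theorem tendsto_opFun_apply (hD : IsSelfAdjoint D) {ι : Type*} {l : Filter ι} {F : ι → ℝ → ℂ}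
    {f : ℝ → ℂ} {C : ℝ} (hF : ∀ᶠ i in l, Continuous (F i) ∧ ∀ x, ‖F i x‖ ≤ C)
    (hf : Continuous f) (hfC : ∀ x, ‖f x‖ ≤ C) (hlim : TendstoLocallyUniformly F f l) (y : H) :
    Tendsto (fun i => opFun D (F i) y) l (𝓝 (opFun D f y)) := by
  have hC0 : 0 ≤ C := (norm_nonneg _).trans (hfC 0)
  have hf' : BddCont f := ⟨hf, C, hfC⟩
  -- On the range of the resolvent the factor 1/(x + i) suppresses large x, where the convergence is
  -- not uniform. The general case follows by density and the common bound C.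
  have key : ∀ w : H, Tendsto (fun i => opFun D (F i) (opFun D (fun x : ℝ => ((x : ℂ) + Complex.I)⁻¹) w))
      l (𝓝 (opFun D f (opFun D (fun x : ℝ => ((x : ℂ) + Complex.I)⁻¹) w))) := by
    intro w
    rw [Metric.tendsto_nhds]
    intro ε hε
    obtain ⟨δ, hδ, hδε⟩ : ∃ δ > 0, δ * ‖w‖ < ε := by
      refine ⟨ε / (‖w‖ + 1), by positivity, ?_⟩
      rw [div_mul_eq_mul_div, div_lt_iff₀ (by positivity)]
      nlinarith [norm_nonneg w]
    -- Beyond M the trivial bound 2C on the difference is δM, which the resolvent reduces to δ.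
    set M : ℝ := 2 * C / δ with hM
    have hu := (tendstoLocallyUniformly_iff_forall_isCompact.mp hlim) (Set.Icc (-M) M) isCompact_Icc
    rw [Metric.tendstoUniformlyOn_iff] at hu
    filter_upwards [hF, hu δ hδ] with i hi hi2
    have hFi : BddCont (F i) := ⟨hi.1, C, hi.2⟩
    rw [dist_eq_norm, ← mul_apply_eq_comp, ← mul_apply_eq_comp, ← _root_.sub_apply, ← sub_mul,
      ← opFun_sub hD hFi hf', ← opFun_mul hD (hFi.sub hf') bddCont_resolventFn]
    refine lt_of_le_of_lt ((ContinuousLinearMap.le_opNorm _ _).trans ?_) hδε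
    refine mul_le_mul_of_nonneg_right ?_ (norm_nonneg _)
    refine norm_opFun_le hD ((hFi.sub hf').mul bddCont_resolventFn).1 fun x => ?_
    rw [norm_mul, norm_inv]
    by_cases hx : x ∈ Set.Icc (-M) M
    · have h1 : ‖F i x - f x‖ ≤ δ := by
        have := hi2 x hx
        rw [dist_comm, dist_eq_norm] at this
        exact this.le
      have h2 : ‖(x : ℂ) + Complex.I‖⁻¹ ≤ 1 := by
        refine inv_le_one_of_one_le₀ ?_
        simpa using Complex.abs_im_le_norm ((x : ℂ) + Complex.I)
      calc _ ≤ δ * 1 := mul_le_mul h1 h2 (by positivity) hδ.le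
        _ = δ := mul_one _
    · have h3 : M ≤ ‖(x : ℂ) + Complex.I‖ := by
        have h4 := Complex.abs_re_le_norm ((x : ℂ) + Complex.I)
        simp only [Complex.add_re, Complex.ofReal_re, Complex.I_re, add_zero] at h4
        refine le_trans ?_ h4
        by_contra hcon
        exact hx (abs_le.mp (not_le.mp hcon).le)
      have h5 : 0 < ‖(x : ℂ) + Complex.I‖ := norm_pos_iff.mpr (add_I_ne_zero x)
      rw [← div_eq_mul_inv, div_le_iff₀ h5]
      calc ‖F i x - f x‖ ≤ C + C := (norm_sub_le _ _).trans (add_le_add (hi.2 x) (hfC x))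
        _ = δ * M := by rw [hM]; field_simp; ring
        _ ≤ _ := by gcongr
  rw [Metric.tendsto_nhds]
  intro ε hε
  obtain ⟨w, hw⟩ := (denseRange_resolvent hD).exists_dist_lt y (ε := ε / (3 * (C + 1))) (by positivity)
  have hCw : C * dist y (opFun D (fun x : ℝ => ((x : ℂ) + Complex.I)⁻¹) w) ≤ ε / 3 := by
    calc _ ≤ (C + 1) * (ε / (3 * (C + 1))) := by
            gcongr
            linarith
      _ = ε / 3 := by field_simp
  filter_upwards [hF, (Metric.tendsto_nhds.mp (key w)) (ε / 3) (by positivity)] with i hi hi2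
  have hb : ∀ g : ℝ → ℂ, Continuous g → (∀ x, ‖g x‖ ≤ C) → dist (opFun D g y)
      (opFun D g (opFun D (fun x : ℝ => ((x : ℂ) + Complex.I)⁻¹) w)) ≤ ε / 3 := by
    intro g hg hgC
    rw [dist_eq_norm, ← map_sub]
    refine ((ContinuousLinearMap.le_opNorm _ _).trans ?_).trans hCw
    rw [dist_eq_norm]
    gcongr
    exact norm_opFun_le hD hg hgC
  have h1 := hb _ hi.1 hi.2
  have h2 := hb _ hf hfC
  rw [dist_comm] at h2
  linarith [dist_triangle4 (opFun D (F i) y) (opFun D (F i) (opFun D (fun x : ℝ => ((x : ℂ) + Complex.I)⁻¹) w))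
    (opFun D f (opFun D (fun x : ℝ => ((x : ℂ) + Complex.I)⁻¹) w)) (opFun D f y)]

theorem continuousOn_opFun_apply (hD : IsSelfAdjoint D) {Z : Type*} [TopologicalSpace Z]
    {F : Z → ℝ → ℂ} (hF : Continuous fun p : Z × ℝ => F p.1 p.2) {C : ℝ} {s : Set Z}
    (hC : ∀ z ∈ s, ∀ x, ‖F z x‖ ≤ C) (y : H) :
    ContinuousOn (fun z => opFun D (F z) y) s := by
  intro z hz
  have hc : ∀ z, Continuous (F z) := fun z => hF.comp (by fun_prop : Continuous fun x : ℝ => (z, x))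
  refine tendsto_opFun_apply hD (C := C) ?_ (hc z) (hC z hz) ?_ y
  · filter_upwards [self_mem_nhdsWithin] with w hw
    exact ⟨hc w, hC w hw⟩
  · rw [tendstoLocallyUniformly_iff_forall_tendsto]
    intro x
    have h1 : Tendsto (fun p : Z × ℝ => F p.1 p.2) (𝓝[s] z ×ˢ 𝓝 x) (𝓝 (F z x)) :=
      (hF.tendsto (z, x)).mono_left (by
        rw [nhds_prod_eq]
        exact Filter.prod_mono nhdsWithin_le_nhds le_rfl)
    have h2 : Tendsto (fun p : Z × ℝ => F z p.2) (𝓝[s] z ×ˢ 𝓝 x) (𝓝 (F z x)) :=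
      ((hc z).tendsto x).comp tendsto_snd
    have h3 := h2.prodMk_nhds h1
    exact h3.mono_right (nhds_le_uniformity _)

end OpFun

/-! ### Analytic families e^{zD}χ(D). -/

section Exponential

variable {H : Type*} [NormedAddCommGroup H] [InnerProductSpace ℂ H] [CompleteSpace H]
variable {D : H →ₗ.[ℂ] H}

/-- `χ` decays so fast that `e^{yx} χ(x)` is bounded, uniformly in `a ≤ y ≤ b`. -/
def ExpBdd (χ : ℝ → ℂ) (a b C : ℝ) : Prop :=
  Continuous χ ∧ ∀ y ∈ Set.Icc a b, ∀ x : ℝ, Real.exp (y * x) * ‖χ x‖ ≤ C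

/-- The function `e^{zx} χ(x)`. -/
def expFn (χ : ℝ → ℂ) (z : ℂ) (x : ℝ) : ℂ := Complex.exp (z * x) * χ x

theorem norm_expFn (χ : ℝ → ℂ) (z : ℂ) (x : ℝ) :
    ‖expFn χ z x‖ = Real.exp (z.re * x) * ‖χ x‖ := by
  rw [expFn, norm_mul, Complex.norm_exp]
  simp

theorem ExpBdd.norm_le {χ : ℝ → ℂ} {a b C : ℝ} (h : ExpBdd χ a b C) {z : ℂ}
    (hz : z.re ∈ Set.Icc a b) (x : ℝ) : ‖expFn χ z x‖ ≤ C := by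
  rw [norm_expFn]
  exact h.2 _ hz x

theorem ExpBdd.continuous {χ : ℝ → ℂ} {a b C : ℝ} (h : ExpBdd χ a b C) (z : ℂ) :
    Continuous (expFn χ z) := by
  have := h.1
  unfold expFn
  fun_prop

theorem ExpBdd.bddCont {χ : ℝ → ℂ} {a b C : ℝ} (h : ExpBdd χ a b C) {z : ℂ}
    (hz : z.re ∈ Set.Icc a b) : BddCont (expFn χ z) := ⟨h.continuous z, C, h.norm_le hz⟩

theorem continuousOn_opFun_expFn (hD : IsSelfAdjoint D) {χ : ℝ → ℂ} {a b C : ℝ}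
    (h : ExpBdd χ a b C) (y : H) :
    ContinuousOn (fun z => opFun D (expFn χ z) y) {z | z.re ∈ Set.Icc a b} := by
  have := h.1
  refine continuousOn_opFun_apply hD (F := expFn χ) (by unfold expFn; fun_prop) (C := C) ?_ y
  intro z hz x
  exact h.norm_le hz x

/-- A margin δ on both sides of Re z is exponential decay in |x|: use the exponent Re z + δ for x ≥
0 and Re z − δ for x < 0. -/
theorem ExpBdd.exp_abs {χ : ℝ → ℂ} {a b C : ℝ} (h : ExpBdd χ a b C) {z : ℂ} {δ : ℝ}
    (h1 : a ≤ z.re - δ) (h2 : z.re + δ ≤ b) (hδ : 0 ≤ δ) (x : ℝ) :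
    Real.exp (δ * |x|) * ‖expFn χ z x‖ ≤ C := by
  rw [norm_expFn, ← mul_assoc, ← Real.exp_add]
  rcases abs_cases x with ⟨hx, _⟩ | ⟨hx, _⟩
  · rw [hx, ← add_mul]
    exact h.2 _ ⟨by linarith, by linarith⟩ x
  · rw [hx, show δ * -x + z.re * x = (z.re - δ) * x by ring]
    exact h.2 _ ⟨by linarith, by linarith⟩ x

theorem ExpBdd.mul_id {χ : ℝ → ℂ} {a b C : ℝ} (h : ExpBdd χ a b C) {z : ℂ}
    (hz : z.re ∈ Set.Ioo a b) : BddCont (fun x : ℝ => (x : ℂ) * expFn χ z x) := by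
  obtain ⟨δ, hδ, h1, h2⟩ : ∃ δ > 0, a ≤ z.re - δ ∧ z.re + δ ≤ b :=
    ⟨min (z.re - a) (b - z.re), lt_min (by linarith [hz.1]) (by linarith [hz.2]),
      by linarith [min_le_left (z.re - a) (b - z.re)],
      by linarith [min_le_right (z.re - a) (b - z.re)]⟩
  refine ⟨by have := h.continuous z; fun_prop, C / δ, fun x => ?_⟩
  rw [norm_mul, Complex.norm_real, Real.norm_eq_abs, le_div_iff₀ hδ]
  refine le_trans ?_ (h.exp_abs h1 h2 hδ.le x)
  have h3 : δ * |x| ≤ Real.exp (δ * |x|) := by linarith [Real.add_one_le_exp (δ * |x|)]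
  calc |x| * ‖expFn χ z x‖ * δ = (δ * |x|) * ‖expFn χ z x‖ := by ring
    _ ≤ _ := by gcongr

/-- Differentiability in operator norm is available only away from the edges of the strip. The
Taylor remainder of e^{kx} is at most |kx|² e^{|k||x|}; of the margin 2δ, one δ absorbs x² and the
other e^{|k||x|}, leaving a multiple of |k|². -/
theorem hasDerivAt_opFun_expFn (hD : IsSelfAdjoint D) {χ : ℝ → ℂ} {a b C : ℝ}
    (h : ExpBdd χ a b C) {z : ℂ} (hz : z.re ∈ Set.Ioo a b) :
    HasDerivAt (fun z => opFun D (expFn χ z)) (opFun D (fun x : ℝ => (x : ℂ) * expFn χ z x)) z := by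
  obtain ⟨δ, hδ, h1, h2⟩ : ∃ δ > 0, a ≤ z.re - 2 * δ ∧ z.re + 2 * δ ≤ b :=
    ⟨min (z.re - a) (b - z.re) / 2, half_pos (lt_min (by linarith [hz.1]) (by linarith [hz.2])),
      by linarith [min_le_left (z.re - a) (b - z.re)],
      by linarith [min_le_right (z.re - a) (b - z.re)]⟩
  have hbound : ∀ k : ℂ, ‖k‖ ≤ δ → ‖opFun D (expFn χ (z + k)) - opFun D (expFn χ z) -
      k • opFun D (fun x : ℝ => (x : ℂ) * expFn χ z x)‖ ≤ (2 / δ ^ 2 * C) * ‖k‖ ^ 2 := by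
    intro k hk
    have hkre : |k.re| ≤ δ := (Complex.abs_re_le_norm k).trans hk
    have hzk : (z + k).re ∈ Set.Icc a b := by
      rw [Complex.add_re]
      exact ⟨by linarith [(abs_le.mp hkre).1], by linarith [(abs_le.mp hkre).2]⟩
    have hb1 := h.bddCont hzk
    have hb2 := h.bddCont (z := z) ⟨hz.1.le, hz.2.le⟩
    have hb3 := h.mul_id hz
    rw [← opFun_sub hD hb1 hb2, ← opFun_const_mul hD k hb3,
      ← opFun_sub hD (hb1.sub hb2) (hb3.const_mul k)]
    refine norm_opFun_le hD ((hb1.sub hb2).sub (hb3.const_mul k)).1 fun x => ?_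
    have he : expFn χ (z + k) x - expFn χ z x - k * ((x : ℂ) * expFn χ z x) =
        (Complex.exp (k * x) - ∑ m ∈ Finset.range 2, (k * x) ^ m / (m.factorial : ℂ)) * expFn χ z x := by
      simp only [expFn, add_mul, Complex.exp_add, Finset.sum_range_succ, Finset.sum_range_zero]
      simp
      ring
    rw [he, norm_mul]
    have h3 := Complex.norm_exp_sub_sum_le_norm_mul_exp (k * x) 2
    rw [norm_mul, Complex.norm_real, Real.norm_eq_abs] at h3
    have h4 : |x| ^ 2 ≤ 2 / δ ^ 2 * Real.exp (δ * |x|) := by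
      have := Real.quadratic_le_exp_of_nonneg (x := δ * |x|) (by positivity)
      rw [div_mul_eq_mul_div, le_div_iff₀ (by positivity)]
      nlinarith [mul_nonneg hδ.le (abs_nonneg x)]
    have h5 : Real.exp (‖k‖ * |x|) ≤ Real.exp (δ * |x|) := by
      apply Real.exp_le_exp.mpr
      gcongr
    have h6 := h.exp_abs h1 h2 (by positivity) x
    have h7 : Real.exp (2 * δ * |x|) = Real.exp (δ * |x|) * Real.exp (δ * |x|) := by
      rw [← Real.exp_add]; congr 1; ring
    rw [h7] at h6
    calc _ ≤ ((‖k‖ * |x|) ^ 2 * Real.exp (‖k‖ * |x|)) * ‖expFn χ z x‖ := by gcongr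
      _ ≤ (‖k‖ ^ 2 * (2 / δ ^ 2 * Real.exp (δ * |x|)) * Real.exp (δ * |x|)) * ‖expFn χ z x‖ := by
          rw [mul_pow]
          gcongr
      _ = 2 / δ ^ 2 * ‖k‖ ^ 2 * (Real.exp (δ * |x|) * Real.exp (δ * |x|) * ‖expFn χ z x‖) := by ring
      _ ≤ 2 / δ ^ 2 * ‖k‖ ^ 2 * C := by gcongr
      _ = _ := by ring
  rw [hasDerivAt_iff_isLittleO_nhds_zero]
  have hO : (fun k => opFun D (expFn χ (z + k)) - opFun D (expFn χ z) -
      k • opFun D (fun x : ℝ => (x : ℂ) * expFn χ z x)) =O[𝓝 0] fun k : ℂ => k ^ 2 := by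
    refine Asymptotics.IsBigO.of_bound (2 / δ ^ 2 * C) ?_
    filter_upwards [Metric.closedBall_mem_nhds (0 : ℂ) hδ] with k hk
    rw [norm_pow]
    exact hbound k (by simpa using hk)
  exact hO.trans_isLittleO (Asymptotics.isLittleO_pow_id one_lt_two)

end Exponential

/-! ### Fermi factors, the propagator and chains of propagators. -/

section Fermi

/-- The function `1 / (1 + e^{βx})`. -/
def fermi (β x : ℝ) : ℂ := ((1 / (1 + Real.exp (β * x)) : ℝ) : ℂ)

/-- For 0 ≤ y ≤ β the factor e^{yx} is below e^{βx} when x ≥ 0 and below 1 when x ≤ 0, hence always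
below 1 + e^{βx}. -/
theorem expBdd_fermi (β : ℝ) : ExpBdd (fermi β) 0 β 1 := by
  refine ⟨?_, fun y hy x => ?_⟩
  · unfold fermi
    refine Complex.continuous_ofReal.comp (continuous_const.div (by fun_prop) fun x => ?_)
    positivity
  · have h : 0 < 1 + Real.exp (β * x) := by positivity
    rw [fermi, Complex.norm_real, Real.norm_of_nonneg (by positivity), mul_one_div,
      div_le_one h]
    rcases le_total 0 x with hx | hx
    · have : Real.exp (y * x) ≤ Real.exp (β * x) :=
        Real.exp_le_exp.mpr (mul_le_mul_of_nonneg_right hy.2 hx)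
      linarith
    · have : Real.exp (y * x) ≤ 1 :=
        Real.exp_le_one_iff.mpr (mul_nonpos_of_nonneg_of_nonpos hy.1 hx)
      linarith [Real.exp_pos (β * x)]

end Fermi

section FermiOperators

variable {H : Type*} [NormedAddCommGroup H] [InnerProductSpace ℂ H] [CompleteSpace H]
variable {D : H →ₗ.[ℂ] H} {β : ℝ}

/-- The operator `e^{zD} / (1 + e^{βD})`, for `0 ≤ Re z ≤ β`. -/
def fermiOp (D : H →ₗ.[ℂ] H) (β : ℝ) (z : ℂ) : H →L[ℂ] H := opFun D (expFn (fermi β) z)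

theorem norm_fermiOp_le (hD : IsSelfAdjoint D) {z : ℂ} (hz : z.re ∈ Set.Icc 0 β) :
    ‖fermiOp D β z‖ ≤ 1 :=
  norm_opFun_le hD ((expBdd_fermi β).continuous z) ((expBdd_fermi β).norm_le hz)

theorem continuousOn_fermiOp_apply (hD : IsSelfAdjoint D) (y : H) :
    ContinuousOn (fun z => fermiOp D β z y) {z | z.re ∈ Set.Icc 0 β} :=
  continuousOn_opFun_expFn hD (expBdd_fermi β) y

theorem hasDerivAt_fermiOp (hD : IsSelfAdjoint D) {z : ℂ} (hz : z.re ∈ Set.Ioo 0 β) :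
    HasDerivAt (fermiOp D β) (opFun D (fun x : ℝ => (x : ℂ) * expFn (fermi β) z x)) z :=
  hasDerivAt_opFun_expFn hD (expBdd_fermi β) hz

theorem continuousAt_fermiOp (hD : IsSelfAdjoint D) {z : ℂ} (hz : z.re ∈ Set.Ioo 0 β) :
    ContinuousAt (fermiOp D β) z := (hasDerivAt_fermiOp hD hz).continuousAt

theorem fermi_mul_exp (β x : ℝ) :
    fermi β x * Complex.exp (β * x) = ((1 / (1 + Real.exp (-β * x)) : ℝ) : ℂ) := by
  have h1 : 1 + Real.exp (β * x) ≠ 0 := by positivity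
  have h2 : 1 + Real.exp (-β * x) ≠ 0 := by positivity
  have h3 : Real.exp (β * x) * Real.exp (-β * x) = 1 := by
    rw [← Real.exp_add]; simp
  rw [fermi, ← Complex.ofReal_mul, ← Complex.ofReal_exp, ← Complex.ofReal_mul]
  congr 1
  rw [div_mul_eq_mul_div, div_eq_div_iff h1 h2]
  linear_combination h3

theorem fermiOp_beta (D : H →ₗ.[ℂ] H) (β : ℝ) :
    fermiOp D β β = opFun D (fun x => ((1 / (1 + Real.exp (-β * x)) : ℝ) : ℂ)) := by
  unfold fermiOp
  congr 1
  ext x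
  rw [← fermi_mul_exp, expFn, mul_comm]

theorem fermiOp_zero_add_beta (hD : IsSelfAdjoint D) (hβ : 0 ≤ β) :
    fermiOp D β 0 + fermiOp D β β = 1 := by
  have h0 : (0 : ℂ).re ∈ Set.Icc 0 β := by simpa using hβ
  have h1 : (β : ℂ).re ∈ Set.Icc 0 β := by simpa using hβ
  rw [fermiOp, fermiOp, ← opFun_add hD ((expBdd_fermi β).bddCont h0) ((expBdd_fermi β).bddCont h1),
    ← opFun_one hD]
  congr 1
  ext x
  have h2 : (1 + Real.exp (β * x) : ℝ) ≠ 0 := by positivity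
  have h3 : (1 : ℂ) + Complex.exp (β * x) ≠ 0 := by
    have := Complex.ofReal_ne_zero.mpr h2
    push_cast at this
    exact this
  simp only [expFn, fermi]
  push_cast
  rw [mul_one_div, mul_one_div, ← add_div]
  simp [div_self h3]

/-- The kernel `e^{sD} F_{σ(s)}`. -/
def kernelOp (D : H →ₗ.[ℂ] H) (β s : ℝ) : H →L[ℂ] H :=
  opFun D (fun x => ((Real.exp (s * x) * fermiSign β s x : ℝ) : ℂ))

theorem opFun_fermiPlus (hD : IsSelfAdjoint D) {s : ℝ} (hs : s ∈ Set.Icc 0 β) :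
    opFun D (fun x => ((Real.exp (s * x) * fermiPlus β x : ℝ) : ℂ)) = -fermiOp D β s := by
  rw [fermiOp, ← opFun_neg hD ((expBdd_fermi β).bddCont (by simpa using hs))]
  congr 1
  ext x
  simp only [expFn, fermi, fermiPlus]
  push_cast
  ring

theorem opFun_fermiMinus (D : H →ₗ.[ℂ] H) (β s : ℝ) :
    opFun D (fun x => ((Real.exp (s * x) * fermiMinus β x : ℝ) : ℂ)) = fermiOp D β (β + s) := by
  rw [fermiOp]
  congr 1
  ext x
  have h : ((fermiMinus β x : ℝ) : ℂ) = fermi β x * Complex.exp (β * x) := (fermi_mul_exp β x).symm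
  rw [expFn, add_mul, Complex.exp_add, Complex.ofReal_mul, h]
  push_cast
  ring

theorem kernelOp_of_pos (hD : IsSelfAdjoint D) {s : ℝ} (hs : 0 < s) (hs' : s ≤ β) :
    kernelOp D β s = -fermiOp D β s := by
  rw [kernelOp, ← opFun_fermiPlus hD ⟨hs.le, hs'⟩]
  simp [fermiSign, hs]

theorem kernelOp_of_nonpos (D : H →ₗ.[ℂ] H) (β : ℝ) {s : ℝ} (hs : s ≤ 0) :
    kernelOp D β s = fermiOp D β (β + s) := by
  rw [kernelOp, ← opFun_fermiMinus]
  simp [fermiSign, not_lt.mpr hs]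

/-- The choice of Fermi factor by the sign of s keeps the exponent in [0, β]: it is s in one case
and β + s in the other. This is the only bound behind the convergence of the series. -/
theorem norm_kernelOp_le (hD : IsSelfAdjoint D) {s : ℝ} (hs : s ∈ Set.Icc (-β) β) :
    ‖kernelOp D β s‖ ≤ 1 := by
  rcases lt_or_ge 0 s with h | h
  · rw [kernelOp_of_pos hD h hs.2, norm_neg]
    exact norm_fermiOp_le hD (by simpa using ⟨h.le, hs.2⟩)
  · rw [kernelOp_of_nonpos D β h]
    refine norm_fermiOp_le hD ?_
    simp only [Complex.add_re, Complex.ofReal_re]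
    exact ⟨by linarith [hs.1], by linarith⟩

/-- The point 0 is excluded because the kernel jumps by the identity, and ±β because at the edge of
the strip only strong continuity holds in general. -/
theorem continuousAt_kernelOp (hD : IsSelfAdjoint D) {s : ℝ} (hs : s ∈ Set.Ioo (-β) β)
    (h0 : s ≠ 0) : ContinuousAt (kernelOp D β) s := by
  rcases lt_or_gt_of_ne h0 with h | h
  · have h1 : ContinuousAt (fun t : ℝ => fermiOp D β (β + t)) s := by
      refine ContinuousAt.comp (f := fun t : ℝ => (β + t : ℂ)) (continuousAt_fermiOp hD ?_)
        (by fun_prop)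
      simp only [Complex.add_re, Complex.ofReal_re]
      exact ⟨by linarith [hs.1], by linarith⟩
    refine h1.congr ?_
    filter_upwards [gt_mem_nhds h] with t ht
    rw [kernelOp_of_nonpos D β ht.le]
  · have h1 : ContinuousAt (fun t : ℝ => -fermiOp D β t) s := by
      refine ContinuousAt.neg (ContinuousAt.comp (f := fun t : ℝ => (t : ℂ))
        (continuousAt_fermiOp hD ?_) (by fun_prop))
      simpa using ⟨h, hs.2⟩
    refine h1.congr ?_
    filter_upwards [lt_mem_nhds h, gt_mem_nhds hs.2] with t ht ht'
    rw [kernelOp_of_pos hD ht ht'.le]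

/-- The chain `G(s - u₁) 𝒦 G(u₁ - u₂) 𝒦 ⋯ 𝒦 e^{u_m D} F₊` with `G(s) = e^{sD} F_{σ(s)}`. -/
def chain (D : H →ₗ.[ℂ] H) (𝒦 : H →L[ℂ] H) (β : ℝ) : (m : ℕ) → ℝ → (Fin m → ℝ) → (H →L[ℂ] H)
  | 0, s, _ => opFun D (fun x => ((Real.exp (s * x) * fermiPlus β x : ℝ) : ℂ))
  | m + 1, s, u => kernelOp D β (s - u 0) * 𝒦 * chain D 𝒦 β m (u 0) (Fin.tail u)

theorem chain_eq_prod (D : H →ₗ.[ℂ] H) (𝒦 : H →L[ℂ] H) (β : ℝ) (m : ℕ) (u : Fin (m + 1) → ℝ) :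
    (List.ofFn fun j : Fin m =>
      opFun D (fun x => ((Real.exp ((u j.castSucc - u j.succ) * x) *
        fermiSign β (u j.castSucc - u j.succ) x : ℝ) : ℂ)) * 𝒦).prod *
    opFun D (fun x => ((Real.exp (u (Fin.last m) * x) * fermiPlus β x : ℝ) : ℂ)) =
      chain D 𝒦 β m (u 0) (Fin.tail u) := by
  induction m with
  | zero => simp [chain]
  | succ m ih =>
    rw [chain, List.ofFn_succ, List.prod_cons, mul_assoc, ← ih]
    rfl

/-- For u₁ ≥ 0 the leading factor F₋e^{-u₁D} is the propagator from time 0 to u₁, so the integrand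
is a chain that starts at time 0. -/
theorem seriesIntegrand_eq_chain (D : H →ₗ.[ℂ] H) (𝒦 : H →L[ℂ] H) (m : ℕ) {u : Fin (m + 1) → ℝ}
    (hu : 0 ≤ u 0) : seriesIntegrand D 𝒦 β m u = chain D 𝒦 β (m + 1) 0 u := by
  rw [seriesIntegrand, mul_assoc, chain_eq_prod, chain, kernelOp]
  congr 4
  ext x
  rw [fermiSign, if_neg (by linarith), zero_sub, mul_comm]

theorem norm_chain_le (hD : IsSelfAdjoint D) (𝒦 : H →L[ℂ] H) {m : ℕ} {s : ℝ} {u : Fin m → ℝ}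
    (hs : s ∈ Set.Icc 0 β) (hu : ∀ i, u i ∈ Set.Icc 0 β) : ‖chain D 𝒦 β m s u‖ ≤ ‖𝒦‖ ^ m := by
  induction m generalizing s with
  | zero =>
    rw [chain, opFun_fermiPlus hD hs, norm_neg, pow_zero]
    exact norm_fermiOp_le hD (by simpa using hs)
  | succ m ih =>
    rw [chain, pow_succ']
    refine (norm_mul_le _ _).trans (mul_le_mul ((norm_mul_le _ _).trans ?_)
      (ih (hu 0) fun i => hu i.succ) (norm_nonneg _) (norm_nonneg _))
    have h0 := hu 0
    have := norm_kernelOp_le hD (β := β) (s := s - u 0)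
      ⟨by linarith [hs.1, h0.2], by linarith [hs.2, h0.1]⟩
    calc _ ≤ 1 * ‖𝒦‖ := by gcongr
      _ = _ := one_mul _

/-- Integrals in B(H) need strong measurability in norm, for which strong operator continuity is not
enough. Norm continuity holds where all times are distinct, which is almost everywhere. -/
theorem continuousOn_chain (hD : IsSelfAdjoint D) (𝒦 : H →L[ℂ] H) (m : ℕ) :
    ContinuousOn (fun p : ℝ × (Fin m → ℝ) => chain D 𝒦 β m p.1 p.2)
      {p | p.1 ∈ Set.Ioo 0 β ∧ p.2 ∈ openCube m β ∧ Function.Injective p.2 ∧ ∀ i, p.2 i ≠ p.1} := by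
  induction m with
  | zero =>
    intro p hp
    have h1 : ContinuousAt (fun p : ℝ × (Fin 0 → ℝ) => -fermiOp D β p.1) p :=
      ContinuousAt.neg (ContinuousAt.comp (f := fun p : ℝ × (Fin 0 → ℝ) => (p.1 : ℂ))
        (continuousAt_fermiOp hD (by simpa using hp.1)) (by fun_prop))
    refine h1.continuousWithinAt.congr (fun q hq => ?_) ?_
    · rw [chain, opFun_fermiPlus hD ⟨hq.1.1.le, hq.1.2.le⟩]
    · rw [chain, opFun_fermiPlus hD ⟨hp.1.1.le, hp.1.2.le⟩]
  | succ m ih =>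
    simp only [chain]
    refine (ContinuousOn.mul ?_ continuousOn_const).mul ?_
    · intro p hp
      refine ContinuousAt.continuousWithinAt (ContinuousAt.comp
        (f := fun p : ℝ × (Fin (m + 1) → ℝ) => p.1 - p.2 0)
        (continuousAt_kernelOp hD ?_ ?_) (by fun_prop))
      · exact ⟨by linarith [hp.1.1, (hp.2.1 0).2], by linarith [hp.1.2, (hp.2.1 0).1]⟩
      · exact sub_ne_zero.mpr (hp.2.2.2 0).symm
    · refine ih.comp (f := fun p : ℝ × (Fin (m + 1) → ℝ) => (p.2 0, Fin.tail p.2)) ?_ ?_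
      · unfold Fin.tail
        fun_prop
      · intro p hp
        exact ⟨hp.2.1 0, fun i => hp.2.1 i.succ, hp.2.2.1.comp (Fin.succ_injective m),
          fun i h => Fin.succ_ne_zero i (hp.2.2.1 h)⟩

/-- Holding the starting time fixed admits s = 0, where e^{sD}F₊ need not be norm continuous in s.
-/
theorem continuousOn_chain_right (hD : IsSelfAdjoint D) (𝒦 : H →L[ℂ] H) (m : ℕ) {s : ℝ}
    (hs : s ∈ Set.Ico 0 β) :
    ContinuousOn (chain D 𝒦 β m s)
      {u | u ∈ openCube m β ∧ Function.Injective u ∧ ∀ i, u i ≠ s} := by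
  cases m with
  | zero => exact continuous_of_const (fun _ _ => rfl) |>.continuousOn
  | succ m =>
    have : chain D 𝒦 β (m + 1) s =
        fun u => kernelOp D β (s - u 0) * 𝒦 * chain D 𝒦 β m (u 0) (Fin.tail u) := rfl
    rw [this]
    refine (ContinuousOn.mul ?_ continuousOn_const).mul ?_
    · intro u hu
      refine ContinuousAt.continuousWithinAt (ContinuousAt.comp
        (f := fun u : Fin (m + 1) → ℝ => s - u 0)
        (continuousAt_kernelOp hD ?_ ?_) (by exact (continuous_const.sub (continuous_apply 0)).continuousAt))
      · exact ⟨by linarith [hs.1, (hu.1 0).2], by linarith [hs.2, (hu.1 0).1]⟩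
      · exact sub_ne_zero.mpr (hu.2.2 0).symm
    · refine (continuousOn_chain hD 𝒦 m).comp
        (f := fun u : Fin (m + 1) → ℝ => (u 0, Fin.tail u)) ?_ ?_
      · unfold Fin.tail
        fun_prop
      · intro u hu
        exact ⟨hu.1 0, fun i => hu.1 i.succ, hu.2.1.comp (Fin.succ_injective m),
          fun i h => Fin.succ_ne_zero i (hu.2.1 h)⟩

end FermiOperators

/-! ### Integration over the cube. -/

section Cube

theorem openCube_eq_pi (n : ℕ) (r : ℝ) : openCube n r = Set.univ.pi fun _ => Set.Ioo 0 r := by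
  ext u
  simp [openCube]

theorem measurableSet_openCube (n : ℕ) (r : ℝ) : MeasurableSet (openCube n r) := by
  rw [openCube_eq_pi]
  exact MeasurableSet.univ_pi fun _ => measurableSet_Ioo

theorem volume_openCube (n : ℕ) (r : ℝ) : volume (openCube n r) = ENNReal.ofReal r ^ n := by
  rw [openCube_eq_pi, volume_pi_pi]
  simp

theorem volume_openCube_lt_top (n : ℕ) (r : ℝ) : volume (openCube n r) < ⊤ := by
  rw [volume_openCube]
  exact ENNReal.pow_lt_top ENNReal.ofReal_lt_top

theorem openCube_mono (n : ℕ) {r r' : ℝ} (h : r ≤ r') : openCube n r ⊆ openCube n r' :=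
  fun _ hu i => ⟨(hu i).1, (hu i).2.trans_le h⟩

theorem ae_apply_ne {n : ℕ} (i : Fin n) (s : ℝ) : ∀ᵐ u : Fin n → ℝ, u i ≠ s := by
  have h : volume {u : Fin n → ℝ | u i ∈ ({s} : Set ℝ)} = 0 := by
    have := (Measure.quasiMeasurePreserving_eval (fun _ : Fin n => (volume : Measure ℝ)) i).preimage_null
      (s := {s}) (by simp)
    exact this
  exact measure_eq_zero_iff_ae_notMem.mp h

theorem ae_injective (n : ℕ) : ∀ᵐ u : Fin n → ℝ, Function.Injective u := by
  have h : ∀ i j : Fin n, i ≠ j → ∀ᵐ u : Fin n → ℝ, u i ≠ u j := by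
    intro i j hij
    let p : Submodule ℝ (Fin n → ℝ) :=
      LinearMap.ker (LinearMap.proj (R := ℝ) (φ := fun _ : Fin n => ℝ) i - LinearMap.proj j)
    have hp : p ≠ ⊤ := by
      intro h
      have : (Pi.single i (1 : ℝ) : Fin n → ℝ) ∈ p := h ▸ Submodule.mem_top
      simp [p, Pi.single_eq_of_ne hij.symm] at this
    have := measure_eq_zero_iff_ae_notMem.mp (Measure.addHaar_submodule volume p hp)
    filter_upwards [this] with u hu huij
    exact hu (by simp [p, huij])
  have h2 : ∀ᵐ u : Fin n → ℝ, ∀ i j : Fin n, i ≠ j → u i ≠ u j := by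
    rw [ae_all_iff]; intro i
    rw [ae_all_iff]; intro j
    by_cases hij : i = j
    · exact Eventually.of_forall fun _ h => absurd hij h
    · filter_upwards [h i j hij] with u hu _ using hu
  filter_upwards [h2] with u hu i j hij
  by_contra hne
  exact hu i j hne hij

theorem isOpen_distinct (n : ℕ) (s : ℝ) :
    IsOpen {u : Fin n → ℝ | Function.Injective u ∧ ∀ i, u i ≠ s} := by
  have : {u : Fin n → ℝ | Function.Injective u ∧ ∀ i, u i ≠ s} =
      (⋂ i, ⋂ j, {u | u i = u j → i = j}) ∩ ⋂ i, {u | u i ≠ s} := by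
    ext u
    simp [Function.Injective]
  rw [this]
  refine IsOpen.inter (isOpen_iInter_of_finite fun i => isOpen_iInter_of_finite fun j => ?_)
    (isOpen_iInter_of_finite fun i => ?_)
  · by_cases hij : i = j
    · simp [hij]
    · simp only [hij, imp_false]
      exact isOpen_ne_fun (continuous_apply i) (continuous_apply j)
  · exact isOpen_ne_fun (continuous_apply i) continuous_const

theorem ae_distinct (n : ℕ) (s : ℝ) :
    ∀ᵐ u : Fin n → ℝ, Function.Injective u ∧ ∀ i, u i ≠ s := by
  filter_upwards [ae_injective n, ae_all_iff.mpr fun i => ae_apply_ne i s] with u h1 h2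
  exact ⟨h1, h2⟩

/-- A bounded function on the cube that is continuous at points with distinct coordinates is
integrable. -/
theorem integrableOn_openCube_of_continuousOn {E : Type*} [NormedAddCommGroup E] {n : ℕ} {r s C : ℝ}
    {f : (Fin n → ℝ) → E}
    (hf : ContinuousOn f {u | u ∈ openCube n r ∧ Function.Injective u ∧ ∀ i, u i ≠ s})
    (hC : ∀ u ∈ openCube n r, ‖f u‖ ≤ C) : IntegrableOn f (openCube n r) := by
  have := isFiniteMeasure_restrict.mpr (volume_openCube_lt_top n r).ne
  refine Integrable.of_bound ?_ C ?_
  · have h1 : (volume.restrict (openCube n r) : Measure (Fin n → ℝ)) = volume.restrict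
        {u | u ∈ openCube n r ∧ Function.Injective u ∧ ∀ i, u i ≠ s} := by
      refine Measure.restrict_congr_set ?_
      filter_upwards [ae_distinct n s] with u hu
      exact propext ⟨fun h => ⟨h, hu⟩, fun h => h.1⟩
    rw [h1]
    exact hf.aestronglyMeasurable ((measurableSet_openCube n r).inter (isOpen_distinct n s).measurableSet)
  · exact (ae_restrict_mem (measurableSet_openCube n r)).mono hC

theorem integrableOn_Ioo_of_continuousOn {E : Type*} [NormedAddCommGroup E] {a b s C : ℝ}
    {f : ℝ → E} (hf : ContinuousOn f {t | t ∈ Set.Ioo a b ∧ t ≠ s})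
    (hC : ∀ t ∈ Set.Ioo a b, ‖f t‖ ≤ C) : IntegrableOn f (Set.Ioo a b) := by
  have := isFiniteMeasure_restrict.mpr (measure_Ioo_lt_top (μ := volume) (a := a) (b := b)).ne
  refine Integrable.of_bound ?_ C ?_
  · have h1 : (volume.restrict (Set.Ioo a b) : Measure ℝ) =
        volume.restrict {t | t ∈ Set.Ioo a b ∧ t ≠ s} := by
      refine Measure.restrict_congr_set ?_
      filter_upwards [Measure.ae_ne volume s] with u hu
      exact propext ⟨fun h => ⟨h, hu⟩, fun h => h.1⟩
    rw [h1]
    exact hf.aestronglyMeasurable (measurableSet_Ioo.inter isOpen_ne.measurableSet)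
  · exact (ae_restrict_mem measurableSet_Ioo).mono hC

/-- Fubini's theorem on the cube: the first coordinate is split off. -/
theorem setIntegral_openCube_succ {E : Type*} [NormedAddCommGroup E] [NormedSpace ℝ E] {n : ℕ} {r : ℝ}
    {f : (Fin (n + 1) → ℝ) → E} (hf : IntegrableOn f (openCube (n + 1) r)) :
    IntegrableOn (fun t => ∫ u in openCube n r, f (Fin.cons t u)) (Set.Ioo 0 r) ∧
    ∫ u in openCube (n + 1) r, f u =
      ∫ t in Set.Ioo 0 r, ∫ u in openCube n r, f (Fin.cons t u) := by
  have hmp := (volume_preserving_piFinSuccAbove (fun _ : Fin (n + 1) => ℝ) 0).symm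
  set e := (MeasurableEquiv.piFinSuccAbove (fun _ : Fin (n + 1) => ℝ) 0).symm with he
  have hcons : ∀ p : ℝ × (Fin n → ℝ), e p = Fin.cons p.1 p.2 := fun p => by
    simp [he, MeasurableEquiv.piFinSuccAbove]
    rfl
  have hpre : e ⁻¹' (openCube (n + 1) r) = Set.Ioo 0 r ×ˢ openCube n r := by
    ext p
    simp only [Set.mem_preimage, hcons, openCube, Set.mem_ofPred_eq, Set.mem_prod, Fin.forall_fin_succ,
      Fin.cons_zero, Fin.cons_succ]
  have hint : IntegrableOn (fun p : ℝ × (Fin n → ℝ) => f (Fin.cons p.1 p.2))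
      (Set.Ioo 0 r ×ˢ openCube n r) (volume.prod volume) := by
    have := (hmp.integrableOn_comp_preimage e.measurableEmbedding (f := f) (s := openCube (n + 1) r)).mpr hf
    rw [hpre] at this
    refine this.congr_fun (fun p _ => ?_) (measurableSet_Ioo.prod (measurableSet_openCube n r))
    simp [hcons]
  refine ⟨?_, ?_⟩
  · have h2 := hint
    rw [IntegrableOn, ← Measure.prod_restrict] at h2
    exact h2.integral_prod_left
  · rw [← setIntegral_prod _ hint, ← hmp.setIntegral_preimage_emb e.measurableEmbedding, hpre]
    refine setIntegral_congr_fun (measurableSet_Ioo.prod (measurableSet_openCube n r)) fun p _ => ?_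
    simp [hcons]

end Cube

/-! ### Absolute convergence of the series. -/

section Series

variable {H : Type*} [NormedAddCommGroup H] [InnerProductSpace ℂ H] [CompleteSpace H]
variable {D : H →ₗ.[ℂ] H} {𝒦 : H →L[ℂ] H} {β : ℝ}

theorem integrableOn_chain (hD : IsSelfAdjoint D) (m : ℕ) {s : ℝ} (hs : s ∈ Set.Ico 0 β) :
    IntegrableOn (chain D 𝒦 β m s) (openCube m β) :=
  integrableOn_openCube_of_continuousOn (continuousOn_chain_right hD 𝒦 m hs) fun _ hu =>
    norm_chain_le hD 𝒦 ⟨hs.1, hs.2.le⟩ fun i => ⟨(hu i).1.le, (hu i).2.le⟩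

theorem norm_seriesIntegrand_le (hD : IsSelfAdjoint D) (hβ : 0 < β) {r : ℝ} (hr : r ≤ β) {m : ℕ}
    {u : Fin (m + 1) → ℝ} (hu : u ∈ openCube (m + 1) r) :
    ‖seriesIntegrand D 𝒦 β m u‖ ≤ ‖𝒦‖ ^ (m + 1) := by
  rw [seriesIntegrand_eq_chain D 𝒦 m (hu 0).1.le]
  exact norm_chain_le hD 𝒦 ⟨le_rfl, hβ.le⟩ fun i => ⟨(hu i).1.le, (hu i).2.le.trans hr⟩

theorem integrableOn_seriesIntegrand (hD : IsSelfAdjoint D) (hβ : 0 < β) {r : ℝ} (hr : r ≤ β) (m : ℕ) :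
    IntegrableOn (seriesIntegrand D 𝒦 β m) (openCube (m + 1) r) := by
  have h := (integrableOn_chain (𝒦 := 𝒦) hD (m + 1) (s := 0) ⟨le_rfl, hβ⟩).mono_set
    (openCube_mono (m + 1) hr)
  exact h.congr_fun (fun u hu => (seriesIntegrand_eq_chain D 𝒦 m (hu 0).1.le).symm)
    (measurableSet_openCube _ _)

theorem integral_norm_seriesIntegrand_le (hD : IsSelfAdjoint D) (hβ : 0 < β) {r : ℝ}
    (hr : r ∈ Set.Icc 0 β) (m : ℕ) :
    ∫ u in openCube (m + 1) r, ‖seriesIntegrand D 𝒦 β m u‖ ≤ (β * ‖𝒦‖) ^ (m + 1) := by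
  have h := norm_setIntegral_le_of_norm_le_const (μ := volume)
    (f := fun u => ‖seriesIntegrand D 𝒦 β m u‖) (volume_openCube_lt_top (m + 1) r)
    (C := ‖𝒦‖ ^ (m + 1)) (fun u hu => by
      rw [norm_norm]
      exact norm_seriesIntegrand_le hD hβ hr.2 hu)
  refine (le_abs_self _).trans (h.trans ?_)
  rw [Measure.real, volume_openCube, ENNReal.toReal_pow, ENNReal.toReal_ofReal hr.1, mul_comm, mul_pow]
  have := pow_le_pow_left₀ hr.1 hr.2 (m + 1)
  gcongr

theorem norm_seriesTerm_le (D : H →ₗ.[ℂ] H) (𝒦 : H →L[ℂ] H) (β r : ℝ) (m : ℕ) :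
    ‖seriesTerm D 𝒦 β r m‖ ≤ ∫ u in openCube (m + 1) r, ‖seriesIntegrand D 𝒦 β m u‖ := by
  rw [seriesTerm, norm_smul, norm_pow, norm_neg, norm_one, one_pow, one_mul]
  exact norm_integral_le_integral_norm _

/-- The integrand of order n is bounded by ‖𝒦‖ⁿ on a cube of volume at most βⁿ, so the series is
dominated by a geometric one of ratio β‖𝒦‖ < 1. -/
theorem series_converges (hD : IsSelfAdjoint D) (hβ : 0 < β) (h𝒦β : ‖𝒦‖ < β⁻¹) {r : ℝ}
    (hr : r ∈ Set.Icc 0 β) :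
    (∀ m : ℕ, IntegrableOn (seriesIntegrand D 𝒦 β m) (openCube (m + 1) r)) ∧
      Summable (fun m : ℕ => ∫ u in openCube (m + 1) r, ‖seriesIntegrand D 𝒦 β m u‖) ∧
      Summable (fun m : ℕ => ‖seriesTerm D 𝒦 β r m‖) ∧
      HasSum (seriesTerm D 𝒦 β r)
        (T D 𝒦 β r - opFun D (fun x => ((1 / (1 + Real.exp (-β * x)) : ℝ) : ℂ))) := by
  have hlt : β * ‖𝒦‖ < 1 := by
    have := mul_lt_mul_of_pos_left h𝒦β hβ
    rwa [mul_inv_cancel₀ hβ.ne'] at this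
  have hgeo : Summable fun m : ℕ => (β * ‖𝒦‖) ^ (m + 1) :=
    (summable_nat_add_iff 1).mpr (summable_geometric_of_lt_one (by positivity) hlt)
  have h1 : Summable (fun m : ℕ => ∫ u in openCube (m + 1) r, ‖seriesIntegrand D 𝒦 β m u‖) :=
    hgeo.of_nonneg_of_le (fun m => integral_nonneg fun _ => norm_nonneg _)
      fun m => integral_norm_seriesIntegrand_le hD hβ hr m
  have h2 : Summable (fun m : ℕ => ‖seriesTerm D 𝒦 β r m‖) :=
    h1.of_nonneg_of_le (fun _ => norm_nonneg _) fun m => norm_seriesTerm_le D 𝒦 β r m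
  refine ⟨fun m => integrableOn_seriesIntegrand hD hβ hr.2 m, h1, h2, ?_⟩
  have h3 : T D 𝒦 β r - opFun D (fun x => ((1 / (1 + Real.exp (-β * x)) : ℝ) : ℂ)) =
      ∑' m, seriesTerm D 𝒦 β r m := add_sub_cancel_left _ _
  rw [h3]
  exact h2.of_norm.hasSum

end Series

/-! ### Duhamel's formula and the value of T(β). -/

section Duhamel

variable {H : Type*} [NormedAddCommGroup H] [InnerProductSpace ℂ H] [CompleteSpace H]
variable {D : H →ₗ.[ℂ] H} {𝒦 : H →L[ℂ] H} {β : ℝ}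

/-- A uniformly bounded, strongly continuous family of operators maps continuous families of vectors
to continuous families of vectors. -/
theorem continuousOn_clm_apply {Z : Type*} [TopologicalSpace Z] {A : Z → H →L[ℂ] H} {h : Z → H}
    {s : Set Z} {C : ℝ} (hA : ∀ y, ContinuousOn (fun z => A z y) s) (hC : ∀ z ∈ s, ‖A z‖ ≤ C)
    (hh : ContinuousOn h s) : ContinuousOn (fun z => A z (h z)) s := by
  intro z hz
  have h1 := hA (h z) z hz
  have h2 : Tendsto (fun w => A w (h w - h z)) (𝓝[s] z) (𝓝 0) := by
    rw [tendsto_zero_iff_norm_tendsto_zero]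
    have h3 : Tendsto (fun w => C * ‖h w - h z‖) (𝓝[s] z) (𝓝 0) := by
      have := ((tendsto_iff_norm_sub_tendsto_zero.mp (hh z hz)).const_mul C)
      simpa using this
    refine squeeze_zero' (Eventually.of_forall fun _ => norm_nonneg _) ?_ h3
    filter_upwards [self_mem_nhdsWithin] with w hw
    exact (ContinuousLinearMap.le_opNorm _ _).trans
      (mul_le_mul_of_nonneg_right (hC w hw) (norm_nonneg _))
  have h4 := Tendsto.add h1 h2
  rw [add_zero] at h4
  refine h4.congr fun w => ?_
  rw [map_sub]
  abel

/-- With A = D + 𝒦 the left side is f(D)(A − D)g(A)y. It makes sense because g(A) maps into the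
common domain of A and D, where A − D = 𝒦. -/
theorem fermiOp_intertwine (hD : IsSelfAdjoint D) (h𝒦 : IsSelfAdjoint 𝒦) {z w : ℂ}
    (hz : z.re ∈ Set.Ioo 0 β) (hw : w.re ∈ Set.Ioo 0 β) (y : H) :
    fermiOp D β z (opFun (perturbed D 𝒦) (fun x : ℝ => (x : ℂ) * expFn (fermi β) w x) y) -
      opFun D (fun x : ℝ => (x : ℂ) * expFn (fermi β) z x) (fermiOp (perturbed D 𝒦) β w y) =
    fermiOp D β z (𝒦 (fermiOp (perturbed D 𝒦) β w y)) := by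
  obtain ⟨h, h'⟩ := opFun_mem_domain (perturbed_isSelfAdjoint hD h𝒦)
    ((expBdd_fermi β).bddCont ⟨hw.1.le, hw.2.le⟩) ((expBdd_fermi β).mul_id hw) y
  have h1 := opFun_apply_D hD ((expBdd_fermi β).bddCont ⟨hz.1.le, hz.2.le⟩)
    ((expBdd_fermi β).mul_id hz) ⟨_, h⟩
  have h2 : opFun (perturbed D 𝒦) (fun x : ℝ => (x : ℂ) * expFn (fermi β) w x) y =
      𝒦 (fermiOp (perturbed D 𝒦) β w y) + D ⟨fermiOp (perturbed D 𝒦) β w y, h⟩ := h'.symm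
  rw [h2, map_add, sub_eq_iff_eq_add]
  congr 1

/-- The integrand is the derivative of X_D(c − t)X_A(t)y. At the ends of the strip there is only
strong continuity, hence the vector y and a derivative taken in the open interval. The hypotheses
keep c − t in [0, β]. -/
theorem integral_fermiOp (hD : IsSelfAdjoint D) (h𝒦 : IsSelfAdjoint 𝒦) {a b c : ℝ} (hab : a ≤ b)
    (ha : 0 ≤ a) (hb : b ≤ β) (hca : c - a ≤ β) (hcb : 0 ≤ c - b) (y : H) :
    ∫ t in Set.Ioo a b, fermiOp D β (c - t : ℝ) (𝒦 (fermiOp (perturbed D 𝒦) β t y)) =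
      fermiOp D β (c - b : ℝ) (fermiOp (perturbed D 𝒦) β b y) -
        fermiOp D β (c - a : ℝ) (fermiOp (perturbed D 𝒦) β a y) := by
  have hA := perturbed_isSelfAdjoint hD h𝒦
  have hcont : ∀ {g : ℝ → H}, ContinuousOn g (Set.Icc a b) →
      ContinuousOn (fun t : ℝ => fermiOp D β (c - t : ℝ) (g t)) (Set.Icc a b) := by
    intro g hg
    refine continuousOn_clm_apply (C := 1) (fun y => ?_) (fun t ht => ?_) hg
    · refine (continuousOn_fermiOp_apply hD y).comp (f := fun t : ℝ => ((c - t : ℝ) : ℂ))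
        (by fun_prop) fun t ht => ?_
      exact ⟨by simpa using by linarith [ht.2], by simpa using by linarith [ht.1]⟩
    · refine norm_fermiOp_le hD ?_
      exact ⟨by simpa using by linarith [ht.2], by simpa using by linarith [ht.1]⟩
  have hcontA : ContinuousOn (fun t : ℝ => fermiOp (perturbed D 𝒦) β t y) (Set.Icc a b) := by
    refine (continuousOn_fermiOp_apply hA y).comp (f := fun t : ℝ => (t : ℂ)) (by fun_prop)
      fun t ht => ?_
    exact ⟨by simpa using by linarith [ht.1], by simpa using by linarith [ht.2]⟩
  have hint : IntervalIntegrable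
      (fun t : ℝ => fermiOp D β (c - t : ℝ) (𝒦 (fermiOp (perturbed D 𝒦) β t y))) volume a b := by
    refine ContinuousOn.intervalIntegrable ?_
    rw [Set.uIcc_of_le hab]
    exact hcont (𝒦.continuous.comp_continuousOn hcontA)
  rw [← integral_Ioc_eq_integral_Ioo, ← intervalIntegral.integral_of_le hab]
  refine intervalIntegral.integral_eq_sub_of_hasDerivAt_of_le hab (hcont hcontA) (fun t ht => ?_) hint
  have hz : ((c - t : ℝ) : ℂ).re ∈ Set.Ioo 0 β := by
    rw [Complex.ofReal_re]
    exact ⟨by linarith [ht.2], by linarith [ht.1]⟩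
  have hw : ((t : ℝ) : ℂ).re ∈ Set.Ioo 0 β := by
    rw [Complex.ofReal_re]
    exact ⟨by linarith [ht.1], by linarith [ht.2]⟩
  have h1 : HasDerivAt (fun t : ℝ => fermiOp D β (c - t : ℝ))
      (-opFun D (fun x : ℝ => (x : ℂ) * expFn (fermi β) ((c - t : ℝ) : ℂ) x)) t := by
    have h2 : HasDerivAt (fun t : ℝ => ((c - t : ℝ) : ℂ)) (-1 : ℂ) t := by
      have := ((hasDerivAt_id t).const_sub c).ofReal_comp
      simpa using this
    have := HasDerivAt.scomp (𝕜 := ℝ) t (hasDerivAt_fermiOp hD hz) h2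
    simpa [Function.comp_def] using this
  have h3 : HasDerivAt (fun t : ℝ => fermiOp (perturbed D 𝒦) β t)
      (opFun (perturbed D 𝒦) (fun x : ℝ => (x : ℂ) * expFn (fermi β) (t : ℂ) x)) t :=
    by
      have h5 : HasDerivAt (fun t : ℝ => (t : ℂ)) 1 t := by
        simpa using (hasDerivAt_id t).ofReal_comp
      simpa [Function.comp_def] using HasDerivAt.scomp (𝕜 := ℝ) t (hasDerivAt_fermiOp hA hw) h5
  have h4 := ((ContinuousLinearMap.apply ℂ H y).restrictScalars ℝ).hasFDerivAt.comp_hasDerivAt t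
    (h1.mul h3)
  refine (h4.congr_deriv ?_ : HasDerivAt (fun t : ℝ => fermiOp D β (c - t : ℝ)
    (fermiOp (perturbed D 𝒦) β t y)) _ t)
  rw [← fermiOp_intertwine hD h𝒦 hz hw y]
  simp
  abel

theorem integrableOn_kernelOp_mul (hD : IsSelfAdjoint D) {A : H →ₗ.[ℂ] H} (hA : IsSelfAdjoint A)
    {s : ℝ} (hs : s ∈ Set.Ico 0 β) :
    IntegrableOn (fun t : ℝ => kernelOp D β (s - t) * 𝒦 * fermiOp A β t) (Set.Ioo 0 β) := by
  refine integrableOn_Ioo_of_continuousOn (s := s) (C := ‖𝒦‖) ?_ fun t ht => ?_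
  · refine (ContinuousOn.mul ?_ continuousOn_const).mul ?_
    · intro t ht
      refine ContinuousAt.continuousWithinAt (ContinuousAt.comp (f := fun t : ℝ => s - t)
        (continuousAt_kernelOp hD ?_ (sub_ne_zero.mpr ht.2.symm)) (by fun_prop))
      exact ⟨by linarith [hs.1, ht.1.2], by linarith [hs.2, ht.1.1]⟩
    · intro t ht
      exact ContinuousAt.continuousWithinAt (ContinuousAt.comp (f := fun t : ℝ => (t : ℂ))
        (continuousAt_fermiOp hA (by simpa using ht.1)) (by fun_prop))
  · have h1 := norm_kernelOp_le hD (β := β) (s := s - t)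
      ⟨by linarith [hs.1, ht.2], by linarith [hs.2, ht.1]⟩
    have h2 := norm_fermiOp_le hA (β := β) (z := t) (by simpa using ⟨ht.1.le, ht.2.le⟩)
    refine (norm_mul_le _ _).trans ((mul_le_mul ((norm_mul_le _ _).trans
      (mul_le_mul_of_nonneg_right h1 (norm_nonneg _))) h2 (norm_nonneg _) (by positivity)).trans ?_)
    simp

/-- Duhamel's formula for the Fermi factors of `D` and `D + 𝒦`. -/
theorem duhamel (hD : IsSelfAdjoint D) (h𝒦 : IsSelfAdjoint 𝒦) {s : ℝ} (hs : s ∈ Set.Ico 0 β) :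
    fermiOp (perturbed D 𝒦) β s - fermiOp D β s =
      -∫ t in Set.Ioo 0 β, kernelOp D β (s - t) * 𝒦 * fermiOp (perturbed D 𝒦) β t := by
  have hA := perturbed_isSelfAdjoint hD h𝒦
  have hβ : 0 < β := hs.1.trans_lt hs.2
  have hint := integrableOn_kernelOp_mul (𝒦 := 𝒦) hD hA hs
  ext y
  rw [_root_.neg_apply, ContinuousLinearMap.integral_apply hint]
  have hint' : IntegrableOn (fun t : ℝ => (kernelOp D β (s - t) * 𝒦 *
      fermiOp (perturbed D 𝒦) β t) y) (Set.Ioo 0 β) :=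
    ((ContinuousLinearMap.apply ℂ H y).integrable_comp hint)
  -- The kernel changes its branch at t = s; the two pieces are integrated exactly with c = s and c
  -- = β + s.
  have hsplit : Set.Ioo 0 β =ᵐ[volume] (Set.Ioo 0 s ∪ Set.Ioo s β : Set ℝ) := by
    filter_upwards [Measure.ae_ne volume s, Measure.ae_ne volume 0] with t ht ht0
    refine propext ⟨fun h => ?_, fun h => ?_⟩
    · rcases lt_or_gt_of_ne ht with h1 | h1
      · exact Or.inl ⟨h.1, h1⟩
      · exact Or.inr ⟨h1, h.2⟩
    · rcases h with h | h
      · exact ⟨h.1, h.2.trans hs.2⟩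
      · exact ⟨hs.1.trans_lt h.1, h.2⟩
  have hsub1 : (Set.Ioo 0 s : Set ℝ) ⊆ Set.Ioo 0 β := Set.Ioo_subset_Ioo_right hs.2.le
  have hsub2 : (Set.Ioo s β : Set ℝ) ⊆ Set.Ioo 0 β := Set.Ioo_subset_Ioo_left hs.1
  rw [setIntegral_congr_set hsplit, setIntegral_union
    (Set.disjoint_left.mpr fun t h1 h2 => lt_asymm h1.2 h2.1) measurableSet_Ioo
    (hint'.mono_set hsub1) (hint'.mono_set hsub2)]
  have e1 : ∫ t in Set.Ioo 0 s, (kernelOp D β (s - t) * 𝒦 * fermiOp (perturbed D 𝒦) β t) y =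
      -∫ t in Set.Ioo 0 s, fermiOp D β (s - t : ℝ) (𝒦 (fermiOp (perturbed D 𝒦) β t y)) := by
    rw [← integral_neg]
    refine setIntegral_congr_fun measurableSet_Ioo fun t ht => ?_
    have := kernelOp_of_pos hD (β := β) (s := s - t) (by linarith [ht.2]) (by linarith [ht.1, hs.2])
    simp only [this]
    simp
  have e2 : ∫ t in Set.Ioo s β, (kernelOp D β (s - t) * 𝒦 * fermiOp (perturbed D 𝒦) β t) y =
      ∫ t in Set.Ioo s β, fermiOp D β (β + s - t : ℝ) (𝒦 (fermiOp (perturbed D 𝒦) β t y)) := by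
    refine setIntegral_congr_fun measurableSet_Ioo fun t ht => ?_
    have := kernelOp_of_nonpos D β (s := s - t) (by linarith [ht.1])
    simp only [this]
    push_cast
    rw [← add_sub_assoc]
    simp
  rw [e1, e2, integral_fermiOp hD h𝒦 hs.1 le_rfl hs.2.le (by linarith [hs.2]) (by linarith) y,
    integral_fermiOp hD h𝒦 hs.2.le hs.1 le_rfl (by linarith) (by linarith [hs.1]) y]
  -- The boundary terms at t = s add up to (X_D(0) + X_D(β))X_A(s) = X_A(s), and those at t = 0 and
  -- t = β to X_D(s)(X_A(0) + X_A(β)) = X_D(s).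
  have h0 := congrArg (fun A : H →L[ℂ] H => A (fermiOp (perturbed D 𝒦) β s y))
    (fermiOp_zero_add_beta hD hβ.le)
  have h1 := congrArg (fun A : H →L[ℂ] H => fermiOp D β s (A y)) (fermiOp_zero_add_beta hA hβ.le)
  simp only [_root_.add_apply, one_apply_eq_self, map_add] at h0 h1
  simp only [_root_.sub_apply, sub_self, sub_zero, add_sub_cancel_left, add_sub_cancel_right,
    Complex.ofReal_zero]
  conv_lhs => rw [← h0, ← h1]
  abel

/-- The iterated integrals of the chains. -/
def chainIntegral (D : H →ₗ.[ℂ] H) (𝒦 : H →L[ℂ] H) (β : ℝ) (m : ℕ) (s : ℝ) : H →L[ℂ] H :=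
  ∫ u in openCube m β, chain D 𝒦 β m s u

theorem chainIntegral_zero (hD : IsSelfAdjoint D) {s : ℝ} (hs : s ∈ Set.Icc 0 β) :
    chainIntegral D 𝒦 β 0 s = -fermiOp D β s := by
  have h1 : openCube 0 β = Set.univ := Set.eq_univ_of_forall fun u i => i.elim0
  rw [chainIntegral, h1, Measure.restrict_univ, ← opFun_fermiPlus hD hs]
  simp [chain, Measure.real, volume_pi]

theorem chainIntegral_succ (hD : IsSelfAdjoint D) (m : ℕ) {s : ℝ} (hs : s ∈ Set.Ico 0 β) :
    IntegrableOn (fun t => kernelOp D β (s - t) * 𝒦 * chainIntegral D 𝒦 β m t) (Set.Ioo 0 β) ∧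
    chainIntegral D 𝒦 β (m + 1) s =
      ∫ t in Set.Ioo 0 β, kernelOp D β (s - t) * 𝒦 * chainIntegral D 𝒦 β m t := by
  obtain ⟨h1, h2⟩ := setIntegral_openCube_succ (integrableOn_chain (𝒦 := 𝒦) hD (m + 1) hs)
  have h3 : ∀ t ∈ Set.Ioo 0 β, ∫ u in openCube m β, chain D 𝒦 β (m + 1) s (Fin.cons t u) =
      kernelOp D β (s - t) * 𝒦 * chainIntegral D 𝒦 β m t := fun t ht => by
    simp only [chain, Fin.cons_zero, Fin.tail_cons]
    rw [integral_const_mul_of_integrable]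
    · rfl
    · exact integrableOn_chain hD m ⟨ht.1.le, ht.2⟩
  exact ⟨h1.congr_fun h3 measurableSet_Ioo, h2.trans (setIntegral_congr_fun measurableSet_Ioo h3)⟩

/-- By Duhamel's formula each remainder is minus the integral transform, with kernel G(s − t)𝒦, of
the previous one. The transform has norm at most β‖𝒦‖, and the iteration starts from a contraction.
The signs come from the chain of order 0 being −X_D(s). -/
theorem norm_perturbation_remainder_le (hD : IsSelfAdjoint D) (h𝒦 : IsSelfAdjoint 𝒦) (N : ℕ) {s : ℝ}
    (hs : s ∈ Set.Ico 0 β) :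
    ‖fermiOp (perturbed D 𝒦) β s +
      ∑ m ∈ Finset.range N, (-1 : ℂ) ^ m • chainIntegral D 𝒦 β m s‖ ≤ (β * ‖𝒦‖) ^ N := by
  have hA := perturbed_isSelfAdjoint hD h𝒦
  have hβ : 0 < β := hs.1.trans_lt hs.2
  induction N generalizing s with
  | zero =>
    simpa using norm_fermiOp_le hA (β := β) (z := s) (by simpa using ⟨hs.1, hs.2.le⟩)
  | succ N ih =>
    have hX := integrableOn_kernelOp_mul (𝒦 := 𝒦) hD hA hs
    have hI := fun m => (chainIntegral_succ (𝒦 := 𝒦) hD m hs)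
    have key : fermiOp (perturbed D 𝒦) β s +
        ∑ m ∈ Finset.range (N + 1), (-1 : ℂ) ^ m • chainIntegral D 𝒦 β m s =
        -∫ t in Set.Ioo 0 β, kernelOp D β (s - t) * 𝒦 * (fermiOp (perturbed D 𝒦) β t +
          ∑ m ∈ Finset.range N, (-1 : ℂ) ^ m • chainIntegral D 𝒦 β m t) := by
      have h1 : ∀ t : ℝ, kernelOp D β (s - t) * 𝒦 * (fermiOp (perturbed D 𝒦) β t +
          ∑ m ∈ Finset.range N, (-1 : ℂ) ^ m • chainIntegral D 𝒦 β m t) =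
          kernelOp D β (s - t) * 𝒦 * fermiOp (perturbed D 𝒦) β t +
          ∑ m ∈ Finset.range N, (-1 : ℂ) ^ m • (kernelOp D β (s - t) * 𝒦 * chainIntegral D 𝒦 β m t) :=
        fun t => by
          rw [mul_add, Finset.mul_sum]
          simp only [mul_smul_comm]
      simp only [h1]
      have hI' : ∀ m ∈ Finset.range N, IntegrableOn (fun t => (-1 : ℂ) ^ m •
          (kernelOp D β (s - t) * 𝒦 * chainIntegral D 𝒦 β m t)) (Set.Ioo 0 β) :=
        fun m _ => (hI m).1.smul ((-1 : ℂ) ^ m)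
      rw [integral_add hX (integrable_finsetSum _ hI'), integral_finsetSum _ hI']
      simp only [integral_smul, ← (hI _).2]
      rw [neg_add, ← duhamel hD h𝒦 hs, Finset.sum_range_succ', chainIntegral_zero hD ⟨hs.1, hs.2.le⟩]
      simp only [pow_succ, mul_neg, mul_one, neg_smul, Finset.sum_neg_distrib, pow_zero, one_smul]
      abel
    rw [key, norm_neg]
    have hbound := norm_setIntegral_le_of_norm_le_const (μ := volume) (s := Set.Ioo 0 β)
      (f := fun t : ℝ => kernelOp D β (s - t) * 𝒦 * (fermiOp (perturbed D 𝒦) β t +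
          ∑ m ∈ Finset.range N, (-1 : ℂ) ^ m • chainIntegral D 𝒦 β m t))
      (C := ‖𝒦‖ * (β * ‖𝒦‖) ^ N) measure_Ioo_lt_top (fun t ht => by
        have h1 := norm_kernelOp_le hD (β := β) (s := s - t)
          ⟨by linarith [hs.1, ht.2], by linarith [hs.2, ht.1]⟩
        have h2 := ih (s := t) ⟨ht.1.le, ht.2⟩
        refine (norm_mul_le _ _).trans (mul_le_mul ((norm_mul_le _ _).trans ?_) h2 (norm_nonneg _)
          (norm_nonneg _))
        calc _ ≤ 1 * ‖𝒦‖ := mul_le_mul_of_nonneg_right h1 (norm_nonneg _)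
          _ = ‖𝒦‖ := one_mul _)
    refine hbound.trans (le_of_eq ?_)
    rw [Measure.real, Real.volume_Ioo, sub_zero, ENNReal.toReal_ofReal hβ.le]
    ring

theorem seriesTerm_eq (D : H →ₗ.[ℂ] H) (𝒦 : H →L[ℂ] H) (β : ℝ) (m : ℕ) :
    seriesTerm D 𝒦 β β m = (-1 : ℂ) ^ (m + 1) • chainIntegral D 𝒦 β (m + 1) 0 := by
  rw [seriesTerm, chainIntegral, setIntegral_congr_fun (measurableSet_openCube _ _)
    fun u hu => seriesIntegrand_eq_chain D 𝒦 m (hu 0).1.le]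

/-- At s = 0 the remainder tends to zero, so X_A(0) = X_D(0) − (T(β) − X_D(β)) = 1 − T(β), while
X_A(β) = 1 − X_A(0). -/
theorem T_beta_eq (hD : IsSelfAdjoint D) (h𝒦 : IsSelfAdjoint 𝒦) (hβ : 0 < β) (h𝒦β : ‖𝒦‖ < β⁻¹) :
    T D 𝒦 β β = fermiOp (perturbed D 𝒦) β β := by
  have hA := perturbed_isSelfAdjoint hD h𝒦
  have hlt : β * ‖𝒦‖ < 1 := by
    have := mul_lt_mul_of_pos_left h𝒦β hβ
    rwa [mul_inv_cancel₀ hβ.ne'] at this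
  have hsum := (series_converges hD hβ h𝒦β (r := β) ⟨hβ.le, le_rfl⟩).2.2.2
  rw [← fermiOp_beta] at hsum
  have h1 := hsum.tendsto_sum_nat
  have h2 : Tendsto (fun N => fermiOp (perturbed D 𝒦) β (0 : ℝ) +
      ∑ m ∈ Finset.range (N + 1), (-1 : ℂ) ^ m • chainIntegral D 𝒦 β m 0) atTop (𝓝 0) := by
    rw [tendsto_zero_iff_norm_tendsto_zero]
    refine squeeze_zero (fun _ => norm_nonneg _)
      (fun N => norm_perturbation_remainder_le hD h𝒦 (N + 1) ⟨le_rfl, hβ⟩) ?_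
    exact (tendsto_add_atTop_iff_nat 1).mpr
      (tendsto_pow_atTop_nhds_zero_of_lt_one (by positivity) hlt)
  have h3 : Tendsto (fun N => fermiOp (perturbed D 𝒦) β (0 : ℝ) - fermiOp D β (0 : ℝ) +
      ∑ m ∈ Finset.range N, seriesTerm D 𝒦 β β m) atTop (𝓝 0) := by
    refine h2.congr fun N => ?_
    rw [Finset.sum_range_succ', chainIntegral_zero hD ⟨le_rfl, hβ.le⟩]
    simp only [seriesTerm_eq, pow_zero, one_smul]
    abel
  have h4 := tendsto_nhds_unique h3 (h1.const_add _)
  have h5 := fermiOp_zero_add_beta hD hβ.le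
  have h6 := fermiOp_zero_add_beta hA hβ.le
  simp only [Complex.ofReal_zero] at h4
  have h7 : T D 𝒦 β β = fermiOp D β 0 + fermiOp D β β - fermiOp (perturbed D 𝒦) β 0 := by
    have h8 : T D 𝒦 β β = (fermiOp (perturbed D 𝒦) β 0 - fermiOp D β 0 +
      (T D 𝒦 β β - fermiOp D β β)) + (fermiOp D β 0 + fermiOp D β β - fermiOp (perturbed D 𝒦) β 0) := by
      abel
    rw [← h4, zero_add] at h8
    exact h8
  rw [h7, h5, ← h6]
  abel

end Duhamel

/-! ### The canonical anticommutation relations. -/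

section CARRelations

variable {H : Type*} [NormedAddCommGroup H] [InnerProductSpace ℂ H] [CompleteSpace H]
variable {𝔄 : Type*} [CStarAlgebra 𝔄] {ψ : H →ₗ⋆[ℂ] 𝔄}

/-- The relation for f, if and (1 + i)f weights ψ(f)², its adjoint and the anticommutator with
different phases, which separates the three. -/
theorem IsCARAlgebra.diagonal (hψ : IsCARAlgebra ψ) (f : H) :
    ψ f * ψ f = 0 ∧ ψ f * star (ψ f) + star (ψ f) * ψ f = ⟪f, f⟫_ℂ • (1 : 𝔄) := by
  have h1 := hψ.relation f
  have h2 := hψ.relation (Complex.I • f)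
  have h3 := hψ.relation ((1 + Complex.I) • f)
  simp only [map_smulₛₗ, star_smul, inner_smul_left, inner_smul_right, Algebra.algebraMap_eq_smul_one,
    pow_two, mul_add, add_mul, smul_mul_smul_comm, RCLike.star_def, map_add, map_one,
    Complex.conj_I, map_neg, neg_neg] at h1 h2 h3
  set a := ψ f
  set b := star (ψ f)
  set n := ⟪f, f⟫_ℂ
  have hI : Complex.I * Complex.I = -1 := Complex.I_mul_I
  have e2 : -(a * a) + (a * b + b * a) - b * b = n • (1 : 𝔄) := by
    have hn : Complex.I * (-Complex.I * n) = n := by linear_combination -n * hI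
    rw [hn] at h2
    rw [← h2]
    simp only [neg_mul, mul_neg, neg_neg, hI]
    module
  have e3 : (-Complex.I) • (a * a) + (a * b + b * a) + Complex.I • (b * b) = n • (1 : 𝔄) := by
    have hIn : Complex.I * (Complex.I * n) = -n := by rw [← mul_assoc, hI, neg_one_mul]
    simp only [one_mul, mul_one, neg_mul, mul_neg, neg_neg, hI, hIn] at h3
    have : (2 : ℂ) • ((-Complex.I) • (a * a) + (a * b + b * a) + Complex.I • (b * b)) =
        (2 : ℂ) • (n • (1 : 𝔄)) := by
      calc _ = _ := by module
        _ = _ := h3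
        _ = _ := by module
    exact smul_right_injective 𝔄 (two_ne_zero (α := ℂ)) this
  have e4 : (2 : ℂ) • (a * b + b * a) = (2 : ℂ) • (n • (1 : 𝔄)) := by
    calc _ = (a * a + b * a + (a * b + b * b)) + (-(a * a) + (a * b + b * a) - b * b) := by module
      _ = _ := by rw [h1, e2]; module
  have e5 : a * b + b * a = n • (1 : 𝔄) := smul_right_injective 𝔄 (two_ne_zero (α := ℂ)) e4
  refine ⟨?_, e5⟩
  have e6 : a * a + b * b = 0 := by
    calc _ = (a * a + b * a + (a * b + b * b)) - (a * b + b * a) := by abel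
      _ = 0 := by rw [h1, e5]; simp
  have e7 : Complex.I • (b * b - a * a) = 0 := by
    calc _ = ((-Complex.I) • (a * a) + (a * b + b * a) + Complex.I • (b * b)) - (a * b + b * a) := by
            module
      _ = 0 := by rw [e3, e5]; simp
  have e8 : b * b = a * a := by
    rw [← sub_eq_zero]
    exact (smul_eq_zero.mp e7).resolve_left Complex.I_ne_zero
  rw [e8, ← two_smul ℂ] at e6
  exact (smul_eq_zero.mp e6).resolve_left two_ne_zero

theorem IsCARAlgebra.mul_self (hψ : IsCARAlgebra ψ) (f : H) : ψ f * ψ f = 0 := (hψ.diagonal f).1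

theorem IsCARAlgebra.anticomm (hψ : IsCARAlgebra ψ) (f g : H) : ψ f * ψ g = -(ψ g * ψ f) := by
  have h := hψ.mul_self (f + g)
  rw [map_add, mul_add, add_mul, add_mul, hψ.mul_self, hψ.mul_self] at h
  rw [eq_neg_iff_add_eq_zero, ← h]
  abel

theorem IsCARAlgebra.anticomm_star (hψ : IsCARAlgebra ψ) (f g : H) :
    ψ f * star (ψ g) + star (ψ g) * ψ f = ⟪f, g⟫_ℂ • (1 : 𝔄) := by
  have h1 := (hψ.diagonal (f + g)).2
  have h2 := (hψ.diagonal (f + Complex.I • g)).2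
  have hf := (hψ.diagonal f).2
  have hg := (hψ.diagonal g).2
  simp only [map_add, star_add, mul_add, add_mul, inner_add_left, inner_add_right, map_smulₛₗ,
    star_smul, inner_smul_left, inner_smul_right, mul_smul_comm, smul_mul_assoc,
    RCLike.star_def, Complex.conj_I, map_neg, neg_neg, add_smul] at h1 h2
  rw [← hf, ← hg] at h1
  have hI : Complex.I * Complex.I = -1 := Complex.I_mul_I
  simp only [smul_add, smul_smul, neg_mul, mul_neg, hI, neg_neg, one_smul] at h2
  have hIg : Complex.I * (Complex.I * ⟪g, g⟫_ℂ) = -⟪g, g⟫_ℂ := by linear_combination ⟪g, g⟫_ℂ * hI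
  rw [hIg, neg_neg, ← hf, ← hg] at h2
  have e1 : ψ f * star (ψ g) + star (ψ g) * ψ f + (ψ g * star (ψ f) + star (ψ f) * ψ g) =
      ⟪f, g⟫_ℂ • (1 : 𝔄) + ⟪g, f⟫_ℂ • (1 : 𝔄) := by
    refine add_left_cancel (a := ψ f * star (ψ f) + star (ψ f) * ψ f +
      (ψ g * star (ψ g) + star (ψ g) * ψ g)) ?_
    calc _ = _ := by abel
      _ = _ := h1
      _ = _ := by abel
  have e2 : Complex.I • (ψ f * star (ψ g) + star (ψ g) * ψ f) -
      Complex.I • (ψ g * star (ψ f) + star (ψ f) * ψ g) =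
      Complex.I • (⟪f, g⟫_ℂ • (1 : 𝔄)) - Complex.I • (⟪g, f⟫_ℂ • (1 : 𝔄)) := by
    refine add_left_cancel (a := ψ f * star (ψ f) + star (ψ f) * ψ f +
      (ψ g * star (ψ g) + star (ψ g) * ψ g)) ?_
    calc _ = _ := by module
      _ = _ := h2
      _ = _ := by module
  have e3 : (2 : ℂ) • (ψ f * star (ψ g) + star (ψ g) * ψ f) = (2 : ℂ) • (⟪f, g⟫_ℂ • (1 : 𝔄)) := by
    rw [← smul_sub, ← smul_sub] at e2
    have e4 := smul_right_injective 𝔄 Complex.I_ne_zero e2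
    calc _ = (ψ f * star (ψ g) + star (ψ g) * ψ f + (ψ g * star (ψ f) + star (ψ f) * ψ g)) +
          (ψ f * star (ψ g) + star (ψ g) * ψ f - (ψ g * star (ψ f) + star (ψ f) * ψ g)) := by module
      _ = _ := by rw [e1, e4]; module
  exact smul_right_injective 𝔄 (two_ne_zero (α := ℂ)) e3

theorem IsCARAlgebra.star_mul_eq (hψ : IsCARAlgebra ψ) (f g : H) :
    star (ψ g) * ψ f = ⟪f, g⟫_ℂ • (1 : 𝔄) - ψ f * star (ψ g) :=
  eq_sub_of_add_eq' (hψ.anticomm_star f g)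

theorem IsCARAlgebra.anticomm_star_star (hψ : IsCARAlgebra ψ) (f g : H) :
    star (ψ f) * star (ψ g) = -(star (ψ g) * star (ψ f)) := by
  rw [← star_mul, ← star_mul, hψ.anticomm, star_neg]

/-- Dropping the positive term ψ(f)ψ(f)* from the anticommutator leaves ψ(f)*ψ(f) ≤ ‖f‖². -/
theorem IsCARAlgebra.norm_le (hψ : IsCARAlgebra ψ) (f : H) : ‖ψ f‖ ≤ ‖f‖ := by
  let _ : PartialOrder 𝔄 := CStarAlgebra.spectralOrder 𝔄
  let _ : StarOrderedRing 𝔄 := CStarAlgebra.spectralOrderedRing 𝔄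
  have := hψ.nontrivial
  have h1 : star (ψ f) * ψ f ≤ ⟪f, f⟫_ℂ • (1 : 𝔄) := by
    rw [← (hψ.diagonal f).2]
    exact le_add_of_nonneg_left (mul_star_self_nonneg _)
  have h2 := CStarAlgebra.norm_le_norm_of_nonneg_of_le (star_mul_self_nonneg (ψ f)) h1
  rw [CStarRing.norm_star_mul_self, norm_smul, norm_one, mul_one, inner_self_eq_norm_sq_to_K] at h2
  simp only [norm_pow, Complex.coe_algebraMap, Complex.norm_real, norm_norm] at h2
  nlinarith [norm_nonneg f, norm_nonneg (ψ f)]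

/-- The linear map `f ↦ ψ(f)*`. -/
def IsCARAlgebra.starL (hψ : IsCARAlgebra ψ) : H →L[ℂ] 𝔄 :=
  LinearMap.mkContinuous
    { toFun := fun f => star (ψ f)
      map_add' := fun f g => by rw [map_add, star_add]
      map_smul' := fun c f => by rw [map_smulₛₗ, star_smul]; simp } 1
    (fun f => by simpa using hψ.norm_le f)

theorem IsCARAlgebra.starL_apply (hψ : IsCARAlgebra ψ) (f : H) : hψ.starL f = star (ψ f) := rfl

theorem IsCARAlgebra.continuous (hψ : IsCARAlgebra ψ) : Continuous ψ := by
  have : Continuous fun f => star (hψ.starL f) := hψ.starL.continuous.star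
  simpa [IsCARAlgebra.starL_apply] using this

end CARRelations

/-! ### Bogoliubov automorphisms. -/

section Bogoliubov

variable {H : Type*} [NormedAddCommGroup H] [InnerProductSpace ℂ H] [CompleteSpace H]
variable {𝔄 : Type*} [CStarAlgebra 𝔄] {ψ : H →ₗ⋆[ℂ] 𝔄}

/-- The complex reflection `x ↦ x + μ ⟨e, x⟩ e`. -/
def complexReflection (e : H) (μ : ℂ) : H →ₗ[ℂ] H :=
  LinearMap.id + μ • ((innerSL ℂ e : H →ₗ[ℂ] ℂ).smulRight e)

theorem complexReflection_apply (e : H) (μ : ℂ) (x : H) :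
    complexReflection e μ x = x + (μ * ⟪e, x⟫_ℂ) • e := by
  simp [complexReflection, smul_smul]

theorem complexReflection_inner {e : H} {μ : ℂ} (he : ‖e‖ = 1) (hμ : μ + star μ + star μ * μ = 0)
    (x y : H) : ⟪complexReflection e μ x, complexReflection e μ y⟫_ℂ = ⟪x, y⟫_ℂ := by
  have hee : ⟪e, e⟫_ℂ = 1 := by simp [inner_self_eq_norm_sq_to_K, he]
  simp only [complexReflection_apply, inner_add_left, inner_add_right, inner_smul_left,
    inner_smul_right, hee, map_mul, inner_conj_symm]
  rw [RCLike.star_def] at hμ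
  linear_combination (⟪x, e⟫_ℂ * ⟪e, y⟫_ℂ) * hμ

/-- The unitary element `1 + μ ψ(e)* ψ(e)` implements the complex reflection. -/
theorem exists_unitary_complexReflection (hψ : IsCARAlgebra ψ) {e : H} {μ : ℂ} (he : ‖e‖ = 1)
    (hμ : μ + star μ + star μ * μ = 0) :
    ∃ v ∈ unitary 𝔄, ∀ x, v * ψ x = ψ (complexReflection e μ x) * v := by
  have hee : ⟪e, e⟫_ℂ = 1 := by simp [inner_self_eq_norm_sq_to_K, he]
  -- n is the projection onto the occupied mode e. The condition on μ says |1 + μ| = 1, so 1 + μn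
  -- multiplies the range of n by a phase.
  set n := star (ψ e) * ψ e with hn
  have hψn : ψ e * n = ψ e := by
    have : ψ e * star (ψ e) = 1 - n := by
      rw [eq_sub_iff_add_eq, hn, hψ.anticomm_star, hee, one_smul]
    rw [hn, ← mul_assoc, this, sub_mul, one_mul, hn, mul_assoc, hψ.mul_self, mul_zero, sub_zero]
  have hnn : n * n = n := by
    conv_lhs => rw [hn, mul_assoc, ← hn, hψn]
  have hsn : star n = n := by rw [hn, star_mul, star_star]
  have hμ' : star μ + μ + μ * star μ = 0 := by rw [← hμ]; ring
  refine ⟨1 + μ • n, ?_, fun x => ?_⟩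
  · rw [Unitary.mem_iff]
    constructor
    · calc star (1 + μ • n) * (1 + μ • n) = 1 + (μ + star μ + star μ * μ) • n := by
            rw [star_add, star_one, star_smul, hsn, mul_add, add_mul, add_mul, smul_mul_smul_comm, hnn]
            simp only [one_mul, mul_one]
            module
        _ = 1 := by rw [hμ, zero_smul, add_zero]
    · calc (1 + μ • n) * star (1 + μ • n) = 1 + (star μ + μ + μ * star μ) • n := by
            rw [star_add, star_one, star_smul, hsn, mul_add, add_mul, add_mul, smul_mul_smul_comm, hnn]
            simp only [one_mul, mul_one]
            module
        _ = 1 := by rw [hμ', zero_smul, add_zero]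
  · have h1 : n * ψ x = ψ x * n - ⟪x, e⟫_ℂ • ψ e := by
      rw [hn, mul_assoc, hψ.anticomm e x, mul_neg, ← mul_assoc, hψ.star_mul_eq, sub_mul, neg_sub,
        smul_mul_assoc, one_mul, mul_assoc]
    rw [complexReflection_apply, map_add, map_smulₛₗ, add_mul 1, smul_mul_assoc, h1, mul_add,
      mul_smul_comm, add_mul (ψ x), smul_mul_assoc, add_mul, smul_mul_assoc, hψn]
    simp only [one_mul, mul_one, map_mul, inner_conj_symm, smul_smul, smul_sub, smul_add]
    rw [RCLike.star_def] at hμ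
    have h2 : (μ * ⟪x, e⟫_ℂ) = -((starRingEnd ℂ) μ * ⟪x, e⟫_ℂ) - μ * ((starRingEnd ℂ) μ * ⟪x, e⟫_ℂ) := by
      linear_combination ⟪x, e⟫_ℂ * hμ
    rw [h2]
    module

/-- Take e along a − b and μ = −‖a − b‖²/(1 − ⟨b, a⟩), so that a moves by exactly b − a.
Unimodularity of 1 + μ follows from ‖a − b‖² = (1 − z) + (1 − z̄) with z = ⟨b, a⟩. Vectors
orthogonal to a and b stay fixed, which protects modes already moved. -/
theorem exists_complexReflection {a b : H} (ha : ‖a‖ = 1) (hb : ‖b‖ = 1) (hab : a ≠ b) :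
    ∃ (e : H) (μ : ℂ), ‖e‖ = 1 ∧ μ + star μ + star μ * μ = 0 ∧ complexReflection e μ a = b ∧
      ∀ c : H, ⟪c, a⟫_ℂ = 0 → ⟪c, b⟫_ℂ = 0 → complexReflection e μ c = c := by
  have haa : ⟪a, a⟫_ℂ = 1 := by simp [inner_self_eq_norm_sq_to_K, ha]
  have hbb : ⟪b, b⟫_ℂ = 1 := by simp [inner_self_eq_norm_sq_to_K, hb]
  have hr : 0 < ‖a - b‖ := norm_pos_iff.mpr (sub_ne_zero.mpr hab)
  have hrC : (‖a - b‖ : ℂ) ≠ 0 := Complex.ofReal_ne_zero.mpr hr.ne'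
  set z := ⟪b, a⟫_ℂ with hz
  have hz' : ⟪a, b⟫_ℂ = star z := (inner_conj_symm a b).symm
  have hz1 : 1 - z ≠ 0 := by
    intro h
    have : ⟪b, a⟫_ℂ = 1 := (sub_eq_zero.mp h).symm
    exact hab ((inner_eq_one_iff_of_norm_eq_one hb ha).mp this).symm
  have hz2 : 1 - star z ≠ 0 := by
    intro h
    apply hz1
    have := congrArg star h
    simpa using this
  have hnorm : (‖a - b‖ : ℂ) ^ 2 = (1 - z) + (1 - star z) := by
    have := inner_self_eq_norm_sq_to_K (𝕜 := ℂ) (a - b)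
    change _ = (‖a - b‖ : ℂ) ^ 2 at this
    rw [← this, inner_sub_left, inner_sub_right, inner_sub_right, haa, hbb, hz', ← hz]
    ring
  refine ⟨((‖a - b‖ : ℂ)⁻¹) • (a - b), -((1 - z) + (1 - star z)) / (1 - z), ?_, ?_, ?_, ?_⟩
  · rw [norm_smul, norm_inv, Complex.norm_real, norm_norm, inv_mul_cancel₀ hr.ne']
  · simp only [RCLike.star_def, map_div₀, map_neg, map_add, map_sub, map_one, Complex.conj_conj] at hz2 ⊢
    field_simp
    ring
  · rw [complexReflection_apply, inner_smul_left, inner_sub_left, haa, ← hz, smul_smul]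
    have : -(1 - z + (1 - star z)) / (1 - z) * ((starRingEnd ℂ) (‖a - b‖ : ℂ)⁻¹ * (1 - z)) *
        (‖a - b‖ : ℂ)⁻¹ = -1 := by
      rw [← hnorm, map_inv₀, Complex.conj_ofReal]
      field_simp
    rw [this]
    module
  · intro c hca hcb
    have h1 : ⟪a - b, c⟫_ℂ = 0 := by
      rw [← inner_conj_symm, inner_sub_right, hca, hcb]
      simp
    rw [complexReflection_apply, inner_smul_left, h1]
    simp

/-- Finitely many orthonormal modes can be moved to other ones by a unitary element. -/
theorem exists_unitary_implementing (hψ : IsCARAlgebra ψ) (n : ℕ) {f g : Fin n → H}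
    (hf : Orthonormal ℂ f) (hg : Orthonormal ℂ g) :
    ∃ v ∈ unitary 𝔄, ∃ W : H →ₗ[ℂ] H, (∀ x y, ⟪W x, W y⟫_ℂ = ⟪x, y⟫_ℂ) ∧
      (∀ x, v * ψ x = ψ (W x) * v) ∧ ∀ i, W (f i) = g i := by
  induction n with
  | zero => exact ⟨1, one_mem _, LinearMap.id, fun _ _ => rfl, fun x => by simp, fun i => i.elim0⟩
  | succ n ih =>
    obtain ⟨v, hv, W, hW, hvW, hWf⟩ := ih (hf.comp _ (Fin.castSucc_injective n))
      (hg.comp _ (Fin.castSucc_injective n))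
    by_cases h : W (f (Fin.last n)) = g (Fin.last n)
    · refine ⟨v, hv, W, hW, hvW, fun i => ?_⟩
      refine Fin.lastCases h (fun j => hWf j) i
    · have h1 : ‖W (f (Fin.last n))‖ = 1 := by
        have h2 := hW (f (Fin.last n)) (f (Fin.last n))
        rw [inner_self_eq_norm_sq_to_K, inner_self_eq_norm_sq_to_K, hf.1 (Fin.last n)] at h2
        have h3 : ‖W (f (Fin.last n))‖ ^ 2 = 1 ^ 2 := by exact_mod_cast h2
        exact (sq_eq_sq₀ (norm_nonneg _) zero_le_one).mp h3
      obtain ⟨e, μ, he, hμ, heb, hec⟩ := exists_complexReflection h1 (hg.1 (Fin.last n)) h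
      obtain ⟨w, hw, hwr⟩ := exists_unitary_complexReflection hψ he hμ
      refine ⟨w * v, mul_mem hw hv, complexReflection e μ ∘ₗ W, fun x y => ?_, fun x => ?_, fun i => ?_⟩
      · rw [LinearMap.comp_apply, LinearMap.comp_apply, complexReflection_inner he hμ, hW]
      · rw [mul_assoc, hvW, ← mul_assoc, hwr, mul_assoc]; rfl
      · refine Fin.lastCases heb (fun j => ?_) i
        rw [LinearMap.comp_apply]
        have h4 : W (f j.castSucc) = g j.castSucc := hWf j
        rw [h4]
        refine hec _ ?_ ?_
        · rw [← h4, hW]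
          exact hf.2 (Fin.castSucc_lt_last j).ne
        · exact hg.2 (Fin.castSucc_lt_last j).ne

/-- U itself need not be implemented by an element of the algebra, but its restriction to finitely
many modes is. -/
theorem exists_unitary_implementing_on (hψ : IsCARAlgebra ψ) (V : Submodule ℂ H)
    [FiniteDimensional ℂ V] {U : H →L[ℂ] H} (hU : ∀ x y, ⟪U x, U y⟫_ℂ = ⟪x, y⟫_ℂ) :
    ∃ v ∈ unitary 𝔄, ∀ x ∈ V, v * ψ x = ψ (U x) * v := by
  let b := stdOrthonormalBasis ℂ V
  have hf : Orthonormal ℂ (fun i => (b i : H)) := b.orthonormal.comp_linearIsometry V.subtypeₗᵢ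
  have hg : Orthonormal ℂ (fun i => U (b i : H)) := by
    rw [orthonormal_iff_ite] at hf ⊢
    intro i j
    rw [hU, hf]
  obtain ⟨v, hv, W, -, hvW, hWf⟩ := exists_unitary_implementing hψ _ hf hg
  refine ⟨v, hv, fun x hx => ?_⟩
  have hWU : W x = U x := by
    have h1 : W ∘ₗ V.subtype = (U : H →ₗ[ℂ] H) ∘ₗ V.subtype := by
      refine b.toBasis.ext fun i => ?_
      simpa using hWf i
    exact congrArg (fun L : V →ₗ[ℂ] H => L ⟨x, hx⟩) h1
  rw [hvW, hWU]

/-- A polynomial in the generators involves finitely many modes, so its two components are conjugate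
by one unitary v and have equal norm. Equality of norms passes to the closure, which is thus the
graph of an isometry. -/
theorem norm_eq_of_mem_adjoin_pairs (hψ : IsCARAlgebra ψ) {U : H →L[ℂ] H}
    (hU : ∀ x y, ⟪U x, U y⟫_ℂ = ⟪x, y⟫_ℂ) {p : 𝔄 × 𝔄}
    (hp : p ∈ (StarAlgebra.adjoin ℂ (Set.range fun f => (ψ f, ψ (U f)))).topologicalClosure) :
    ‖p.1‖ = ‖p.2‖ := by
  have key : ∀ p ∈ StarAlgebra.adjoin ℂ (Set.range fun f => (ψ f, ψ (U f))),
      ∃ V : Submodule ℂ H, FiniteDimensional ℂ V ∧ ∀ v ∈ unitary 𝔄,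
        (∀ x ∈ V, v * ψ x = ψ (U x) * v) → v * p.1 = p.2 * v := by
    intro p hp
    induction hp using StarAlgebra.adjoin_induction with
    | mem x hx =>
      obtain ⟨f, rfl⟩ := hx
      exact ⟨ℂ ∙ f, inferInstance, fun v _ h => h f (Submodule.mem_span_singleton_self f)⟩
    | algebraMap r =>
      exact ⟨⊥, inferInstance, fun v _ _ => (Algebra.commutes r v).symm⟩
    | add x y _ _ hx hy =>
      obtain ⟨V, hV, h1⟩ := hx
      obtain ⟨V', hV', h2⟩ := hy
      refine ⟨V ⊔ V', inferInstance, fun v hv h => ?_⟩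
      rw [Prod.fst_add, Prod.snd_add, mul_add, add_mul,
        h1 v hv fun x hx => h x (Submodule.mem_sup_left hx),
        h2 v hv fun x hx => h x (Submodule.mem_sup_right hx)]
    | mul x y _ _ hx hy =>
      obtain ⟨V, hV, h1⟩ := hx
      obtain ⟨V', hV', h2⟩ := hy
      refine ⟨V ⊔ V', inferInstance, fun v hv h => ?_⟩
      rw [Prod.fst_mul, Prod.snd_mul, ← mul_assoc, h1 v hv fun x hx => h x (Submodule.mem_sup_left hx),
        mul_assoc, h2 v hv fun x hx => h x (Submodule.mem_sup_right hx), mul_assoc]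
    | star x _ hx =>
      obtain ⟨V, hV, h1⟩ := hx
      refine ⟨V, hV, fun v hv h => ?_⟩
      have h2 := congrArg star (h1 v hv h)
      rw [star_mul, star_mul] at h2
      have h3 : v * (star x.1 * star v) * v = v * (star v * star x.2) * v := by rw [h2]
      have h4 := Unitary.star_mul_self_of_mem hv
      have h5 := Unitary.mul_star_self_of_mem hv
      rw [mul_assoc, mul_assoc, h4, mul_one, ← mul_assoc v, h5, one_mul] at h3
      exact h3
  have hclosed : IsClosed {p : 𝔄 × 𝔄 | ‖p.1‖ = ‖p.2‖} :=
    isClosed_eq (by fun_prop) (by fun_prop)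
  have hsub : ((StarAlgebra.adjoin ℂ (Set.range fun f => (ψ f, ψ (U f)))) : Set (𝔄 × 𝔄)) ⊆
      {p : 𝔄 × 𝔄 | ‖p.1‖ = ‖p.2‖} := by
    intro p hp
    obtain ⟨V, hV, h⟩ := key p hp
    obtain ⟨v, hv, hvU⟩ := exists_unitary_implementing_on hψ V hU
    have h1 := h v hv hvU
    rw [Set.mem_ofPred_eq, ← CStarRing.norm_mem_unitary_mul p.1 hv, h1, CStarRing.norm_mul_mem_unitary p.2 hv]
  exact closure_minimal hsub hclosed hp

/-- Both coordinate projections are isometric on the closed graph, so their images are closed; they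
contain the generators, for the second projection because U is onto, and so are the whole algebra.
-/
theorem exists_mem_adjoin_pairs (hψ : IsCARAlgebra ψ) {U : H →L[ℂ] H}
    (hU : ∀ x y, ⟪U x, U y⟫_ℂ = ⟪x, y⟫_ℂ) (hsurj : Function.Surjective U) (a : 𝔄) :
    (∃ b, (a, b) ∈ (StarAlgebra.adjoin ℂ (Set.range fun f => (ψ f, ψ (U f)))).topologicalClosure) ∧
    (∃ b, (b, a) ∈ (StarAlgebra.adjoin ℂ (Set.range fun f => (ψ f, ψ (U f)))).topologicalClosure) := by
  set G := (StarAlgebra.adjoin ℂ (Set.range fun f => (ψ f, ψ (U f)))).topologicalClosure with hG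
  have hmem : ∀ f, (ψ f, ψ (U f)) ∈ G := fun f =>
    StarSubalgebra.le_topologicalClosure _ (StarAlgebra.subset_adjoin ℂ _ ⟨f, rfl⟩)
  have hnorm : ∀ p ∈ G, ‖p.1‖ = ‖p.2‖ := fun p hp => norm_eq_of_mem_adjoin_pairs hψ hU hp
  have hcomplete : CompleteSpace G :=
    (StarSubalgebra.isClosed_topologicalClosure _).completeSpace_coe
  have main : ∀ π : 𝔄 × 𝔄 →⋆ₐ[ℂ] 𝔄, Continuous π → (∀ p ∈ G, ‖π p‖ = ‖p‖) →
      (∀ f, ∃ p ∈ G, π p = ψ f) → ∃ p ∈ G, π p = a := by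
    intro π hπ hπn hπf
    have hiso : Isometry (fun p : G => π p) := by
      refine Isometry.of_dist_eq fun p q => ?_
      rw [dist_eq_norm, ← map_sub]
      have h1 : (p : 𝔄 × 𝔄) - q ∈ G := sub_mem p.2 q.2
      rw [hπn _ h1, Subtype.dist_eq, dist_eq_norm]
    have hcl : IsClosed ((G.map π : StarSubalgebra ℂ 𝔄) : Set 𝔄) := by
      have h1 : ((G.map π : StarSubalgebra ℂ 𝔄) : Set 𝔄) = Set.range (fun p : G => π p) := by
        ext x
        simp
      rw [h1]
      exact hiso.isClosedEmbedding.isClosed_range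
    have hle : (StarAlgebra.adjoin ℂ (Set.range ψ)).topologicalClosure ≤ G.map π := by
      refine StarSubalgebra.topologicalClosure_minimal (StarAlgebra.adjoin_le ?_) hcl
      rintro _ ⟨f, rfl⟩
      exact StarSubalgebra.mem_map.mpr (hπf f)
    rw [hψ.generates] at hle
    exact StarSubalgebra.mem_map.mp (hle (StarSubalgebra.mem_top))
  constructor
  · obtain ⟨p, hp, hpa⟩ := main (StarAlgHom.fst ℂ 𝔄 𝔄) continuous_fst (fun p hp => by
      rw [Prod.norm_def, ← hnorm p hp, max_self]; rfl) (fun f => ⟨_, hmem f, rfl⟩)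
    exact ⟨p.2, by rw [← hpa]; exact hp⟩
  · obtain ⟨p, hp, hpa⟩ := main (StarAlgHom.snd ℂ 𝔄 𝔄) continuous_snd (fun p hp => by
      rw [Prod.norm_def, hnorm p hp, max_self]; rfl) (fun f => by
        obtain ⟨g, rfl⟩ := hsurj f
        exact ⟨_, hmem g, rfl⟩)
    exact ⟨p.1, by rw [← hpa]; exact hp⟩

theorem exists_bogoliubov (hψ : IsCARAlgebra ψ) {U : H →L[ℂ] H}
    (hU : ∀ x y, ⟪U x, U y⟫_ℂ = ⟪x, y⟫_ℂ) (hsurj : Function.Surjective U) :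
    ∃ α : 𝔄 ≃⋆ₐ[ℂ] 𝔄, ∀ f, α (ψ f) = ψ (U f) := by
  set G := (StarAlgebra.adjoin ℂ (Set.range fun f => (ψ f, ψ (U f)))).topologicalClosure with hG
  have hnorm : ∀ p ∈ G, ‖p.1‖ = ‖p.2‖ := fun p hp => norm_eq_of_mem_adjoin_pairs hψ hU hp
  choose α hα using fun a => (exists_mem_adjoin_pairs hψ hU hsurj a).1
  choose α' hα' using fun a => (exists_mem_adjoin_pairs hψ hU hsurj a).2
  have huniq : ∀ {a b b' : 𝔄}, (a, b) ∈ G → (a, b') ∈ G → b = b' := fun {a b b'} h h' => by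
    have h1 := hnorm _ (sub_mem h h')
    simp only [Prod.mk_sub_mk, sub_self, norm_zero] at h1
    exact sub_eq_zero.mp (norm_eq_zero.mp h1.symm)
  have huniq' : ∀ {a a' b : 𝔄}, (a, b) ∈ G → (a', b) ∈ G → a = a' := fun {a a' b} h h' => by
    have h1 := hnorm _ (sub_mem h h')
    simp only [Prod.mk_sub_mk, sub_self, norm_zero] at h1
    exact sub_eq_zero.mp (norm_eq_zero.mp h1)
  refine ⟨{
    toFun := α
    invFun := α'
    left_inv := fun a => huniq' (hα' (α a)) (hα a)
    right_inv := fun a => huniq (hα (α' a)) (hα' a)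
    map_mul' := fun a b => huniq (hα (a * b)) (mul_mem (hα a) (hα b))
    map_add' := fun a b => huniq (hα (a + b)) (add_mem (hα a) (hα b))
    map_star' := fun a => huniq (hα (star a)) (star_mem (hα a))
    map_smul' := fun c a => huniq (hα (c • a)) (SMulMemClass.smul_mem c (hα a)) }, fun f => ?_⟩
  exact huniq (hα (ψ f)) (StarSubalgebra.le_topologicalClosure _
    (StarAlgebra.subset_adjoin ℂ _ ⟨f, rfl⟩))

theorem bogoliubov_apply (hψ : IsCARAlgebra ψ) {U : H →L[ℂ] H}
    (hU : ∀ x y, ⟪U x, U y⟫_ℂ = ⟪x, y⟫_ℂ) (hsurj : Function.Surjective U) (f : H) :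
    bogoliubov ψ U (ψ f) = ψ (U f) := by
  have h := exists_bogoliubov hψ hU hsurj
  rw [bogoliubov, dif_pos h]
  exact h.choose_spec f

theorem bddCont_unitary (t : ℝ) : BddCont (fun x : ℝ => Complex.exp (Complex.I * t * x)) :=
  ⟨by fun_prop, 1, fun x => by rw [Complex.norm_exp]; simp⟩

theorem unitaryGroup_mul_neg {D : H →ₗ.[ℂ] H} (hD : IsSelfAdjoint D) (t : ℝ) :
    unitaryGroup D t * unitaryGroup D (-t) = 1 := by
  rw [unitaryGroup, unitaryGroup, ← opFun_mul hD (bddCont_unitary t) (bddCont_unitary (-t)), ← opFun_one hD]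
  congr 1
  ext x
  rw [← Complex.exp_add]
  simp

theorem unitaryGroup_inner {D : H →ₗ.[ℂ] H} (hD : IsSelfAdjoint D) (t : ℝ) (x y : H) :
    ⟪unitaryGroup D t x, unitaryGroup D t y⟫_ℂ = ⟪x, y⟫_ℂ := by
  have h1 : opFun D (fun x : ℝ => star (Complex.exp (Complex.I * t * x))) = unitaryGroup D (-t) := by
    rw [unitaryGroup]
    congr 1
    ext x
    rw [RCLike.star_def, ← Complex.exp_conj]
    simp
  rw [unitaryGroup, opFun_inner hD (bddCont_unitary t), h1]
  have := congrArg (fun A : H →L[ℂ] H => A y) (unitaryGroup_mul_neg hD (-t))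
  rw [neg_neg] at this
  change ⟪x, (unitaryGroup D (-t) * unitaryGroup D t) y⟫_ℂ = _
  simp only [this]
  rfl

theorem evolution_apply (hψ : IsCARAlgebra ψ) {D : H →ₗ.[ℂ] H} (hD : IsSelfAdjoint D) (t : ℝ) (f : H) :
    evolution ψ D t (ψ f) = ψ (unitaryGroup D t f) :=
  bogoliubov_apply hψ (unitaryGroup_inner hD t)
    (fun y => ⟨unitaryGroup D (-t) y, congrArg (fun A : H →L[ℂ] H => A y) (unitaryGroup_mul_neg hD t)⟩) f

end Bogoliubov

/-! ### States on a unital C*-algebra. -/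

section States

variable {𝔄 : Type*} [CStarAlgebra 𝔄] {ω : 𝔄 →L[ℂ] ℂ}

theorem IsState.im_eq_zero (hω : IsState ω) (a : 𝔄) : (ω (star a * a)).im = 0 :=
  (Complex.nonneg_iff.mp (hω.2 a)).2.symm

/-- Reality of ω on squares, applied to a + 1 and a + i, compares the imaginary and the real parts
of ω(a) and ω(a*). -/
theorem IsState.map_star (hω : IsState ω) (a : 𝔄) : ω (star a) = star (ω a) := by
  have h := hω.im_eq_zero a
  have h1 := hω.im_eq_zero (a + 1)
  have h2 := hω.im_eq_zero (a + algebraMap ℂ 𝔄 Complex.I)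
  rw [star_add, star_one, mul_add, add_mul, add_mul, mul_one, mul_one, one_mul, map_add, map_add,
    map_add, hω.1] at h1
  rw [Algebra.algebraMap_eq_smul_one, star_add, star_smul, star_one, mul_add, add_mul, add_mul,
    smul_mul_smul_comm, mul_smul_comm, smul_mul_assoc, mul_one, one_mul, mul_one, map_add, map_add, map_add,
    map_smul, map_smul, map_smul, hω.1] at h2
  simp at h1 h2
  rw [h] at h1 h2
  apply Complex.ext
  · simp only [RCLike.star_def, Complex.conj_re]
    linarith
  · simp only [RCLike.star_def, Complex.conj_im]
    linarith

/-- Nonnegative variance gives |ω(a)|² ≤ ω(a*a), and ‖a‖² − a*a is itself of the form c*c. -/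
theorem IsState.norm_apply_le (hω : IsState ω) (a : 𝔄) : ‖ω a‖ ≤ ‖a‖ := by
  let _ : PartialOrder 𝔄 := CStarAlgebra.spectralOrder 𝔄
  let _ : StarOrderedRing 𝔄 := CStarAlgebra.spectralOrderedRing 𝔄
  have h1 := hω.2 (a - algebraMap ℂ 𝔄 (ω a))
  have e1 : ω (star (a - algebraMap ℂ 𝔄 (ω a)) * (a - algebraMap ℂ 𝔄 (ω a))) =
      ω (star a * a) - ((‖ω a‖ ^ 2 : ℝ) : ℂ) := by
    rw [Algebra.algebraMap_eq_smul_one, star_sub, star_smul, star_one, mul_sub, sub_mul, sub_mul,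
      smul_mul_smul_comm, mul_smul_comm, smul_mul_assoc, mul_one, one_mul, mul_one, map_sub, map_sub, map_sub,
      map_smul, map_smul, map_smul, hω.1, hω.map_star]
    simp only [smul_eq_mul, RCLike.star_def, Complex.mul_conj', mul_comm]
    push_cast
    ring
  have h2 : 0 ≤ algebraMap ℝ 𝔄 (‖a‖ ^ 2) - star a * a :=
    sub_nonneg.mpr CStarAlgebra.star_mul_le_algebraMap_norm_sq
  obtain ⟨c, hc⟩ := CStarAlgebra.nonneg_iff_eq_star_mul_self.mp h2
  have h3 := hω.2 c
  rw [← hc, map_sub] at h3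
  have e3 : ω (algebraMap ℝ 𝔄 (‖a‖ ^ 2)) = ((‖a‖ ^ 2 : ℝ) : ℂ) := by
    rw [IsScalarTower.algebraMap_apply ℝ ℂ 𝔄, Algebra.algebraMap_eq_smul_one, map_smul, hω.1]
    simp
  rw [e1] at h1
  rw [e3] at h3
  have h5 := (Complex.nonneg_iff.mp (add_nonneg h1 h3)).1
  simp only [Complex.add_re, Complex.sub_re, Complex.ofReal_re] at h5
  exact (sq_le_sq₀ (norm_nonneg _) (norm_nonneg _)).mp (by linarith)

/-- A functional of norm one with value 1 at the unit is a state; Hahn–Banach provides one. It is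
real on self-adjoint elements by a shift in the imaginary direction, and positive because ‖a*a‖ −
a*a has norm at most ‖a*a‖. -/
theorem exists_state (𝔄 : Type*) [CStarAlgebra 𝔄] [Nontrivial 𝔄] : ∃ ω : 𝔄 →L[ℂ] ℂ, IsState ω := by
  let _ : PartialOrder 𝔄 := CStarAlgebra.spectralOrder 𝔄
  let _ : StarOrderedRing 𝔄 := CStarAlgebra.spectralOrderedRing 𝔄
  obtain ⟨ω, hω, hω1⟩ := exists_dual_vector ℂ (1 : 𝔄) (by simp)
  have h1 : ω 1 = 1 := by simpa using hω1
  have hle : ∀ a, ‖ω a‖ ≤ ‖a‖ := fun a => by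
    have := ω.le_opNorm a
    rwa [hω, one_mul] at this
  have him : ∀ h : 𝔄, star h = h → (ω h).im = 0 := by
    intro h hh
    -- Comparing |ω(h) + it|² with ‖h‖² + t² cancels t² and leaves a bound linear in t, which fails
    -- for suitable t unless Im ω(h) = 0.
    have hb : ∀ t : ℝ, (ω h).im ^ 2 + 2 * (ω h).im * t ≤ ‖h‖ ^ 2 := by
      intro t
      have h2 : star (h + (Complex.I * t) • (1 : 𝔄)) * (h + (Complex.I * t) • (1 : 𝔄)) =
          h * h + ((t : ℂ) ^ 2) • (1 : 𝔄) := by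
        rw [star_add, star_smul, star_one, hh, mul_add, add_mul, add_mul, smul_mul_smul_comm]
        have : star (Complex.I * t) * (Complex.I * t) = (t : ℂ) ^ 2 := by
          simp only [star_mul', RCLike.star_def, Complex.conj_I, Complex.conj_ofReal]
          linear_combination -(t : ℂ) ^ 2 * Complex.I_mul_I
        rw [this]
        simp
      have h3 : ‖h + (Complex.I * t) • (1 : 𝔄)‖ ^ 2 ≤ ‖h‖ ^ 2 + t ^ 2 := by
        rw [pow_two, ← CStarRing.norm_star_mul_self, h2]
        refine (norm_add_le _ _).trans (add_le_add ?_ ?_)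
        · rw [pow_two]; exact norm_mul_le _ _
        · rw [norm_smul, norm_one, mul_one]
          simp
      have h4 := hle (h + (Complex.I * t) • (1 : 𝔄))
      rw [map_add, map_smul, h1] at h4
      have h5 : ‖ω h + (Complex.I * t) • (1 : ℂ)‖ ^ 2 = (ω h).re ^ 2 + ((ω h).im + t) ^ 2 := by
        rw [← Complex.normSq_eq_norm_sq, Complex.normSq_apply]
        simp
        ring
      have h6 := pow_le_pow_left₀ (norm_nonneg _) h4 2
      nlinarith [sq_nonneg (ω h).re]
    by_contra hne
    have h7 := hb ((‖h‖ ^ 2 + 1) / (2 * (ω h).im))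
    have h8 : 2 * (ω h).im * ((‖h‖ ^ 2 + 1) / (2 * (ω h).im)) = ‖h‖ ^ 2 + 1 := by field_simp
    nlinarith [sq_nonneg (ω h).im]
  refine ⟨ω, h1, fun a => ?_⟩
  have hsa : star (star a * a) = star a * a := by simp
  refine Complex.nonneg_iff.mpr ⟨?_, (him _ hsa).symm⟩
  have h2 : star a * a ≤ algebraMap ℝ 𝔄 ‖star a * a‖ := by
    have := CStarAlgebra.star_mul_le_algebraMap_norm_sq (a := a)
    rwa [CStarRing.norm_star_mul_self, ← pow_two]
  have h3 : ‖algebraMap ℝ 𝔄 ‖star a * a‖ - star a * a‖ ≤ ‖star a * a‖ := by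
    have := CStarAlgebra.norm_le_norm_of_nonneg_of_le (sub_nonneg.mpr h2)
      (sub_le_self _ (star_mul_self_nonneg a))
    rwa [norm_algebraMap', norm_norm] at this
  have h4 := (Complex.abs_re_le_norm _).trans ((hle _).trans h3)
  have e3 : ω (algebraMap ℝ 𝔄 ‖star a * a‖) = (‖star a * a‖ : ℂ) := by
    rw [IsScalarTower.algebraMap_apply ℝ ℂ 𝔄, Algebra.algebraMap_eq_smul_one, map_smul, h1]
    simp
  rw [map_sub, e3, Complex.sub_re, Complex.ofReal_re] at h4
  linarith [(abs_le.mp h4).2]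

end States

/-! ### Existence of states with the bounded KMS property. -/

section AlgebraicKMS

variable {H : Type*} [NormedAddCommGroup H] [InnerProductSpace ℂ H] [CompleteSpace H]
variable {𝔄 : Type*} [CStarAlgebra 𝔄] {ψ : H →ₗ⋆[ℂ] 𝔄} {S : H →L[ℂ] H} {ω : 𝔄 →L[ℂ] ℂ}

/-- The KMS condition in bounded form: with `S = (1 + e^{-βD})⁻¹` it says that
`ω(ψ(g)* a) = ω(a ψ(e^{-βD} g)*)`. -/
def IsAlgKMS (ψ : H →ₗ⋆[ℂ] 𝔄) (S : H →L[ℂ] H) (ω : 𝔄 →L[ℂ] ℂ) : Prop :=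
  ∀ (h : H) (a : 𝔄), ω (star (ψ (S h)) * a) = ω (a * star (ψ (h - S h)))

theorem IsAlgKMS.left (hω : IsState ω) (hk : IsAlgKMS ψ S ω) (h : H) (a : 𝔄) :
    ω (ψ (h - S h) * a) = ω (a * ψ (S h)) := by
  have h1 := congrArg star (hk h (star a))
  rw [← hω.map_star, ← hω.map_star, star_mul, star_mul, star_star, star_star, star_star] at h1
  exact h1.symm

/-- The channel that resets the mode `e` to the occupation probability `s`. -/
def resetMode (c : 𝔄) (s : ℝ) : 𝔄 →L[ℂ] 𝔄 :=
  (s : ℂ) • (ContinuousLinearMap.mulLeftRight ℂ 𝔄 (c * star c) (c * star c) +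
    ContinuousLinearMap.mulLeftRight ℂ 𝔄 (star c) c) +
  ((1 - s : ℝ) : ℂ) • (ContinuousLinearMap.mulLeftRight ℂ 𝔄 (star c * c) (star c * c) +
    ContinuousLinearMap.mulLeftRight ℂ 𝔄 c (star c))

theorem resetMode_apply (c : 𝔄) (s : ℝ) (x : 𝔄) : resetMode c s x =
    (s : ℂ) • ((c * star c) * x * (c * star c) + star c * x * c) +
    ((1 - s : ℝ) : ℂ) • ((star c * c) * x * (star c * c) + c * x * star c) := rfl

/-- The map is a positive combination of maps x ↦ d x d*, and it is unital because c c* and c* c are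
complementary projections. -/
theorem resetMode_state {c : 𝔄} {s : ℝ} (hs : s ∈ Set.Icc 0 1) (hc : c * c = 0)
    (hcc : c * star c + star c * c = 1) (hω : IsState ω) : IsState (ω.comp (resetMode c s)) := by
  have h1 : (c * star c) * (c * star c) = c * star c := by
    have : c * star c = 1 - star c * c := eq_sub_of_add_eq hcc
    calc (c * star c) * (c * star c) = (c * star c) - c * (c * star c) * star c * 0
          - (star c * (c * c)) * star c := by
          conv_lhs => rw [this, sub_mul, one_mul, ← this]
          noncomm_ring
      _ = _ := by rw [hc]; simp
  have h2 : (star c * c) * (star c * c) = star c * c := by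
    have : star c * c = 1 - c * star c := eq_sub_of_add_eq' hcc
    calc (star c * c) * (star c * c) = (star c * c) - c * star c * (star c * c) := by
          conv_lhs => rw [this, sub_mul, one_mul, ← this]
      _ = star c * c - c * (star (c * c)) * c := by rw [star_mul]; noncomm_ring
      _ = _ := by rw [hc]; simp
  refine ⟨?_, fun a => ?_⟩
  · rw [ContinuousLinearMap.comp_apply, resetMode_apply]
    simp only [mul_one]
    rw [h1, h2, hcc, add_comm (star c * c), hcc, ← add_smul]
    simp [hω.1]
  · rw [ContinuousLinearMap.comp_apply, resetMode_apply]
    have e1 : (c * star c) * (star a * a) * (c * star c) =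
        star (a * (c * star c)) * (a * (c * star c)) := by simp [mul_assoc]
    have e2 : star c * (star a * a) * c = star (a * c) * (a * c) := by simp [mul_assoc]
    have e3 : (star c * c) * (star a * a) * (star c * c) =
        star (a * (star c * c)) * (a * (star c * c)) := by simp [mul_assoc]
    have e4 : c * (star a * a) * star c = star (a * star c) * (a * star c) := by simp [mul_assoc]
    rw [e1, e2, e3, e4, map_add, map_smul, map_smul, map_add, map_add, smul_eq_mul, smul_eq_mul]
    have hs0 : (0 : ℂ) ≤ (s : ℂ) := by exact_mod_cast hs.1
    have hs1 : (0 : ℂ) ≤ ((1 - s : ℝ) : ℂ) := by exact_mod_cast sub_nonneg.mpr hs.2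
    exact add_nonneg (mul_nonneg hs0 (add_nonneg (hω.2 _) (hω.2 _)))
      (mul_nonneg hs1 (add_nonneg (hω.2 _) (hω.2 _)))

/-- In c*x only the summand with weight 1 − s survives, in xc* only the one with weight s, and both
leave the same element; each side is s(1 − s) times it. -/
theorem resetMode_kms {c : 𝔄} (s : ℝ) (hc : c * c = 0) (hcc : c * star c + star c * c = 1) (x : 𝔄) :
    (s : ℂ) • resetMode c s (star c * x) = ((1 - s : ℝ) : ℂ) • resetMode c s (x * star c) := by
  have hs : star c * star c = 0 := by rw [← star_mul, hc, star_zero]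
  have h1 : star c * c * star c = star c := by
    have : star c * c = 1 - c * star c := eq_sub_of_add_eq' hcc
    rw [this, sub_mul, one_mul, mul_assoc, hs, mul_zero, sub_zero]
  have e1 : resetMode c s (star c * x) =
      ((1 - s : ℝ) : ℂ) • (star c * x * (star c * c) + c * star c * x * star c) := by
    rw [resetMode_apply]
    have a1 : c * star c * (star c * x) * (c * star c) = 0 := by
      rw [show c * star c * (star c * x) * (c * star c) = c * (star c * star c) * x * (c * star c) by
        noncomm_ring, hs]; simp
    have a2 : star c * (star c * x) * c = 0 := by
      rw [← mul_assoc, hs]; simp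
    have a3 : star c * c * (star c * x) * (star c * c) = star c * x * (star c * c) := by
      rw [← mul_assoc (star c * c), h1]
    rw [a1, a2, a3, ← mul_assoc c]
    simp
  have e2 : resetMode c s (x * star c) =
      (s : ℂ) • (star c * x * (star c * c) + c * star c * x * star c) := by
    rw [resetMode_apply]
    have a1 : c * star c * (x * star c) * (c * star c) = c * star c * x * star c := by
      rw [show c * star c * (x * star c) * (c * star c) = c * star c * x * (star c * c * star c) by
        noncomm_ring, h1]
    have a2 : star c * (x * star c) * c = star c * x * (star c * c) := by noncomm_ring
    have a3 : star c * c * (x * star c) * (star c * c) = 0 := by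
      rw [show star c * c * (x * star c) * (star c * c) = star c * c * x * (star c * star c) * c by
        noncomm_ring, hs]; simp
    have a4 : c * (x * star c) * star c = 0 := by
      rw [show c * (x * star c) * star c = c * x * (star c * star c) by noncomm_ring, hs]; simp
    rw [a1, a2, a3, a4]
    simp [add_comm]
  rw [e1, e2, smul_comm]

/-- An element d anticommuting with c and c* is pulled out of every summand. The signs agree for d
on the left and on the right, so the same y serves both; hence resetting one mode preserves the KMS
relation of the orthogonal ones. -/
theorem resetMode_anticomm {c d : 𝔄} (s : ℝ) (h1 : d * c = -(c * d)) (h2 : d * star c = -(star c * d))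
    (x : 𝔄) : ∃ y, resetMode c s (d * x) = d * y ∧ resetMode c s (x * d) = y * d := by
  have h3 : c * star c * d = d * (c * star c) := by
    rw [mul_assoc, ← neg_eq_iff_eq_neg.mpr h2, mul_neg, ← mul_assoc, ← neg_eq_iff_eq_neg.mpr h1]
    noncomm_ring
  have h4 : star c * c * d = d * (star c * c) := by
    rw [mul_assoc, ← neg_eq_iff_eq_neg.mpr h1, mul_neg, ← mul_assoc, ← neg_eq_iff_eq_neg.mpr h2]
    noncomm_ring
  have h1' : c * d = -(d * c) := by rw [h1, neg_neg]
  have h2' : star c * d = -(d * star c) := by rw [h2, neg_neg]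
  refine ⟨(s : ℂ) • ((c * star c) * x * (c * star c) - star c * x * c) +
    ((1 - s : ℝ) : ℂ) • ((star c * c) * x * (star c * c) - c * x * star c), ?_, ?_⟩
  · rw [resetMode_apply, mul_add, mul_smul_comm, mul_smul_comm, mul_sub, mul_sub]
    have a1 : c * star c * (d * x) * (c * star c) = d * (c * star c * x * (c * star c)) := by
      rw [← mul_assoc (c * star c), h3]; noncomm_ring
    have a2 : star c * (d * x) * c = -(d * (star c * x * c)) := by
      rw [← mul_assoc (star c), h2']; noncomm_ring
    have a3 : star c * c * (d * x) * (star c * c) = d * (star c * c * x * (star c * c)) := by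
      rw [← mul_assoc (star c * c), h4]; noncomm_ring
    have a4 : c * (d * x) * star c = -(d * (c * x * star c)) := by
      rw [← mul_assoc c, h1']; noncomm_ring
    rw [a1, a2, a3, a4, ← sub_eq_add_neg, ← sub_eq_add_neg]
  · rw [resetMode_apply, add_mul, smul_mul_assoc, smul_mul_assoc, sub_mul, sub_mul]
    have a1 : c * star c * (x * d) * (c * star c) = c * star c * x * (c * star c) * d := by
      rw [mul_assoc _ (c * star c) d, h3]; noncomm_ring
    have a2 : star c * (x * d) * c = -(star c * x * c * d) := by
      rw [mul_assoc _ c d, h1']; noncomm_ring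
    have a3 : star c * c * (x * d) * (star c * c) = star c * c * x * (star c * c) * d := by
      rw [mul_assoc _ (star c * c) d, h4]; noncomm_ring
    have a4 : c * (x * d) * star c = -(c * x * star c * d) := by
      rw [mul_assoc _ (star c) d, h2']; noncomm_ring
    rw [a1, a2, a3, a4, ← sub_eq_add_neg, ← sub_eq_add_neg]

theorem exists_state_modes (hψ : IsCARAlgebra ψ) (n : ℕ) {e : Fin n → H} (he : Orthonormal ℂ e)
    {s : Fin n → ℝ} (hs : ∀ i, s i ∈ Set.Icc 0 1) :
    ∃ ω : 𝔄 →L[ℂ] ℂ, IsState ω ∧ ∀ i a,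
      (s i : ℂ) * ω (star (ψ (e i)) * a) = ((1 - s i : ℝ) : ℂ) * ω (a * star (ψ (e i))) := by
  induction n with
  | zero =>
    have := hψ.nontrivial
    obtain ⟨ω, hω⟩ := exists_state 𝔄
    exact ⟨ω, hω, fun i => i.elim0⟩
  | succ n ih =>
    obtain ⟨ω, hω, hk⟩ := ih (he.comp _ (Fin.castSucc_injective n)) (s := fun i => s i.castSucc)
      (fun i => hs _)
    have hc := hψ.mul_self (e (Fin.last n))
    have hcc : ψ (e (Fin.last n)) * star (ψ (e (Fin.last n))) +
        star (ψ (e (Fin.last n))) * ψ (e (Fin.last n)) = 1 := by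
      rw [hψ.anticomm_star, inner_self_eq_norm_sq_to_K, he.1]
      simp
    refine ⟨ω.comp (resetMode (ψ (e (Fin.last n))) (s (Fin.last n))),
      resetMode_state (hs _) hc hcc hω, fun i a => ?_⟩
    refine Fin.lastCases ?_ (fun j => ?_) i
    · have := congrArg ω (resetMode_kms (s (Fin.last n)) hc hcc a)
      simp only [map_smul, smul_eq_mul] at this
      exact this
    · obtain ⟨y, hy1, hy2⟩ := resetMode_anticomm (c := ψ (e (Fin.last n)))
        (d := star (ψ (e j.castSucc))) (s (Fin.last n)) (by
          rw [hψ.star_mul_eq, he.2 (Fin.castSucc_lt_last j).ne', zero_smul, zero_sub])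
        (hψ.anticomm_star_star _ _) a
      rw [ContinuousLinearMap.comp_apply, ContinuousLinearMap.comp_apply, hy1, hy2]
      exact hk j y

/-- The compression of S to V is diagonalized and its eigenvalues, which lie in [0, 1], are used as
occupations. On vectors h with h and Sh in V the compression acts as S. -/
theorem exists_state_subspace (hψ : IsCARAlgebra ψ) (hS : IsSelfAdjoint S)
    (hS0 : ∀ x, 0 ≤ (⟪x, S x⟫_ℂ).re) (hS1 : ∀ x, (⟪x, S x⟫_ℂ).re ≤ ‖x‖ ^ 2) (V : Submodule ℂ H)
    [FiniteDimensional ℂ V] :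
    ∃ ω : 𝔄 →L[ℂ] ℂ, IsState ω ∧ ∀ h ∈ V, S h ∈ V → ∀ a,
      ω (star (ψ (S h)) * a) = ω (a * star (ψ (h - S h))) := by
  have hsymm : ∀ x y : H, ⟪S x, y⟫_ℂ = ⟪x, S y⟫_ℂ := fun x y => by
    rw [← ContinuousLinearMap.adjoint_inner_right, hS.adjoint_eq]
  let A : V →ₗ[ℂ] V := (V.orthogonalProjectionOnto : H →ₗ[ℂ] V) ∘ₗ (S : H →ₗ[ℂ] H) ∘ₗ V.subtype
  have hAdef : ∀ x : V, A x = V.orthogonalProjectionOnto (S x) := fun _ => rfl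
  have hAinner : ∀ x y : V, ⟪x, A y⟫_ℂ = ⟪(x : H), S y⟫_ℂ := fun x y => by
    rw [hAdef, Submodule.inner_orthogonalProjectionOnto_eq_of_mem_left]
  have hA : A.IsSymmetric := fun x y => by
    rw [hAinner, ← inner_conj_symm, hAinner, inner_conj_symm, hsymm]
  set b := hA.eigenvectorBasis rfl
  set s := hA.eigenvalues rfl
  have hbs : ∀ i, A (b i) = (s i : ℂ) • b i := fun i => hA.apply_eigenvectorBasis rfl i
  have hsval : ∀ i, s i = (⟪(b i : H), S (b i)⟫_ℂ).re := fun i => by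
    rw [← hAinner, hbs, inner_smul_right, inner_self_eq_norm_sq_to_K, b.orthonormal.1 i]
    simp
  obtain ⟨ω, hω, hk⟩ := exists_state_modes hψ _ (e := fun i => (b i : H))
    (b.orthonormal.comp_linearIsometry V.subtypeₗᵢ) (s := s) (fun i => by
      have h1 : ‖(b i : H)‖ = 1 := b.orthonormal.1 i
      have h2 := hS1 (b i)
      rw [h1, one_pow] at h2
      rw [hsval]
      exact ⟨hS0 _, h2⟩)
  refine ⟨ω, hω, fun h hh hSh a => ?_⟩
  let L1 : V →ₗ[ℂ] ℂ := (ω : 𝔄 →ₗ[ℂ] ℂ) ∘ₗ LinearMap.mulRight ℂ a ∘ₗ (hψ.starL : H →ₗ[ℂ] 𝔄) ∘ₗ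
    V.subtype ∘ₗ A
  let L2 : V →ₗ[ℂ] ℂ := (ω : 𝔄 →ₗ[ℂ] ℂ) ∘ₗ LinearMap.mulLeft ℂ a ∘ₗ (hψ.starL : H →ₗ[ℂ] 𝔄) ∘ₗ
    V.subtype ∘ₗ (LinearMap.id - A)
  have hL : L1 = L2 := by
    refine b.toBasis.ext fun i => ?_
    have e1 : L1 (b i) = ω (star (ψ (A (b i) : H)) * a) := rfl
    have e2 : L2 (b i) = ω (a * star (ψ ((b i - A (b i) : V) : H))) := rfl
    have h1 := hk i a
    rw [OrthonormalBasis.coe_toBasis, e1, e2, hbs]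
    have e3 : (b i - (s i : ℂ) • b i : V) = ((1 - s i : ℝ) : ℂ) • b i := by
      push_cast
      module
    rw [e3, Submodule.coe_smul, Submodule.coe_smul, map_smulₛₗ, map_smulₛₗ, star_smul, star_smul]
    simp only [RCLike.star_def, Complex.conj_ofReal, smul_mul_assoc, mul_smul_comm, map_smul,
      smul_eq_mul]
    exact h1
  have hAh : (A ⟨h, hh⟩ : H) = S h := by
    rw [hAdef]
    exact congrArg Subtype.val (Submodule.orthogonalProjectionOnto_mem_subspace_eq_self (K := V) ⟨S h, hSh⟩)
  have h1 := congrArg (fun L : V →ₗ[ℂ] ℂ => L ⟨h, hh⟩) hL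
  have e1 : L1 ⟨h, hh⟩ = ω (star (ψ (A ⟨h, hh⟩ : H)) * a) := rfl
  have e2 : L2 ⟨h, hh⟩ = ω (a * star (ψ (h - (A ⟨h, hh⟩ : H)))) := rfl
  simp only [e1, e2, hAh] at h1
  exact h1

/-- Existence of a state with the KMS property, as a weak-* limit over the finite-dimensional
subspaces. -/
theorem exists_algKMS (hψ : IsCARAlgebra ψ) (hS : IsSelfAdjoint S)
    (hS0 : ∀ x, 0 ≤ (⟪x, S x⟫_ℂ).re) (hS1 : ∀ x, (⟪x, S x⟫_ℂ).re ≤ ‖x‖ ^ 2) :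
    ∃ ω : 𝔄 →L[ℂ] ℂ, IsState ω ∧ IsAlgKMS ψ S ω := by
  classical
  choose w hw hk using fun F : Finset H =>
    exists_state_subspace hψ hS hS0 hS1 (Submodule.span ℂ (F : Set H))
  let U : Ultrafilter (Finset H) := Ultrafilter.of atTop
  have hU : (U : Filter (Finset H)) ≤ atTop := Ultrafilter.of_le atTop
  let W : Finset H → WeakDual ℂ 𝔄 := fun F => StrongDual.toWeakDual (w F)
  have hmem : ∀ F, W F ∈ WeakDual.toStrongDual ⁻¹' Metric.closedBall (0 : StrongDual ℂ 𝔄) 1 := by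
    intro F
    rw [Set.mem_preimage, mem_closedBall_zero_iff]
    exact ContinuousLinearMap.opNorm_le_bound _ zero_le_one fun a => by
      rw [one_mul]; exact (hw F).norm_apply_le a
  obtain ⟨Ω, -, hΩ⟩ := (WeakDual.isCompact_closedBall (0 : StrongDual ℂ 𝔄) 1).ultrafilter_le_nhds
    (U.map W) (by
      rw [le_principal_iff]
      exact Filter.mem_map.mpr (Eventually.of_forall hmem))
  let ω : 𝔄 →L[ℂ] ℂ := WeakDual.toStrongDual Ω
  have hlim : ∀ a, Tendsto (fun F => w F a) U (𝓝 (ω a)) := fun a =>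
    ((WeakDual.eval_continuous a).tendsto Ω).comp hΩ
  refine ⟨ω, ⟨?_, fun a => ?_⟩, fun h a => ?_⟩
  · refine tendsto_nhds_unique (hlim 1) ?_
    simp only [(hw _).1]
    exact tendsto_const_nhds
  · exact isClosed_Ici.mem_of_tendsto (hlim _) (Eventually.of_forall fun F => (hw F).2 a)
  · refine tendsto_nhds_unique (hlim _) ((hlim _).congr' ?_)
    -- The relation for a given h holds as soon as the finite set contains h and Sh, hence along the
    -- ultrafilter.
    have hev : ∀ᶠ F : Finset H in atTop, {h, S h} ⊆ F := eventually_ge_atTop _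
    filter_upwards [hU hev] with F hF
    refine (hk F h (Submodule.subset_span ?_) (Submodule.subset_span ?_) a).symm
    · exact hF (by simp)
    · exact hF (by simp)

end AlgebraicKMS

/-! ### Uniqueness of the state. -/

section Words

variable {H : Type*} [NormedAddCommGroup H] [InnerProductSpace ℂ H] [CompleteSpace H]
variable {𝔄 : Type*} [CStarAlgebra 𝔄] {ψ : H →ₗ⋆[ℂ] 𝔄} {S : H →L[ℂ] H} {ω δ : 𝔄 →L[ℂ] ℂ}

/-- The generators: `ψ(h)*` for `(true, h)` and `ψ(h)` for `(false, h)`. -/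
def letter (ψ : H →ₗ⋆[ℂ] 𝔄) (p : Bool × H) : 𝔄 := if p.1 then star (ψ p.2) else ψ p.2

/-- Products of generators. -/
def word (ψ : H →ₗ⋆[ℂ] 𝔄) (l : List (Bool × H)) : 𝔄 := (l.map (letter ψ)).prod

theorem word_nil : word ψ [] = 1 := rfl

theorem word_cons (p : Bool × H) (l : List (Bool × H)) : word ψ (p :: l) = letter ψ p * word ψ l := by
  simp [word]

theorem word_append (l l' : List (Bool × H)) : word ψ (l ++ l') = word ψ l * word ψ l' := by
  simp [word]

theorem word_singleton (p : Bool × H) : word ψ [p] = letter ψ p := by simp [word]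

theorem letter_add (b : Bool) (x y : H) : letter ψ (b, x + y) = letter ψ (b, x) + letter ψ (b, y) := by
  cases b <;> simp [letter]

theorem letter_sub (b : Bool) (x y : H) : letter ψ (b, x - y) = letter ψ (b, x) - letter ψ (b, y) := by
  cases b <;> simp [letter]

theorem IsCARAlgebra.continuous_letter (hψ : IsCARAlgebra ψ) (b : Bool) :
    Continuous fun x => letter ψ (b, x) := by
  cases b
  · simpa [letter] using hψ.continuous
  · simpa [letter] using hψ.continuous.star

theorem IsCARAlgebra.letter_mul (hψ : IsCARAlgebra ψ) (p q : Bool × H) :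
    ∃ c : ℂ, letter ψ p * letter ψ q = c • (1 : 𝔄) - letter ψ q * letter ψ p := by
  obtain ⟨_ | _, f⟩ := p <;> obtain ⟨_ | _, g⟩ := q
  · exact ⟨0, by simpa [letter] using hψ.anticomm f g⟩
  · exact ⟨⟪f, g⟫_ℂ, by simpa [letter] using eq_sub_of_add_eq (hψ.anticomm_star f g)⟩
  · exact ⟨⟪g, f⟫_ℂ, by simpa [letter] using hψ.star_mul_eq g f⟩
  · exact ⟨0, by simpa [letter] using hψ.anticomm_star_star f g⟩

/-- The span of the words with `k - 1` letters. -/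
def lowerWords (ψ : H →ₗ⋆[ℂ] 𝔄) (k : ℕ) : Submodule ℂ 𝔄 :=
  Submodule.span ℂ {x | ∃ l : List (Bool × H), l.length + 1 = k ∧ word ψ l = x}

theorem letter_mul_mem_lowerWords (p : Bool × H) {k : ℕ} {x : 𝔄} (hx : x ∈ lowerWords ψ k) :
    letter ψ p * x ∈ lowerWords ψ (k + 1) := by
  induction hx using Submodule.span_induction with
  | mem x hx =>
    obtain ⟨l, hl, rfl⟩ := hx
    exact Submodule.subset_span ⟨p :: l, by simp [← hl], word_cons p l⟩
  | zero => simp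
  | add x y _ _ h1 h2 => rw [mul_add]; exact add_mem h1 h2
  | smul c x _ h => rw [mul_smul_comm]; exact Submodule.smul_mem _ _ h

/-- Each exchange of neighbouring letters costs a sign and a scalar; the scalar removes two letters
from the product. -/
theorem letter_mul_word (hψ : IsCARAlgebra ψ) (p : Bool × H) (l : List (Bool × H)) :
    ∃ r ∈ lowerWords ψ l.length,
      letter ψ p * word ψ l = (-1 : ℂ) ^ l.length • (word ψ l * letter ψ p) + r := by
  induction l with
  | nil => exact ⟨0, zero_mem _, by simp [word_nil]⟩
  | cons q l ih =>
    obtain ⟨r, hr, h⟩ := ih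
    obtain ⟨c, hc⟩ := hψ.letter_mul p q
    refine ⟨c • word ψ l - letter ψ q * r, ?_, ?_⟩
    · exact sub_mem (Submodule.smul_mem _ _ (Submodule.subset_span ⟨l, by simp, rfl⟩))
        (letter_mul_mem_lowerWords q hr)
    · rw [word_cons, ← mul_assoc, hc, sub_mul, smul_mul_assoc, one_mul, mul_assoc, h, mul_add,
        mul_smul_comm, List.length_cons, pow_succ, mul_assoc]
      module

theorem map_lowerWords {k : ℕ} (h : ∀ l : List (Bool × H), l.length + 1 = k → δ (word ψ l) = 0) {r : 𝔄}
    (hr : r ∈ lowerWords ψ k) : δ r = 0 := by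
  induction hr using Submodule.span_induction with
  | mem x hx => obtain ⟨l, hl, rfl⟩ := hx; exact h l hl
  | zero => simp
  | add x y _ _ h1 h2 => rw [map_add, h1, h2, add_zero]
  | smul c x _ h => rw [map_smul, h, smul_zero]

/-- The linear form of the KMS condition, on both kinds of generators. -/
def LinKMS (ψ : H →ₗ⋆[ℂ] 𝔄) (S : H →L[ℂ] H) (δ : 𝔄 →L[ℂ] ℂ) : Prop :=
  ∀ (b : Bool) (h : H), ∃ h₁ h₂ : H, h₁ + h₂ = h ∧ (h₁ - h₂ = S h - (h - S h) ∨
    h₁ - h₂ = -(S h - (h - S h))) ∧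
    ∀ a : 𝔄, δ (letter ψ (b, h₁) * a) = δ (a * letter ψ (b, h₂))

/-- Uniqueness is proved for the difference of two states, which is not positive; only linear
identities survive. For ψ in place of ψ* the roles of Sh and h − Sh are exchanged. -/
theorem IsAlgKMS.linKMS_sub {ω' : 𝔄 →L[ℂ] ℂ} (hω : IsState ω) (hk : IsAlgKMS ψ S ω) (hω' : IsState ω')
    (hk' : IsAlgKMS ψ S ω') : LinKMS ψ S (ω - ω') := by
  rintro (_ | _) h
  · refine ⟨h - S h, S h, by abel, Or.inr (by abel), fun a => ?_⟩
    simp only [_root_.sub_apply, letter]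
    exact congrArg₂ _ (hk.left hω h a) (hk'.left hω' h a)
  · refine ⟨S h, h - S h, by abel, Or.inl rfl, fun a => ?_⟩
    simp only [_root_.sub_apply, letter]
    exact congrArg₂ _ (hk h a) (hk' h a)

/-- Generators with `S h = h / 2` can be moved around cyclically. -/
theorem LinKMS.cyclic (hδ : LinKMS ψ S δ) (b : Bool) {h : H} (hh : S h - (h - S h) = 0) (a : 𝔄) :
    δ (letter ψ (b, h) * a) = δ (a * letter ψ (b, h)) := by
  obtain ⟨h1, h2, e1, e2, h3⟩ := hδ b (h + h)
  have e3 : h1 = h2 := by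
    rw [← sub_eq_zero]
    have : S (h + h) - (h + h - S (h + h)) = 0 := by
      rw [map_add, ← add_zero (0 : H), ← hh]; abel
    rcases e2 with e2 | e2
    · rw [e2, this]
    · rw [e2, this, neg_zero]
  subst e3
  have e4 : h1 = h := by
    have : (2 : ℂ) • h1 = (2 : ℂ) • h := by rw [two_smul, two_smul, e1]
    exact smul_right_injective H (two_ne_zero (α := ℂ)) this
  rw [← e4]
  exact h3 a

/-- The number operator of an orthonormal basis of a finite-dimensional subspace counts letters. -/
theorem number_mul_word (hψ : IsCARAlgebra ψ) {W : Submodule ℂ H} {ι : Type*} [Fintype ι]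
    (e : OrthonormalBasis ι ℂ W) (l : List (Bool × H)) (hl : ∀ p ∈ l, p.2 ∈ W) :
    (∑ i, star (ψ (e i)) * ψ (e i)) * word ψ l = word ψ l * (∑ i, star (ψ (e i)) * ψ (e i)) +
      (l.map fun p => if p.1 then (1 : ℂ) else -1).sum • word ψ l := by
  have hexp : ∀ f ∈ W, ∑ i, ⟪(e i : H), f⟫_ℂ • (e i : H) = f := by
    intro f hf
    have := congrArg Subtype.val (e.sum_repr' ⟨f, hf⟩)
    simpa using this
  induction l with
  | nil => simp [word_nil]
  | cons p l ih =>
    have ih := ih fun q hq => hl q (List.mem_cons_of_mem _ hq)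
    have hp : p.2 ∈ W := hl p List.mem_cons_self
    set N := ∑ i, star (ψ (e i)) * ψ (e i) with hN
    have hcomm : N * letter ψ p = letter ψ p * N + (if p.1 then (1 : ℂ) else -1) • letter ψ p := by
      obtain ⟨_ | _, f⟩ := p
      · simp only [letter, Bool.false_eq_true, if_false]
        have h1 : ∀ i, star (ψ (e i)) * ψ (e i) * ψ f =
            ψ f * (star (ψ (e i)) * ψ (e i)) - star (⟪(e i : H), f⟫_ℂ) • ψ (e i) := by
          intro i
          rw [mul_assoc, hψ.anticomm, mul_neg, ← mul_assoc, hψ.star_mul_eq, sub_mul, smul_mul_assoc,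
            one_mul, mul_assoc]
          rw [RCLike.star_def, inner_conj_symm]
          abel
        rw [hN, Finset.sum_mul, Finset.mul_sum]
        simp only [h1]
        have hsum : ψ f = ∑ i, star (⟪(e i : H), f⟫_ℂ) • ψ (e i) := by
          conv_lhs => rw [← hexp f hp, map_sum]
          simp only [map_smulₛₗ, RCLike.star_def]
        rw [Finset.sum_sub_distrib, ← hsum]
        module
      · simp only [letter, if_true]
        have h1 : ∀ i, star (ψ (e i)) * ψ (e i) * star (ψ f) =
            star (ψ f) * (star (ψ (e i)) * ψ (e i)) + (⟪(e i : H), f⟫_ℂ) • star (ψ (e i)) := by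
          intro i
          rw [mul_assoc, eq_sub_of_add_eq (hψ.anticomm_star _ _), mul_sub, ← mul_assoc,
            hψ.anticomm_star_star, mul_smul_comm, mul_one, neg_mul, mul_assoc]
          abel
        rw [hN, Finset.sum_mul, Finset.mul_sum]
        simp only [h1]
        rw [Finset.sum_add_distrib, one_smul]
        congr 1
        conv_rhs => rw [← hexp f hp, map_sum, star_sum]
        simp
    rw [word_cons, ← mul_assoc, hcomm, add_mul, mul_assoc, ih, mul_add, List.map_cons, List.sum_cons]
    simp only [smul_mul_assoc, mul_smul_comm, mul_assoc]
    module

theorem odd_sum_ne_zero (l : List (Bool × H)) (hl : Odd l.length) :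
    (l.map fun p => if p.1 then (1 : ℂ) else -1).sum ≠ 0 := by
  have h : ∀ l : List (Bool × H), ∃ k : ℤ, (l.map fun p => if p.1 then (1 : ℂ) else -1).sum = (k : ℂ) ∧
      (Odd k ↔ Odd l.length) := by
    intro l
    induction l with
    | nil => exact ⟨0, by simp⟩
    | cons p l ih =>
      obtain ⟨k, hk, hk'⟩ := ih
      rw [List.map_cons, List.sum_cons, hk]
      by_cases hp : p.1
      · refine ⟨1 + k, by simp [hp], ?_⟩
        rw [List.length_cons]
        grind
      · refine ⟨-1 + k, by simp [hp], ?_⟩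
        rw [List.length_cons]
        grind
  obtain ⟨k, hk, hk'⟩ := h l
  rw [hk]
  intro h0
  have := hk'.mpr hl
  rw [Int.cast_eq_zero.mp h0] at this
  simp at this

/-- For odd length a letter passes the other letters with sign +, so δ is cyclic on words of this
length and the KMS identity kills letters from the range of R = 2S − 1. By cyclicity and continuity
every letter may be projected to ker R. There δ is invariant under cyclic permutation of letters, so
the number operator N satisfies δ(Nw) = δ(wN), whereas Nw − wN is an odd multiple of w. -/
theorem LinKMS.odd_step (hψ : IsCARAlgebra ψ) (hS : IsSelfAdjoint S) (hδ : LinKMS ψ S δ) {d : ℕ}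
    (hd : Odd d) (ih : ∀ l : List (Bool × H), l.length < d → δ (word ψ l) = 0) (l : List (Bool × H))
    (hl : l.length = d) : δ (word ψ l) = 0 := by
  have hcyc : ∀ (p : Bool × H) (t : List (Bool × H)), t.length + 1 = d →
      δ (letter ψ p * word ψ t) = δ (word ψ t * letter ψ p) := by
    intro p t ht
    obtain ⟨r, hr, h⟩ := letter_mul_word hψ p t
    have hev : Even t.length := by grind
    rw [h, hev.neg_one_pow, one_smul, map_add, map_lowerWords (fun l' hl' => ih l' (by omega)) hr, add_zero]
  have hspec : ∀ x, ⟪x, S x⟫_ℂ = ⟪S x, x⟫_ℂ := fun x => by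
    rw [← ContinuousLinearMap.adjoint_inner_right, hS.adjoint_eq]
  let R : H →L[ℂ] H := S - (1 - S)
  have hR : IsSelfAdjoint R := hS.sub ((IsSelfAdjoint.one _).sub hS)
  have hRapp : ∀ h, R h = S h - (h - S h) := fun h => rfl
  have hkill : ∀ (b : Bool) (h : H) (t : List (Bool × H)), t.length + 1 = d →
      δ (letter ψ (b, R h) * word ψ t) = 0 := by
    intro b h t ht
    obtain ⟨h1, h2, -, e2, h3⟩ := hδ b h
    have h4 := h3 (word ψ t)
    rw [← hcyc _ t ht] at h4
    have h5 : δ (letter ψ (b, h1 - h2) * word ψ t) = 0 := by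
      rw [letter_sub, sub_mul, map_sub, h4, sub_self]
    rcases e2 with e2 | e2
    · rwa [hRapp, ← e2]
    · rw [← neg_eq_iff_eq_neg] at e2
      rw [hRapp, ← e2, ← zero_sub, letter_sub, sub_mul, map_sub, h5]
      cases b <;> simp [letter]
  let N : Submodule ℂ H := R.ker
  have hNc : IsClosed (N : Set H) := R.isClosed_ker
  have : CompleteSpace N := hNc.completeSpace_coe
  -- R is self-adjoint, so the orthogonal complement of its kernel is the closure of its range.
  have hclos : Nᗮ = (R.range).topologicalClosure := by
    rw [← Submodule.orthogonal_orthogonal_eq_closure, ContinuousLinearMap.orthogonal_range, hR.adjoint_eq]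
  have hkill' : ∀ (b : Bool) (x : H) (t : List (Bool × H)), t.length + 1 = d → x ∈ Nᗮ →
      δ (letter ψ (b, x) * word ψ t) = 0 := by
    intro b x t ht hx
    rw [hclos] at hx
    have hcl : IsClosed {x : H | δ (letter ψ (b, x) * word ψ t) = 0} :=
      isClosed_eq (δ.continuous.comp ((hψ.continuous_letter b).mul continuous_const)) continuous_const
    refine closure_minimal ?_ hcl hx
    rintro _ ⟨h, rfl⟩
    exact hkill b h t ht
  let P : H → H := fun x => (N.orthogonalProjectionOnto x : H)
  have hP : ∀ x, R (P x) = 0 := fun x => (N.orthogonalProjectionOnto x).2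
  have hproj : ∀ (b : Bool) (x : H) (t : List (Bool × H)), t.length + 1 = d →
      δ (word ψ ((b, x) :: t)) = δ (word ψ ((b, P x) :: t)) := by
    intro b x t ht
    rw [word_cons, word_cons, ← sub_eq_zero, ← map_sub, ← sub_mul, ← letter_sub]
    exact hkill' b _ t ht (N.sub_starProjection_mem_orthogonal x)
  -- Cyclicity brings the letters to the front one at a time, where each is projected, and sends
  -- them to the back.
  have hall : ∀ t s : List (Bool × H), (t ++ s).length = d →
      δ (word ψ (t ++ s)) = δ (word ψ (t.map (fun p => (p.1, P p.2)) ++ s)) := by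
    intro t
    induction t with
    | nil => intro s _; rfl
    | cons p t iht =>
      intro s hs
      have e1 : (t ++ s).length + 1 = d := by simpa using hs
      have e2 : (t.map (fun p => (p.1, P p.2)) ++ s).length + 1 = d := by simpa using hs
      obtain ⟨b, x⟩ := p
      rw [List.cons_append, hproj b x _ e1, word_cons, hcyc _ _ e1, ← word_singleton, ← word_append,
        List.append_assoc, iht _ (by simpa [add_assoc] using hs), ← List.append_assoc, word_append, word_singleton,
        ← hcyc _ _ e2, ← word_cons]
      rfl
  have h1 := hall l [] (by simpa using hl)
  rw [List.append_nil, List.append_nil] at h1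
  rw [h1]
  set l' := l.map (fun p => (p.1, P p.2)) with hl'
  have hl'N : ∀ p ∈ l', R p.2 = 0 := by
    intro p hp
    obtain ⟨q, -, rfl⟩ := List.mem_map.mp hp
    exact hP _
  let W : Submodule ℂ H := Submodule.span ℂ {x | ∃ p ∈ l', p.2 = x}
  have hfin : {x | ∃ p ∈ l', p.2 = x}.Finite := (List.finite_toSet l').image Prod.snd
  have : FiniteDimensional ℂ W := FiniteDimensional.span_of_finite ℂ hfin
  have hWN : ∀ x ∈ W, S x - (x - S x) = 0 := by
    intro x hx
    have : W ≤ N := Submodule.span_le.mpr (by rintro _ ⟨p, hp, rfl⟩; exact hl'N p hp)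
    exact this hx
  have h2 := congrArg δ (number_mul_word hψ (stdOrthonormalBasis ℂ W) l'
    (fun p hp => Submodule.subset_span ⟨p, hp, rfl⟩))
  rw [map_add, map_smul, Finset.sum_mul, Finset.mul_sum, map_sum, map_sum] at h2
  have h3 : ∀ i, δ (star (ψ (stdOrthonormalBasis ℂ W i)) * ψ (stdOrthonormalBasis ℂ W i) * word ψ l') =
      δ (word ψ l' * (star (ψ (stdOrthonormalBasis ℂ W i)) * ψ (stdOrthonormalBasis ℂ W i))) := by
    intro i
    have hi := hWN _ (stdOrthonormalBasis ℂ W i).2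
    have c1 := hδ.cyclic true hi (ψ (stdOrthonormalBasis ℂ W i) * word ψ l')
    have c2 := hδ.cyclic false hi (word ψ l' * star (ψ (stdOrthonormalBasis ℂ W i)))
    simp only [letter, if_true, Bool.false_eq_true, if_false] at c1 c2
    rw [mul_assoc, c1, mul_assoc, c2, mul_assoc]
  simp only [h3, left_eq_add, smul_eq_mul] at h2
  exact (mul_eq_zero.mp h2).resolve_left (odd_sum_ne_zero l' (by rw [hl', List.length_map, hl]; exact hd))

/-- For even length split the first letter as h₁ + h₂. The KMS identity moves h₁ to the end as h₂,
while carrying h₂ there through an odd number of letters gives the opposite sign; only shorter words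
remain. -/
theorem LinKMS.word_eq_zero (hψ : IsCARAlgebra ψ) (hS : IsSelfAdjoint S) (hδ : LinKMS ψ S δ)
    (h1 : δ 1 = 0) (l : List (Bool × H)) : δ (word ψ l) = 0 := by
  induction hn : l.length using Nat.strong_induction_on generalizing l with
  | _ n ih =>
    have ih' : ∀ l : List (Bool × H), l.length < n → δ (word ψ l) = 0 := fun l hl => ih _ hl l rfl
    rcases Nat.even_or_odd n with he | ho
    · cases l with
      | nil => rw [word_nil, h1]
      | cons p t =>
        obtain ⟨b, h⟩ := p
        obtain ⟨x, y, e1, -, h3⟩ := hδ b h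
        obtain ⟨r, hr, h4⟩ := letter_mul_word hψ (b, y) t
        have hodd : Odd t.length := by grind
        rw [word_cons, ← e1, letter_add, add_mul, map_add, h3, h4, hodd.neg_one_pow, map_add, map_smul,
          map_lowerWords (fun l' hl' => ih' l' (by grind)) hr]
        simp
    · exact hδ.odd_step hψ hS ho ih' l hn

theorem eq_zero_of_word_eq_zero (hψ : IsCARAlgebra ψ) (h : ∀ l, δ (word ψ l) = 0) : δ = 0 := by
  have h1 : ∀ x ∈ StarAlgebra.adjoin ℂ (Set.range ψ), δ x = 0 := by
    intro x hx
    have h2 : x ∈ Subalgebra.toSubmodule (StarAlgebra.adjoin ℂ (Set.range ψ)).toSubalgebra := hx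
    rw [StarAlgebra.adjoin_eq_span] at h2
    clear hx
    induction h2 using Submodule.span_induction with
    | mem x hx =>
      obtain ⟨L, hL, rfl⟩ := Submonoid.exists_list_of_mem_closure hx
      have h3 : ∃ l, L.prod = word ψ l := by
        clear hx
        induction L with
        | nil => exact ⟨[], rfl⟩
        | cons y L ih =>
          obtain ⟨l, hl⟩ := ih fun z hz => hL z (List.mem_cons_of_mem _ hz)
          rcases hL y List.mem_cons_self with ⟨f, rfl⟩ | ⟨f, hf⟩
          · exact ⟨(false, f) :: l, by rw [word_cons, List.prod_cons, hl]; rfl⟩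
          · refine ⟨(true, f) :: l, ?_⟩
            rw [word_cons, List.prod_cons, hl]
            simp [letter, hf]
      obtain ⟨l, hl⟩ := h3
      rw [hl, h]
    | zero => simp
    | add x y _ _ h1 h2 => rw [map_add, h1, h2, add_zero]
    | smul c x _ h => rw [map_smul, h, smul_zero]
  ext x
  have h2 : x ∈ (StarAlgebra.adjoin ℂ (Set.range ψ)).topologicalClosure := by
    rw [hψ.generates]; trivial
  have hcl : IsClosed {x : 𝔄 | δ x = 0} := isClosed_eq δ.continuous continuous_const
  exact closure_minimal (fun x hx => h1 x hx) hcl h2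

theorem IsAlgKMS.unique (hψ : IsCARAlgebra ψ) (hS : IsSelfAdjoint S) {ω' : 𝔄 →L[ℂ] ℂ} (hω : IsState ω)
    (hk : IsAlgKMS ψ S ω) (hω' : IsState ω') (hk' : IsAlgKMS ψ S ω') : ω = ω' := by
  rw [← sub_eq_zero]
  exact eq_zero_of_word_eq_zero hψ ((hk.linKMS_sub hω hω' hk').word_eq_zero hψ hS
    (by rw [_root_.sub_apply, hω.1, hω'.1, sub_self]))

end Words

/-! ### The determinant formula. -/

section Quasifree

variable {H : Type*} [NormedAddCommGroup H] [InnerProductSpace ℂ H] [CompleteSpace H]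
variable {𝔄 : Type*} [CStarAlgebra 𝔄] {ψ : H →ₗ⋆[ℂ] 𝔄} {S : H →L[ℂ] H} {ω : 𝔄 →L[ℂ] ℂ}

/-- The product `ψ(f_1) ⋯ ψ(f_n)`. -/
def psiProd (ψ : H →ₗ⋆[ℂ] 𝔄) {n : ℕ} (f : Fin n → H) : 𝔄 := (List.ofFn fun i => ψ (f i)).prod

theorem psiProd_zero (f : Fin 0 → H) : psiProd ψ f = 1 := by simp [psiProd]

theorem psiProd_succ {n : ℕ} (f : Fin (n + 1) → H) :
    psiProd ψ f = ψ (f 0) * psiProd ψ (fun i => f i.succ) := by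
  simp [psiProd, List.ofFn_succ]

theorem prod_reverse_eq_star {n : ℕ} (g : Fin n → H) :
    (List.ofFn fun j => star (ψ (g j))).reverse.prod = star (psiProd ψ g) := by
  induction n with
  | zero => simp [psiProd]
  | succ n ih => rw [psiProd_succ, List.ofFn_succ, List.reverse_cons, List.prod_append, ih]; simp

theorem psi_mul_psiProd (hψ : IsCARAlgebra ψ) (y : H) {n : ℕ} (f : Fin n → H) :
    ψ y * psiProd ψ f = (-1 : ℂ) ^ n • (psiProd ψ f * ψ y) := by
  induction n with
  | zero => simp [psiProd_zero]
  | succ n ih =>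
    rw [psiProd_succ, ← mul_assoc, hψ.anticomm, neg_mul, mul_assoc, ih, pow_succ, mul_smul_comm, mul_assoc]
    module

theorem star_mul_psiProd (hψ : IsCARAlgebra ψ) (y : H) (n : ℕ) (g : Fin (n + 1) → H) :
    star (ψ y) * psiProd ψ g = (-1 : ℂ) ^ (n + 1) • (psiProd ψ g * star (ψ y)) +
      ∑ j : Fin (n + 1), ((-1 : ℂ) ^ (j : ℕ) * ⟪g j, y⟫_ℂ) • psiProd ψ (fun i => g (j.succAbove i)) := by
  induction n with
  | zero =>
    rw [psiProd_succ, psiProd_zero, mul_one, hψ.star_mul_eq]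
    simp [psiProd_zero, sub_eq_neg_add]
  | succ n ih =>
    rw [psiProd_succ, ← mul_assoc, hψ.star_mul_eq, sub_mul, smul_mul_assoc, one_mul, mul_assoc, ih,
      Fin.sum_univ_succ (n := n + 1), mul_add, Finset.mul_sum, mul_smul_comm, pow_succ _ (n + 1), mul_assoc]
    have h1 : ∀ j : Fin (n + 1), ((-1 : ℂ) ^ (j.succ : ℕ) * ⟪g j.succ, y⟫_ℂ) •
        psiProd ψ (fun i => g (j.succ.succAbove i)) =
        -(ψ (g 0) * (((-1 : ℂ) ^ (j : ℕ) * ⟪g j.succ, y⟫_ℂ) •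
          psiProd ψ (fun i => g (j.succAbove i).succ))) := by
      intro j
      rw [psiProd_succ, mul_smul_comm, Fin.val_succ, pow_succ]
      simp only [Fin.succ_succAbove_zero, Fin.succ_succAbove_succ]
      module
    simp only [h1, Finset.sum_neg_distrib, Fin.succAbove_zero, Fin.val_zero, pow_zero, one_mul]
    module

/-- ψ(y) passes 2n + 1 letters, hence the sign −, and is contracted only with the starred ones. -/
theorem psi_mul_star_psiProd (hψ : IsCARAlgebra ψ) (y : H) {n : ℕ} (f : Fin n → H)
    (g : Fin (n + 1) → H) :
    ψ y * (psiProd ψ f * star (psiProd ψ g)) = -(psiProd ψ f * star (psiProd ψ g) * ψ y) +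
      ∑ j : Fin (n + 1), ((-1 : ℂ) ^ (j : ℕ) * ⟪y, g j⟫_ℂ) •
        (psiProd ψ f * star (psiProd ψ (fun i => g (j.succAbove i)))) := by
  have h1 := congrArg star (star_mul_psiProd hψ y n g)
  simp only [star_add, star_sum, star_smul, star_mul, star_star, star_pow, star_neg, star_one,
    RCLike.star_def, inner_conj_symm, mul_comm ⟪y, _⟫_ℂ] at h1
  have h2 : ψ y * star (psiProd ψ g) = (-1 : ℂ) ^ (n + 1) • (star (psiProd ψ g) * ψ y -
      ∑ j : Fin (n + 1), ((-1 : ℂ) ^ (j : ℕ) * ⟪y, g j⟫_ℂ) •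
        star (psiProd ψ (fun i => g (j.succAbove i)))) := by
    rw [h1, add_sub_cancel_right, smul_smul, ← mul_pow]
    simp
  rw [← mul_assoc, psi_mul_psiProd hψ, smul_mul_assoc, mul_assoc, h2, mul_smul_comm, smul_smul, mul_sub,
    Finset.mul_sum, pow_succ, ← mul_assoc, ← mul_pow, mul_assoc]
  simp only [mul_smul_comm]
  norm_num
  exact sub_eq_neg_add _ _

theorem psiProd_smul (c : ℂ) {n : ℕ} (f : Fin n → H) :
    psiProd ψ (fun i => c • f i) = star c ^ n • psiProd ψ f := by
  induction n with
  | zero => simp [psiProd_zero]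
  | succ n ih =>
    rw [psiProd_succ, psiProd_succ, ih, map_smulₛₗ, smul_mul_smul_comm, pow_succ']
    rfl

theorem map_psiProd {α : 𝔄 ≃⋆ₐ[ℂ] 𝔄} {U : H → H} (hα : ∀ f, α (ψ f) = ψ (U f)) {n : ℕ} (f : Fin n → H) :
    α (psiProd ψ f) = psiProd ψ (fun i => U (f i)) := by
  induction n with
  | zero => simp [psiProd_zero]
  | succ n ih => rw [psiProd_succ, psiProd_succ, map_mul, ih, hα]

theorem starAlgEquiv_continuous (α : 𝔄 ≃⋆ₐ[ℂ] 𝔄) : Continuous α := (StarAlgEquiv.isometry α).continuous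

/-- A state of the CAR algebra with the KMS property is gauge invariant. -/
theorem IsAlgKMS.gauge (hψ : IsCARAlgebra ψ) (hS : IsSelfAdjoint S) (hω : IsState ω) (hk : IsAlgKMS ψ S ω)
    {c : ℂ} (hc : star c * c = 1) :
    ∃ α : 𝔄 ≃⋆ₐ[ℂ] 𝔄, (∀ f, α (ψ f) = ψ (c • f)) ∧ ∀ a, ω (α a) = ω a := by
  have hα := bogoliubov_apply hψ (U := c • (1 : H →L[ℂ] H)) (fun x y => by
    simp only [_root_.smul_apply, one_apply_eq_self, inner_smul_left, inner_smul_right]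
    rw [← mul_assoc, mul_comm c, ← RCLike.star_def, hc, one_mul]) (fun y => ⟨star c • y, by
      simp only [_root_.smul_apply, one_apply_eq_self, smul_smul]
      rw [mul_comm, hc, one_smul]⟩)
  set α := bogoliubov ψ (c • (1 : H →L[ℂ] H))
  have hα : ∀ f, α (ψ f) = ψ (c • f) := hα
  refine ⟨α, hα, fun a => ?_⟩
  let ω' : 𝔄 →L[ℂ] ℂ := ω.comp ⟨(α : 𝔄 →ₗ[ℂ] 𝔄), starAlgEquiv_continuous α⟩
  have happ : ∀ a, ω' a = ω (α a) := fun _ => rfl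
  have hω' : IsState ω' := ⟨by rw [happ, map_one, hω.1], fun a => by
    rw [happ, map_mul, map_star]; exact hω.2 _⟩
  -- S commutes with the phase c, so the rotated state has the same KMS property and uniqueness
  -- applies.
  have hk' : IsAlgKMS ψ S ω' := by
    intro h a
    rw [happ, happ, map_mul α, map_mul α, map_star α, map_star α, hα, hα, ← map_smul, hk (c • h), smul_sub, map_smul]
  rw [← happ, hk'.unique hψ hS hω' hω hk]

theorem IsAlgKMS.eq_zero_of_ne (hψ : IsCARAlgebra ψ) (hS : IsSelfAdjoint S) (hω : IsState ω)
    (hk : IsAlgKMS ψ S ω) {n m : ℕ} (hnm : n ≠ m) (f : Fin n → H) (g : Fin m → H) :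
    ω (psiProd ψ f * star (psiProd ψ g)) = 0 := by
  have hne : (n : ℂ) - m ≠ 0 := sub_ne_zero.mpr (by exact_mod_cast hnm)
  -- The rotation by θ multiplies the product by e^{-i(n−m)θ} = −1.
  set θ : ℝ := Real.pi / (n - m) with hθ
  have hs : star (Complex.exp (Complex.I * θ)) = Complex.exp (-(Complex.I * θ)) := by
    rw [RCLike.star_def, ← Complex.exp_conj]
    simp
  obtain ⟨α, hα, hα'⟩ := hk.gauge hψ hS hω (c := Complex.exp (Complex.I * θ)) (by
    rw [hs, ← Complex.exp_add]; simp)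
  have h1 := hα' (psiProd ψ f * star (psiProd ψ g))
  rw [map_mul, map_star, map_psiProd hα, map_psiProd hα, psiProd_smul, psiProd_smul, star_smul, star_pow,
    star_star, smul_mul_smul_comm, map_smul, hs, ← Complex.exp_nat_mul, ← Complex.exp_nat_mul,
    ← Complex.exp_add] at h1
  have h2 : (n : ℂ) * -(Complex.I * θ) + m * (Complex.I * θ) = -(Real.pi * Complex.I) := by
    rw [hθ]
    push_cast
    field_simp
    ring
  rw [h2, Complex.exp_neg, Complex.exp_pi_mul_I] at h1
  rw [smul_eq_mul] at h1
  norm_num at h1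
  linear_combination (-1 / 2 : ℂ) * h1

/-- Splitting f₀ as (f₀ − Sf₀) + Sf₀ and moving the first part to the other end turns ω(ψ(f₀)a) into
ω of the anticommutator of ψ(Sf₀) with a, which is the Laplace expansion along the first row. -/
theorem IsAlgKMS.isQuasifree (hψ : IsCARAlgebra ψ) (hS : IsSelfAdjoint S) (hω : IsState ω)
    (hk : IsAlgKMS ψ S ω) : IsQuasifree ψ S ω := by
  have hsymm : ∀ x y : H, ⟪S x, y⟫_ℂ = ⟪x, S y⟫_ℂ := fun x y => by
    rw [← ContinuousLinearMap.adjoint_inner_right, hS.adjoint_eq]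
  refine ⟨fun n f g => ?_, fun n m f g hnm => ?_⟩
  · rw [prod_reverse_eq_star]
    change ω (psiProd ψ f * _) = _
    induction n with
    | zero => simp [psiProd_zero, hω.1]
    | succ n ih =>
      have h1 := hk.left hω (f 0) (psiProd ψ (fun i => f i.succ) * star (psiProd ψ g))
      have h2 := congrArg ω (psi_mul_star_psiProd hψ (S (f 0)) (fun i => f i.succ) g)
      rw [map_sub, sub_mul, map_sub, sub_eq_iff_eq_add] at h1
      rw [map_add, map_neg, ← sub_eq_iff_eq_add', sub_neg_eq_add, add_comm] at h2
      rw [psiProd_succ, mul_assoc, h1, h2, map_sum, Matrix.det_succ_row_zero]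
      refine Finset.sum_congr rfl fun j _ => ?_
      rw [map_smul, ih, smul_eq_mul, hsymm]
      rfl
  · rw [prod_reverse_eq_star]
    exact hk.eq_zero_of_ne hψ hS hω hnm f g

end Quasifree

/-! ### Bounded holomorphic functions on a strip. -/

section Strip

variable {F : ℂ → ℂ} {β C : ℝ}

theorem closure_strip (hβ : 0 < β) :
    closure {z : ℂ | 0 < z.im ∧ z.im < β} = {z | 0 ≤ z.im ∧ z.im ≤ β} := by
  change closure (Complex.im ⁻¹' Set.Ioo 0 β) = Complex.im ⁻¹' Set.Icc 0 β
  rw [Complex.closure_preimage_im, closure_Ioo hβ.ne]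

theorem strip_norm_le (hβ : 0 < β) (hc : ContinuousOn F {z | 0 ≤ z.im ∧ z.im ≤ β})
    (hd : DifferentiableOn ℂ F {z | 0 < z.im ∧ z.im < β})
    (hB : ∃ B : ℝ, ∀ z : ℂ, 0 ≤ z.im → z.im ≤ β → ‖F z‖ ≤ B)
    (h0 : ∀ t : ℝ, ‖F t‖ ≤ C) (h1 : ∀ t : ℝ, ‖F (t + Complex.I * β)‖ ≤ C) {z : ℂ} (hz0 : 0 ≤ z.im)
    (hz1 : z.im ≤ β) : ‖F z‖ ≤ C := by
  obtain ⟨B, hB⟩ := hB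
  refine PhragmenLindelof.horizontal_strip (a := 0) (b := β) (f := F)
    ⟨hd, by change ContinuousOn F (closure {z : ℂ | 0 < z.im ∧ z.im < β}); rwa [closure_strip hβ]⟩
    ⟨0, by rw [sub_zero]; positivity, 0, ?_⟩ (fun w hw => ?_) (fun w hw => ?_) hz0 hz1
  · refine Asymptotics.IsBigO.of_bound B ?_
    refine Filter.Eventually.filter_mono inf_le_right ?_
    rw [eventually_principal]
    intro w hw
    simpa using hB w hw.1.le hw.2.le
  · have : w = (w.re : ℂ) := Complex.ext (by simp) (by simp [hw])
    rw [this]; exact h0 _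
  · have : w = (w.re : ℂ) + Complex.I * β := Complex.ext (by simp) (by simp [hw])
    rw [this]; exact h1 _

/-- Multiplying by e^{ilz} changes the bound on the upper edge to Be^{-lβ} and keeps the zero on the
lower one, so |F(z)| ≤ Be^{-l(β − Im z)} for all l ≥ 0. The upper edge follows by continuity. -/
theorem strip_eq_zero (hβ : 0 < β) (hc : ContinuousOn F {z | 0 ≤ z.im ∧ z.im ≤ β})
    (hd : DifferentiableOn ℂ F {z | 0 < z.im ∧ z.im < β})
    (hB : ∃ B : ℝ, ∀ z : ℂ, 0 ≤ z.im → z.im ≤ β → ‖F z‖ ≤ B)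
    (h0 : ∀ t : ℝ, F t = 0) {z : ℂ} (hz0 : 0 ≤ z.im) (hz1 : z.im ≤ β) : F z = 0 := by
  obtain ⟨B, hB⟩ := hB
  have hB0 : 0 ≤ B := (norm_nonneg _).trans (hB 0 (by simp) (by simpa using hβ.le))
  have hexp : ∀ (l : ℝ) (z : ℂ), ‖Complex.exp (Complex.I * l * z)‖ = Real.exp (-(l * z.im)) := by
    intro l z
    rw [Complex.norm_exp]
    simp
  have key : ∀ z : ℂ, 0 ≤ z.im → z.im ≤ β → ∀ l : ℝ, 0 ≤ l →
      ‖F z‖ ≤ B * Real.exp (-(l * (β - z.im))) := by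
    intro z hz0 hz1 l hl
    have := strip_norm_le (F := fun z => Complex.exp (Complex.I * l * z) * F z)
      (C := Real.exp (-(l * β)) * B) hβ (ContinuousOn.mul (by fun_prop) hc)
      (DifferentiableOn.mul (by fun_prop) hd) ⟨B, fun w hw0 hw1 => ?_⟩ (fun t => ?_) (fun t => ?_) hz0 hz1
    · rw [norm_mul, hexp] at this
      have h2 : Real.exp (-(l * (β - z.im))) = Real.exp (l * z.im) * Real.exp (-(l * β)) := by
        rw [← Real.exp_add]; congr 1; ring
      have h3 : Real.exp (l * z.im) * Real.exp (-(l * z.im)) = 1 := by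
        rw [← Real.exp_add]; simp
      calc ‖F z‖ = Real.exp (l * z.im) * (Real.exp (-(l * z.im)) * ‖F z‖) := by
            rw [← mul_assoc, h3, one_mul]
        _ ≤ Real.exp (l * z.im) * (Real.exp (-(l * β)) * B) := by gcongr
        _ = _ := by rw [h2]; ring
    · rw [norm_mul, hexp]
      calc _ ≤ 1 * B := by
            gcongr
            · exact Real.exp_le_one_iff.mpr (by have := mul_nonneg hl hw0; linarith)
            · exact hB w hw0 hw1
        _ = B := one_mul _
    · rw [h0]; simp; positivity
    · rw [norm_mul, hexp]
      gcongr
      · simp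
      · exact hB _ (by simpa using hβ.le) (by simp)
  have hint : Set.EqOn F (fun _ => 0) {z | 0 < z.im ∧ z.im < β} := by
    intro w hw
    have hlim : Tendsto (fun l : ℝ => B * Real.exp (-(l * (β - w.im)))) atTop (𝓝 (B * 0)) := by
      refine Tendsto.const_mul _ (Real.tendsto_exp_neg_atTop_nhds_zero.comp ?_)
      exact tendsto_id.atTop_mul_const (sub_pos.mpr hw.2)
    rw [mul_zero] at hlim
    have := ge_of_tendsto hlim (by
      filter_upwards [eventually_ge_atTop 0] with l hl
      exact key w hw.1.le hw.2.le l hl)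
    exact norm_le_zero_iff.mp this
  exact hint.of_subset_closure hc continuousOn_const (fun w hw => ⟨hw.1.le, hw.2.le⟩)
    (closure_strip hβ).ge ⟨hz0, hz1⟩

end Strip

/-! ### Equivalence of the bounded and the analytic KMS conditions. -/

section KMS

variable {H : Type*} [NormedAddCommGroup H] [InnerProductSpace ℂ H] [CompleteSpace H]
variable {𝔄 : Type*} [CStarAlgebra 𝔄] {ψ : H →ₗ⋆[ℂ] 𝔄} {ω : 𝔄 →L[ℂ] ℂ}
variable {D : H →ₗ.[ℂ] H} {β : ℝ}

theorem fermiOp_isSelfAdjoint (hD : IsSelfAdjoint D) {s : ℝ} (hs : s ∈ Set.Icc 0 β) :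
    IsSelfAdjoint (fermiOp D β s) := by
  have h := opFun_star hD ((expBdd_fermi β).bddCont (z := (s : ℂ)) (by simpa using hs))
  rw [IsSelfAdjoint, fermiOp, ← h]
  congr 1
  ext x
  simp only [expFn, fermi, star_mul', RCLike.star_def, ← Complex.exp_conj, map_mul, Complex.conj_ofReal]

theorem fermiOp_nonneg (hD : IsSelfAdjoint D) {s : ℝ} (hs : s ∈ Set.Icc 0 β) (x : H) :
    0 ≤ (⟪x, fermiOp D β s x⟫_ℂ).re := by
  let g : ℝ → ℂ := fun x => ((Real.sqrt (Real.exp (s * x) * (1 / (1 + Real.exp (β * x)))) : ℝ) : ℂ)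
  have hsq : ∀ x, g x * g x = expFn (fermi β) s x := by
    intro x
    simp only [g, expFn, fermi]
    rw [← Complex.ofReal_mul, Real.mul_self_sqrt (by positivity)]
    push_cast
    rfl
  have hg : BddCont g := by
    refine ⟨?_, 1, fun x => ?_⟩
    · refine Complex.continuous_ofReal.comp (Real.continuous_sqrt.comp (.mul (by fun_prop)
        (continuous_const.div (by fun_prop) fun x => ?_)))
      positivity
    · have h1 := (expBdd_fermi β).norm_le (z := (s : ℂ)) (by simpa using hs) x
      rw [← hsq, norm_mul, ← pow_two] at h1
      exact (sq_le_one_iff₀ (norm_nonneg _)).mp h1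
  have h1 : fermiOp D β s = opFun D g * opFun D g := by
    rw [← opFun_mul hD hg hg, fermiOp]
    congr 1
    ext x
    exact (hsq x).symm
  have h2 : (fun t => star (g t)) = g := by
    ext t
    simp [g]
  have h3 := opFun_inner hD hg x (opFun D g x)
  rw [h2] at h3
  rw [h1, mul_apply_eq_comp, ← h3]
  exact inner_self_nonneg (𝕜 := ℂ)

theorem fermiOp_le (hD : IsSelfAdjoint D) (hβ : 0 ≤ β) (x : H) :
    (⟪x, fermiOp D β β x⟫_ℂ).re ≤ ‖x‖ ^ 2 := by
  have h1 := congrArg (fun A : H →L[ℂ] H => A x) (fermiOp_zero_add_beta hD hβ)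
  simp only [_root_.add_apply, one_apply_eq_self] at h1
  have h2 := congrArg (fun y => (⟪x, y⟫_ℂ).re) h1
  simp only [inner_add_right, Complex.add_re] at h2
  have h3 := fermiOp_nonneg hD (β := β) (s := 0) ⟨le_rfl, hβ⟩ x
  have h4 : (⟪x, x⟫_ℂ).re = ‖x‖ ^ 2 := inner_self_eq_norm_sq (𝕜 := ℂ) x
  rw [Complex.ofReal_zero] at h3
  linarith

theorem sub_fermiOp_beta (hD : IsSelfAdjoint D) (hβ : 0 ≤ β) (h : H) :
    h - fermiOp D β β h = fermiOp D β 0 h := by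
  have h1 := congrArg (fun A : H →L[ℂ] H => A h) (fermiOp_zero_add_beta hD hβ)
  simp only [_root_.add_apply, one_apply_eq_self] at h1
  exact (eq_sub_of_add_eq h1).symm

theorem unitaryGroup_fermiOp (hD : IsSelfAdjoint D) (t : ℝ) {z : ℂ} (hz : z.re ∈ Set.Icc 0 β) :
    unitaryGroup D t * fermiOp D β z = fermiOp D β (z + Complex.I * t) := by
  rw [unitaryGroup, fermiOp, fermiOp, ← opFun_mul hD (bddCont_unitary t) ((expBdd_fermi β).bddCont hz)]
  congr 1
  ext x
  rw [expFn, expFn, ← mul_assoc, ← Complex.exp_add]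
  ring_nf

theorem evolution_star (hψ : IsCARAlgebra ψ) (hD : IsSelfAdjoint D) (t : ℝ) (f : H) :
    evolution ψ D t (star (ψ f)) = star (ψ (unitaryGroup D t f)) := by
  rw [map_star, evolution_apply hψ hD]

/-- The orbit of ψ(Sh)* has the explicit continuation e^{izD}Sh = X_D(β + iz)h. It agrees with the
KMS function on the real axis, hence on the strip, and at z = iβ it is X_D(0)h = h − Sh. -/
theorem IsKMSState.isAlgKMS (hψ : IsCARAlgebra ψ) (hD : IsSelfAdjoint D) (hβ : 0 < β)
    (hω : IsKMSState (evolution ψ D) β ω) : IsAlgKMS ψ (fermiOp D β β) ω := by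
  intro h a
  obtain ⟨F, hc, hd, ⟨C, hC⟩, hF⟩ := hω.2 a (star (ψ (fermiOp D β β h)))
  let L : H →L[ℂ] ℂ := ω.comp ((ContinuousLinearMap.mul ℂ 𝔄 a).comp hψ.starL)
  have hL : ∀ x, L x = ω (a * star (ψ x)) := fun _ => rfl
  let G : ℂ → ℂ := fun z => L (fermiOp D β (β + Complex.I * z) h)
  have hre : ∀ z : ℂ, ((β : ℂ) + Complex.I * z).re = β - z.im := fun z => by simp [sub_eq_add_neg]
  have hGc : ContinuousOn G {z | 0 ≤ z.im ∧ z.im ≤ β} := by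
    refine L.continuous.comp_continuousOn ((continuousOn_fermiOp_apply (β := β) hD h).comp (by fun_prop) ?_)
    intro z hz
    rw [Set.mem_ofPred_eq, hre]
    exact ⟨by linarith [hz.2], by linarith [hz.1]⟩
  have hGd : DifferentiableOn ℂ G {z | 0 < z.im ∧ z.im < β} := by
    intro z hz
    have hz' : ((β : ℂ) + Complex.I * z).re ∈ Set.Ioo 0 β := by
      rw [hre]; exact ⟨by linarith [hz.2], by linarith [hz.1]⟩
    have h1 : DifferentiableAt ℂ (fermiOp D β) (β + Complex.I * z) := (hasDerivAt_fermiOp hD hz').differentiableAt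
    have h2 : DifferentiableAt ℂ (fun z => fermiOp D β (β + Complex.I * z)) z :=
      DifferentiableAt.comp (g := fermiOp D β) (f := fun z => β + Complex.I * z) z h1 (by fun_prop)
    exact ((L.differentiableAt).comp z (h2.clm_apply (differentiableAt_const h))).differentiableWithinAt
  have hGB : ∀ z : ℂ, 0 ≤ z.im → z.im ≤ β → ‖G z‖ ≤ ‖L‖ * ‖h‖ := by
    intro z h0 h1
    refine (L.le_opNorm _).trans ?_
    gcongr
    refine ((fermiOp D β _).le_opNorm h).trans ?_
    have := norm_fermiOp_le (β := β) hD (z := β + Complex.I * z) (by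
      rw [hre]; exact ⟨by linarith, by linarith⟩)
    exact mul_le_of_le_one_left (norm_nonneg _) this
  have hU : ∀ t : ℝ, unitaryGroup D t (fermiOp D β β h) = fermiOp D β (β + Complex.I * t) h := fun t =>
    congrArg (fun A : H →L[ℂ] H => A h) (unitaryGroup_fermiOp hD t (by simpa using hβ.le))
  have hzero := strip_eq_zero (F := fun z => F z - G z) hβ (hc.sub hGc) (hd.sub hGd)
    ⟨C + ‖L‖ * ‖h‖, fun z h0 h1 => (norm_sub_le _ _).trans (add_le_add (hC z h0 h1) (hGB z h0 h1))⟩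
    (fun t => by
      rw [(hF t).1, evolution_star hψ hD, hU]
      exact sub_self _)
    (z := ((0 : ℝ) : ℂ) + Complex.I * β) (by simpa using hβ.le) (by simp)
  have e1 := (hF 0).2
  rw [sub_eq_zero.mp hzero, evolution_star hψ hD, hU] at e1
  simp only [G, hL, Complex.ofReal_zero, zero_add, mul_zero, add_zero] at e1
  have e2 : (β : ℂ) + Complex.I * (Complex.I * β) = 0 := by linear_combination (β : ℂ) * Complex.I_mul_I
  rw [e2] at e1
  rw [← e1, sub_fermiOp_beta hD hβ.le]

/-- `b` has an entire orbit with the KMS property. -/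
def EntireKMS (ψ : H →ₗ⋆[ℂ] 𝔄) (D : H →ₗ.[ℂ] H) (β : ℝ) (ω : 𝔄 →L[ℂ] ℂ) (b : 𝔄) : Prop :=
  ∃ B : ℂ → 𝔄, Differentiable ℂ B ∧ (∃ C, ∀ z : ℂ, |z.im| ≤ β → ‖B z‖ ≤ C) ∧
    (∀ t : ℝ, B t = evolution ψ D t b) ∧ ∀ z a, ω (a * B (z + Complex.I * β)) = ω (B z * a)

theorem EntireKMS.add {b b' : 𝔄} (h : EntireKMS ψ D β ω b) (h' : EntireKMS ψ D β ω b') :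
    EntireKMS ψ D β ω (b + b') := by
  obtain ⟨B, h1, ⟨C, h2⟩, h3, h4⟩ := h
  obtain ⟨B', h1', ⟨C', h2'⟩, h3', h4'⟩ := h'
  refine ⟨fun z => B z + B' z, h1.add h1', ⟨C + C', fun z hz =>
    (norm_add_le _ _).trans (add_le_add (h2 z hz) (h2' z hz))⟩, fun t => ?_, fun z a => ?_⟩
  · beta_reduce
    rw [h3, h3', map_add]
  · rw [mul_add, add_mul, map_add, map_add, h4, h4']

/-- The factors are moved around one after the other: first B'(z + iβ), then B(z + iβ). -/
theorem EntireKMS.mul {b b' : 𝔄} (h : EntireKMS ψ D β ω b) (h' : EntireKMS ψ D β ω b') :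
    EntireKMS ψ D β ω (b * b') := by
  obtain ⟨B, h1, ⟨C, h2⟩, h3, h4⟩ := h
  obtain ⟨B', h1', ⟨C', h2'⟩, h3', h4'⟩ := h'
  refine ⟨fun z => B z * B' z, h1.mul h1', ⟨C * C', fun z hz =>
    (norm_mul_le _ _).trans (mul_le_mul (h2 z hz) (h2' z hz) (norm_nonneg _)
      ((norm_nonneg _).trans (h2 z hz)))⟩, fun t => ?_, fun z a => ?_⟩
  · beta_reduce
    rw [h3, h3', map_mul]
  · rw [← mul_assoc, h4', ← mul_assoc, h4, mul_assoc]

theorem EntireKMS.star (hω : IsState ω) {b : 𝔄} (h : EntireKMS ψ D β ω b) :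
    EntireKMS ψ D β ω (star b) := by
  obtain ⟨B, h1, ⟨C, h2⟩, h3, h4⟩ := h
  refine ⟨fun z => Star.star (B (starRingEnd ℂ z)), fun z => ?_, ⟨C, fun z hz => ?_⟩, fun t => ?_,
    fun z a => ?_⟩
  · have := (h1 (starRingEnd ℂ z)).star_conj
    rw [Complex.conj_conj] at this
    exact this
  · rw [norm_star]
    exact h2 _ (by simpa using hz)
  · beta_reduce
    rw [Complex.conj_ofReal, h3, map_star]
  -- Conjugation reverses the shift by iβ, so the relation is used at z̄ − iβ.
  · have e := h4 (starRingEnd ℂ z - Complex.I * β) (Star.star a)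
    rw [sub_add_cancel] at e
    have e' := congrArg Star.star e
    rw [← hω.map_star, ← hω.map_star, star_mul, star_mul, star_star] at e'
    rw [e']
    beta_reduce
    rw [map_add, map_mul (starRingEnd ℂ), Complex.conj_I, Complex.conj_ofReal, neg_mul, ← sub_eq_add_neg]

theorem entireKMS_algebraMap (c : ℂ) : EntireKMS ψ D β ω (algebraMap ℂ 𝔄 c) :=
  ⟨fun _ => algebraMap ℂ 𝔄 c, differentiable_const _, ⟨_, fun _ _ => le_rfl⟩,
    fun t => (AlgHomClass.commutes _ c).symm, fun z a => by rw [Algebra.commutes]⟩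

/-- The Gaussian cutoff `e^{-εx²}`. -/
def gaussian (ε x : ℝ) : ℂ := ((Real.exp (-(ε * x ^ 2)) : ℝ) : ℂ)

theorem expBdd_gaussian {ε : ℝ} (hε : 0 < ε) (b : ℝ) :
    ExpBdd (gaussian ε) (-b) b (Real.exp (b ^ 2 / (4 * ε))) := by
  refine ⟨by unfold gaussian; fun_prop, fun y hy x => ?_⟩
  rw [gaussian, Complex.norm_real, Real.norm_of_nonneg (Real.exp_pos _).le, ← Real.exp_add]
  refine Real.exp_le_exp.mpr ?_
  have h1 : y ^ 2 ≤ b ^ 2 := sq_le_sq' hy.1 hy.2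
  have h2 : y * x + -(ε * x ^ 2) = y ^ 2 / (4 * ε) - ε * (x - y / (2 * ε)) ^ 2 := by
    field_simp
    ring
  rw [h2]
  have h3 : y ^ 2 / (4 * ε) ≤ b ^ 2 / (4 * ε) := by gcongr
  have h4 : 0 ≤ ε * (x - y / (2 * ε)) ^ 2 := by positivity
  linarith

/-- The Gaussian Γ(D) makes the orbit entire. With k(x) = e^{izx}(1 + e^{-βx})Γ(x) one has S k(D) =
e^{izD}Γ(D) and (1 − S)k(D) = e^{i(z + iβ)D}Γ(D), so the bounded condition for k(D)h is the required
relation at z. -/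
theorem entireKMS_gaussian (hψ : IsCARAlgebra ψ) (hD : IsSelfAdjoint D) (hβ : 0 < β)
    (hk : IsAlgKMS ψ (fermiOp D β β) ω) {ε : ℝ} (hε : 0 < ε) (h : H) :
    EntireKMS ψ D β ω (star (ψ (opFun D (gaussian ε) h))) := by
  have hre : ∀ z : ℂ, (Complex.I * z).re = -z.im := fun z => by simp
  have hb : ∀ z : ℂ, BddCont (expFn (gaussian ε) z) := fun z =>
    (expBdd_gaussian hε |z.re|).bddCont ⟨neg_abs_le _, le_abs_self _⟩
  refine ⟨fun z => hψ.starL (opFun D (expFn (gaussian ε) (Complex.I * z)) h), fun z => ?_,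
    ⟨Real.exp (β ^ 2 / (4 * ε)) * ‖h‖, fun z hz => ?_⟩, fun t => ?_, fun z a => ?_⟩
  · have h1 : DifferentiableAt ℂ (fun z => opFun D (expFn (gaussian ε) z)) (Complex.I * z) :=
      (hasDerivAt_opFun_expFn hD (expBdd_gaussian hε (|z.im| + 1)) (by
        rw [hre]
        constructor <;> cases abs_cases z.im <;> linarith)).differentiableAt
    have h2 : DifferentiableAt ℂ (fun z => opFun D (expFn (gaussian ε) (Complex.I * z))) z :=
      DifferentiableAt.comp z h1 (by fun_prop)
    exact hψ.starL.differentiableAt.comp z (h2.clm_apply (differentiableAt_const h))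
  · beta_reduce
    rw [hψ.starL_apply, norm_star]
    refine (hψ.norm_le _).trans ((ContinuousLinearMap.le_opNorm _ _).trans ?_)
    gcongr
    refine norm_opFun_le hD (hb _).1 ((expBdd_gaussian hε β).norm_le ?_)
    rw [hre]
    exact ⟨by linarith [(abs_le.mp hz).2], by linarith [(abs_le.mp hz).1]⟩
  · beta_reduce
    rw [evolution_star hψ hD, hψ.starL_apply, unitaryGroup, ← mul_apply_eq_comp]
    have hg : BddCont (gaussian ε) := by
      have : expFn (gaussian ε) 0 = gaussian ε := by ext x; simp [expFn]
      exact this ▸ hb 0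
    rw [← opFun_mul hD (bddCont_unitary t) hg]
    rfl
  · -- write `e^{izD} Γ h = S h'`
    let k : ℝ → ℂ := fun x => expFn (gaussian ε) (Complex.I * z) x +
      expFn (gaussian ε) (Complex.I * (z + Complex.I * β)) x
    have hkb : BddCont k := (hb _).add (hb _)
    have hI : ∀ x : ℝ, expFn (gaussian ε) (Complex.I * (z + Complex.I * β)) x * Complex.exp (β * x) =
        expFn (gaussian ε) (Complex.I * z) x := by
      intro x
      rw [expFn, expFn, mul_right_comm, ← Complex.exp_add]
      congr 2
      linear_combination (β : ℂ) * x * Complex.I_mul_I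
    have h0 : (0 : ℂ).re ∈ Set.Icc 0 β := by simpa using hβ.le
    have h1 : (β : ℂ).re ∈ Set.Icc 0 β := by simpa using hβ.le
    have hfe : ∀ x : ℝ, fermi β x * (1 + Complex.exp (β * x)) = 1 := by
      intro x
      have h2 : (1 + Real.exp (β * x) : ℝ) ≠ 0 := by positivity
      have h3 : (1 : ℂ) + Complex.exp (β * x) ≠ 0 := by
        have := Complex.ofReal_ne_zero.mpr h2
        push_cast at this
        exact this
      rw [fermi]
      push_cast
      rw [one_div, inv_mul_cancel₀ h3]
    have e1 : fermiOp D β β (opFun D k h) = opFun D (expFn (gaussian ε) (Complex.I * z)) h := by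
      rw [← mul_apply_eq_comp, fermiOp, ← opFun_mul hD ((expBdd_fermi β).bddCont h1) hkb]
      congr 2
      ext x
      simp only [k]
      rw [← hI x]
      simp only [expFn]
      linear_combination Complex.exp (β * x) * (Complex.exp (Complex.I * (z + Complex.I * β) * x) *
        gaussian ε x) * hfe x
    have e2 : fermiOp D β 0 (opFun D k h) =
        opFun D (expFn (gaussian ε) (Complex.I * (z + Complex.I * β))) h := by
      rw [← mul_apply_eq_comp, fermiOp, ← opFun_mul hD ((expBdd_fermi β).bddCont h0) hkb]
      congr 2
      ext x
      simp only [k]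
      rw [← hI x]
      simp only [expFn, zero_mul, Complex.exp_zero, one_mul]
      linear_combination (Complex.exp (Complex.I * (z + Complex.I * β) * x) *
        gaussian ε x) * hfe x
    have e3 := hk (opFun D k h) a
    rw [sub_fermiOp_beta hD hβ.le, e1, e2] at e3
    exact e3.symm

theorem tendsto_gaussian (hD : IsSelfAdjoint D) (h : H) :
    Tendsto (fun ε => opFun D (gaussian ε) h) (𝓝[>] 0) (𝓝 h) := by
  have h1 := continuousOn_opFun_apply hD (F := gaussian) (C := 1) (s := Set.Ici 0)
    (by unfold gaussian; fun_prop) (fun ε hε x => by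
      rw [gaussian, Complex.norm_real, Real.norm_of_nonneg (Real.exp_pos _).le, Real.exp_le_one_iff]
      have : 0 ≤ ε := hε
      have := mul_nonneg this (sq_nonneg x)
      linarith) h 0 Set.self_mem_Ici
  have h2 : opFun D (gaussian 0) = 1 := by
    rw [← opFun_one hD]
    congr 1
    ext x
    simp [gaussian]
  rw [ContinuousWithinAt, h2] at h1
  exact h1.mono_left (nhdsWithin_mono _ Set.Ioi_subset_Ici_self)

theorem exists_entireKMS_near (hψ : IsCARAlgebra ψ) (hD : IsSelfAdjoint D) (hβ : 0 < β) (hω : IsState ω)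
    (hk : IsAlgKMS ψ (fermiOp D β β) ω) (b : 𝔄) : b ∈ closure {b | EntireKMS ψ D β ω b} := by
  let s : Set 𝔄 := {x | ∃ (ε : ℝ) (h : H), 0 < ε ∧ x = star (ψ (opFun D (gaussian ε) h))}
  have h1 : ∀ x ∈ StarAlgebra.adjoin ℂ s, EntireKMS ψ D β ω x := by
    intro x hx
    induction hx using StarAlgebra.adjoin_induction with
    | mem x hx =>
      obtain ⟨ε, h, hε, rfl⟩ := hx
      exact entireKMS_gaussian hψ hD hβ hk hε h
    | algebraMap c => exact entireKMS_algebraMap c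
    | add x y _ _ hx hy => exact hx.add hy
    | mul x y _ _ hx hy => exact hx.mul hy
    | star x _ hx => exact hx.star hω
  have h2 : (⊤ : StarSubalgebra ℂ 𝔄) ≤ (StarAlgebra.adjoin ℂ s).topologicalClosure := by
    rw [← hψ.generates]
    refine StarSubalgebra.topologicalClosure_minimal (StarAlgebra.adjoin_le ?_)
      (StarSubalgebra.isClosed_topologicalClosure _)
    rintro _ ⟨f, rfl⟩
    have h3 : star (ψ f) ∈ (StarAlgebra.adjoin ℂ s).topologicalClosure := by
      refine (StarSubalgebra.isClosed_topologicalClosure _).mem_of_tendsto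
        ((hψ.starL.continuous.tendsto f).comp (tendsto_gaussian hD f)) ?_
      filter_upwards [self_mem_nhdsWithin] with ε hε
      exact StarSubalgebra.le_topologicalClosure _ (StarAlgebra.subset_adjoin ℂ s ⟨ε, f, hε, rfl⟩)
    have := star_mem h3
    rwa [star_star] at this
  exact closure_mono (fun x hx => h1 x hx) (h2 (StarSubalgebra.mem_top (x := b)))

theorem norm_evolution (ψ : H →ₗ⋆[ℂ] 𝔄) (D : H →ₗ.[ℂ] H) (t : ℝ) (a : 𝔄) : ‖evolution ψ D t a‖ = ‖a‖ := by
  have := (StarAlgEquiv.isometry (evolution ψ D t)).norm_map_of_map_zero (map_zero _) a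
  exact this

/-- For entire u_n → b the functions ω(a B_n(z)) differ by at most ‖a‖‖u_n − u_m‖ on both edges,
hence on the whole strip. Their uniform limit is the KMS function of b. -/
theorem IsAlgKMS.isKMSState (hψ : IsCARAlgebra ψ) (hD : IsSelfAdjoint D) (hβ : 0 < β) (hω : IsState ω)
    (hk : IsAlgKMS ψ (fermiOp D β β) ω) : IsKMSState (evolution ψ D) β ω := by
  refine ⟨hω, fun a b => ?_⟩
  obtain ⟨u, hu, hlim⟩ := mem_closure_iff_seq_limit.mp (exists_entireKMS_near hψ hD hβ hω hk b)
  choose B h1 h2 h3 h4 using hu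
  choose C hC using h2
  have hω1 : ∀ x : 𝔄, ‖ω x‖ ≤ ‖x‖ := hω.norm_apply_le
  let F : ℕ → ℂ → ℂ := fun n z => ω (a * B n z)
  have hFd : ∀ n, Differentiable ℂ (F n) := fun n =>
    ω.differentiable.comp ((differentiable_const a).mul (h1 n))
  have hFt : ∀ n (t : ℝ), F n t = ω (a * evolution ψ D t (u n)) := fun n t => by
    simp only [F, h3]
  have hFb : ∀ n (t : ℝ), F n (t + Complex.I * β) = ω (evolution ψ D t (u n) * a) := fun n t => by
    simp only [F, h4, h3]
  have hdiff : ∀ n m (z : ℂ), 0 ≤ z.im → z.im ≤ β → ‖F n z - F m z‖ ≤ ‖a‖ * ‖u n - u m‖ := by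
    intro n m z hz0 hz1
    refine strip_norm_le (F := fun z => F n z - F m z) hβ
      ((hFd n).sub (hFd m)).continuous.continuousOn ((hFd n).sub (hFd m)).differentiableOn
      ⟨‖a‖ * C n + ‖a‖ * C m, fun w h0 h1 => ?_⟩ (fun t => ?_) (fun t => ?_) hz0 hz1
    · have hw : |w.im| ≤ β := abs_le.mpr ⟨by linarith, h1⟩
      refine (norm_sub_le _ _).trans (add_le_add ?_ ?_)
      · exact (hω1 _).trans ((norm_mul_le _ _).trans (by gcongr; exact hC n w hw))
      · exact (hω1 _).trans ((norm_mul_le _ _).trans (by gcongr; exact hC m w hw))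
    · rw [hFt, hFt, ← map_sub, ← mul_sub, ← map_sub]
      refine (hω1 _).trans ((norm_mul_le _ _).trans ?_)
      rw [norm_evolution]
    · rw [hFb, hFb, ← map_sub, ← sub_mul, ← map_sub]
      refine (hω1 _).trans ((norm_mul_le _ _).trans ?_)
      rw [norm_evolution, mul_comm]
  have hcauchy : UniformCauchySeqOn F atTop {z | 0 ≤ z.im ∧ z.im ≤ β} := by
    rw [Metric.uniformCauchySeqOn_iff]
    intro ε hε
    obtain ⟨N, hN⟩ := Metric.cauchySeq_iff.mp hlim.cauchySeq (ε / (‖a‖ + 1)) (by positivity)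
    refine ⟨N, fun m hm n hn z hz => ?_⟩
    rw [dist_eq_norm]
    refine (hdiff m n z hz.1 hz.2).trans_lt ?_
    have h5 := hN m hm n hn
    rw [dist_eq_norm, lt_div_iff₀ (by positivity)] at h5
    nlinarith [norm_nonneg (u m - u n), norm_nonneg a]
  have hex : ∀ z ∈ {z : ℂ | 0 ≤ z.im ∧ z.im ≤ β}, ∃ v, Tendsto (fun n => F n z) atTop (𝓝 v) := fun z hz =>
    cauchySeq_tendsto_of_complete (hcauchy.cauchySeq hz)
  choose! G hG using hex
  have hunif := hcauchy.tendstoUniformlyOn_of_tendsto hG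
  refine ⟨G, ?_, ?_, ⟨‖a‖ * C 0 + ‖a‖ * (‖u 0 - b‖), fun z hz0 hz1 => ?_⟩, fun t => ⟨?_, ?_⟩⟩
  · exact hunif.continuousOn (Frequently.of_forall fun n => (hFd n).continuous.continuousOn)
  · refine (hunif.mono fun z hz => ⟨hz.1.le, hz.2.le⟩).tendstoLocallyUniformlyOn.differentiableOn
      (Eventually.of_forall fun n => (hFd n).differentiableOn) ?_
    exact (isOpen_Ioo.preimage Complex.continuous_im)
  · have h5 : ‖F 0 z - G z‖ ≤ ‖a‖ * ‖u 0 - b‖ :=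
      le_of_tendsto_of_tendsto' ((tendsto_const_nhds.sub (hG z ⟨hz0, hz1⟩)).norm)
        ((tendsto_const_nhds.sub hlim).norm.const_mul _) fun n => hdiff 0 n z hz0 hz1
    have h6 : ‖F 0 z‖ ≤ ‖a‖ * C 0 := (hω1 _).trans ((norm_mul_le _ _).trans (by
      gcongr; exact hC 0 z (abs_le.mpr ⟨by linarith, hz1⟩)))
    have h7 := norm_sub_le (F 0 z) (F 0 z - G z)
    rw [sub_sub_cancel] at h7
    linarith
  · refine tendsto_nhds_unique (hG t ⟨by simp, by simpa using hβ.le⟩) ?_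
    simp only [hFt]
    exact (ω.continuous.tendsto _).comp (tendsto_const_nhds.mul
      (((starAlgEquiv_continuous (evolution ψ D t)).tendsto _).comp hlim))
  · refine tendsto_nhds_unique (hG (t + Complex.I * β) ⟨by simpa using hβ.le, by simp⟩) ?_
    simp only [hFb]
    exact (ω.continuous.tendsto _).comp (Tendsto.mul_const _
      (((starAlgEquiv_continuous (evolution ψ D t)).tendsto _).comp hlim))

/-- There is exactly one KMS state; it is the quasifree state with two-point function
`(1 + e^{-βD})⁻¹`. -/
theorem exists_kmsState (hψ : IsCARAlgebra ψ) (hD : IsSelfAdjoint D) (hβ : 0 < β) :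
    ∃ ω₀ : 𝔄 →L[ℂ] ℂ, (∀ ω, IsKMSState (evolution ψ D) β ω ↔ ω = ω₀) ∧ IsState ω₀ ∧
      IsAlgKMS ψ (fermiOp D β β) ω₀ ∧ IsQuasifree ψ (fermiOp D β β) ω₀ := by
  have hS := fermiOp_isSelfAdjoint (β := β) hD (s := β) ⟨hβ.le, le_rfl⟩
  obtain ⟨ω₀, hω, hk⟩ := exists_algKMS hψ hS (fermiOp_nonneg hD ⟨hβ.le, le_rfl⟩) (fermiOp_le hD hβ.le)
  refine ⟨ω₀, fun ω => ⟨fun h => ?_, ?_⟩, hω, hk, hk.isQuasifree hψ hS hω⟩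
  · exact (h.isAlgKMS hψ hD hβ).unique hψ hS h.1 hω hk
  · rintro rfl
    exact hk.isKMSState hψ hD hβ hω

end KMS

/-! ### Set partitions and ordered products. -/

section Combinatorics

variable {n : ℕ}

/-- Sums over partitions are organized by the block of a given element. -/
theorem sum_finpartition (f : Finset (Fin n) → ℂ) {S : Finset (Fin n)} {a : Fin n} (ha : a ∈ S) :
    ∑ P : Finpartition S, ∏ b ∈ P.parts, f b = ∑ T ∈ (S.erase a).powerset,
      f (insert a T) * ∑ P : Finpartition (S.erase a \ T), ∏ b ∈ P.parts, f b := by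
  simp only [Finset.mul_sum]
  rw [Finset.sum_sigma']
  symm
  have hsub : ∀ T ∈ (S.erase a).powerset, T ⊆ S ∧ a ∉ T := fun T hT => by
    have := Finset.mem_powerset.mp hT
    exact ⟨this.trans (Finset.erase_subset _ _), fun h => by simpa using this h⟩
  have hnot : ∀ T ∈ (S.erase a).powerset, ∀ P : Finpartition (S.erase a \ T), insert a T ∉ P.parts := by
    intro T hT P h
    have := P.subset h (Finset.mem_insert_self a T)
    simp at this
  have hnota : ∀ T, ∀ P : Finpartition (S.erase a \ T), ∀ b ∈ P.parts, a ∉ b := by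
    intro T P b h hab
    have := P.subset h hab
    simp at this
  refine Finset.sum_bij (fun x hx => Finpartition.extend (c := S) x.2 (b := insert a x.1)
    (Finset.insert_ne_empty _ _) ?_ ?_) ?_ ?_ ?_ ?_
  · rw [Finset.disjoint_left]
    intro y hy
    simp only [Finset.mem_sdiff, Finset.mem_erase] at hy
    simp [hy.1.1, hy.2]
  · have h1 := hsub x.1 (Finset.mem_sigma.mp hx).1
    ext y
    have := @h1.1 y
    by_cases hya : y = a
    · subst hya; simp [ha]
    · simp [hya]; tauto
  · intro x hx; exact Finset.mem_univ _
  · rintro ⟨T, P⟩ hT ⟨U, Q⟩ hU h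
    have hT := (Finset.mem_sigma.mp hT).1
    have hU := (Finset.mem_sigma.mp hU).1
    have h1 : insert (insert a T) P.parts = insert (insert a U) Q.parts := congrArg Finpartition.parts h
    have h2 : insert a T = insert a U := by
      have h3 : insert a T ∈ insert (insert a U) Q.parts := h1 ▸ Finset.mem_insert_self _ _
      rcases Finset.mem_insert.mp h3 with h3 | h3
      · exact h3
      · exact absurd (Finset.mem_insert_self a T) (hnota U Q _ h3)
    have h3 : T = U := by
      have := congrArg (fun X => X.erase a) h2
      simpa [Finset.erase_insert (hsub T hT).2, Finset.erase_insert (hsub U hU).2] using this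
    subst h3
    have h4 : P = Q := by
      ext1
      have := congrArg (fun X => X.erase (insert a T)) h1
      simpa [Finset.erase_insert (hnot T hT P), Finset.erase_insert (hnot T hT Q)] using this
    rw [h4]
  · intro P _
    have hp : P.part a ∈ P.parts := P.part_mem.mpr ha
    have hap : a ∈ P.part a := P.mem_part_self.mpr ha
    have hsup : (P.parts.erase (P.part a)).sup id = S.erase a \ (P.part a).erase a := by
      ext y
      rw [Finset.mem_sup]
      constructor
      · rintro ⟨b, hb, hyb⟩
        obtain ⟨hne, hb⟩ := Finset.mem_erase.mp hb
        have hyp : y ∉ P.part a := fun h => hne (P.eq_of_mem_parts hb hp hyb h)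
        simp only [Finset.mem_sdiff, Finset.mem_erase]
        exact ⟨⟨fun h => hyp (h ▸ hap), P.subset hb hyb⟩, fun h => hyp h.2⟩
      · intro h
        simp only [Finset.mem_sdiff, Finset.mem_erase, not_and] at h
        obtain ⟨b, hb, hyb⟩ := P.exists_mem h.1.2
        exact ⟨b, Finset.mem_erase.mpr ⟨fun e => h.2 h.1.1 (e ▸ hyb), hb⟩, hyb⟩
    refine ⟨⟨(P.part a).erase a, P.ofSubset (Finset.erase_subset _ _) hsup⟩, ?_, ?_⟩
    · refine Finset.mem_sigma.mpr ⟨?_, Finset.mem_univ _⟩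
      exact Finset.mem_powerset.mpr (Finset.erase_subset_erase _ (P.part_subset a))
    · ext1
      change insert (insert a ((P.part a).erase a)) (P.parts.erase (P.part a)) = P.parts
      rw [Finset.insert_erase hap, Finset.insert_erase hp]
  · rintro ⟨T, P⟩ hT
    have hT := (Finset.mem_sigma.mp hT).1
    change _ = ∏ b ∈ insert (insert a T) P.parts, f b
    rw [Finset.prod_insert (hnot T hT P)]

/-- A set with a marked element is an element together with a subset of the rest; the mark will be
the first vertex of a path. -/
theorem sum_powerset_choose (R : Finset (Fin n)) (h : Fin n → Finset (Fin n) → ℂ) :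
    ∑ T ∈ R.powerset, ∑ l ∈ T, h l (T.erase l) = ∑ l ∈ R, ∑ T ∈ (R.erase l).powerset, h l T := by
  rw [Finset.sum_sigma', Finset.sum_sigma']
  refine Finset.sum_bij' (fun x _ => ⟨x.2, x.1.erase x.2⟩) (fun x _ => ⟨insert x.1 x.2, x.1⟩) ?_ ?_ ?_ ?_ ?_
  · rintro ⟨T, l⟩ hx
    simp only [Finset.mem_sigma, Finset.mem_powerset] at hx ⊢
    exact ⟨hx.1 hx.2, Finset.erase_subset_erase _ hx.1⟩
  · rintro ⟨l, T⟩ hx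
    simp only [Finset.mem_sigma, Finset.mem_powerset] at hx ⊢
    exact ⟨Finset.insert_subset hx.1 (hx.2.trans (Finset.erase_subset _ _)), Finset.mem_insert_self _ _⟩
  · rintro ⟨T, l⟩ hx
    simp only [Finset.mem_sigma, Finset.mem_powerset] at hx
    simp [Finset.insert_erase hx.2]
  · rintro ⟨l, T⟩ hx
    simp only [Finset.mem_sigma, Finset.mem_powerset] at hx
    have : l ∉ T := fun h => by simpa using hx.2 h
    simp [Finset.erase_insert this]
  · rintro ⟨T, l⟩ hx
    rfl

/-- The product of the factors in `R`, in increasing order of the index. -/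
def ordProd {M : Type*} [Monoid M] (q : Fin n → M) (R : Finset (Fin n)) : M :=
  ((R.sort (· ≤ ·)).map q).prod

variable {M : Type*} [Monoid M] (q : Fin n → M)

theorem ordProd_empty : ordProd q ∅ = 1 := by simp [ordProd]

theorem ordProd_insert {R : Finset (Fin n)} {a : Fin n} (h : ∀ x ∈ R, a < x) :
    ordProd q (insert a R) = q a * ordProd q R := by
  rw [ordProd, Finset.sort_insert _ (fun b hb => (h b hb).le) (fun ha => lt_irrefl _ (h a ha))]
  simp [ordProd]

theorem ordProd_union {A B : Finset (Fin n)} (h : ∀ a ∈ A, ∀ b ∈ B, a < b) :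
    ordProd q (A ∪ B) = ordProd q A * ordProd q B := by
  induction A using Finset.induction_on_min with
  | empty => simp [ordProd_empty]
  | insert a A ha ih =>
    rw [Finset.insert_union, ordProd_insert, ordProd_insert _ ha, ih, mul_assoc]
    · exact fun x hx y hy => h x (Finset.mem_insert_of_mem hx) y hy
    · intro x hx
      rcases Finset.mem_union.mp hx with hx | hx
      · exact ha x hx
      · exact h a (Finset.mem_insert_self _ _) x hx

theorem ordProd_split {R : Finset (Fin n)} {j : Fin n} (hj : j ∉ R) :
    ordProd q (R.filter (· < j)) * ordProd q (R.filter (j < ·)) = ordProd q R := by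
  rw [← ordProd_union]
  · congr 1
    ext x
    have : x ∈ R → x ≠ j := fun h e => hj (e ▸ h)
    simp only [Finset.mem_union, Finset.mem_filter]
    constructor
    · rintro (h | h) <;> exact h.1
    · intro h
      rcases lt_or_gt_of_ne (this h) with h' | h'
      · exact Or.inl ⟨h, h'⟩
      · exact Or.inr ⟨h, h'⟩
  · intro a ha b hb
    exact (Finset.mem_filter.mp ha).2.trans (Finset.mem_filter.mp hb).2

theorem ordProd_eq_ofFn (S : Finset (Fin n)) :
    (List.ofFn fun i : Fin S.card => q (S.orderEmbOfFin rfl i)).prod = ordProd q S := by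
  rw [ordProd, ← S.listMap_orderEmbOfFin_finRange rfl, List.map_map, List.ofFn_eq_map]
  rfl

end Combinatorics

/-! ### Carrying a field through a product of quadratic elements. -/

section Quadratic

variable {H : Type*} [NormedAddCommGroup H] [InnerProductSpace ℂ H] [CompleteSpace H]
variable {𝔄 : Type*} [CStarAlgebra 𝔄] {ψ : H →ₗ⋆[ℂ] 𝔄} {S : H →L[ℂ] H} {ω : 𝔄 →L[ℂ] ℂ}
variable {J : Type*}

/-- The quadratic element `∑_p ψ(x_p) ψ(y_p)* + c`. -/
def quad (ψ : H →ₗ⋆[ℂ] 𝔄) (F : Finset J) (x y : J → H) (c : ℂ) : 𝔄 :=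
  ∑ p ∈ F, ψ (x p) * star (ψ (y p)) + c • 1

/-- The one-particle operator of `quad`. -/
def oneBody (F : Finset J) (x y : J → H) : H →L[ℂ] H :=
  ∑ p ∈ F, (innerSL ℂ (y p)).smulRight (x p)

theorem oneBody_apply (F : Finset J) (x y : J → H) (v : H) :
    oneBody F x y v = ∑ p ∈ F, ⟪y p, v⟫_ℂ • x p := by
  simp [oneBody]

theorem oneBody_inner (F : Finset J) (x y : J → H) (v w : H) :
    ⟪oneBody F x y v, w⟫_ℂ = ⟪v, oneBody F y x w⟫_ℂ := by
  rw [oneBody_apply, oneBody_apply, sum_inner, inner_sum]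
  refine Finset.sum_congr rfl fun p _ => ?_
  rw [inner_smul_left, inner_smul_right, inner_conj_symm]
  ring

/-- The commutator with a field is again a field. The path expansions below use quadratic elements
only through this relation. -/
theorem quad_mul (hψ : IsCARAlgebra ψ) (F : Finset J) (x y : J → H) (c : ℂ) (v : H) :
    quad ψ F x y c * ψ v = ψ v * quad ψ F x y c + ψ (oneBody F x y v) := by
  have h1 : ∀ p, ψ (x p) * star (ψ (y p)) * ψ v =
      ψ v * (ψ (x p) * star (ψ (y p))) + star (⟪y p, v⟫_ℂ) • ψ (x p) := by
    intro p
    rw [mul_assoc, hψ.star_mul_eq, mul_sub, mul_smul_comm, mul_one, ← mul_assoc, hψ.anticomm,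
      RCLike.star_def, inner_conj_symm, neg_mul, mul_assoc]
    abel
  rw [quad, oneBody_apply, add_mul, mul_add, Finset.sum_mul, Finset.mul_sum, map_sum]
  simp only [h1, Finset.sum_add_distrib, map_smulₛₗ, smul_mul_assoc, mul_smul_comm, one_mul, mul_one,
    RCLike.star_def]
  abel

theorem ordProd_mul_psi {n : ℕ} {q : Fin n → 𝔄} {A : Fin n → H →L[ℂ] H}
    (hq : ∀ l v, q l * ψ v = ψ v * q l + ψ (A l v)) (R : Finset (Fin n)) (v : H) :
    ordProd q R * ψ v = ψ v * ordProd q R + ∑ l ∈ R,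
      ordProd q (R.filter (· < l)) * ψ (A l v) * ordProd q (R.filter (l < ·)) := by
  induction R using Finset.induction_on_min with
  | empty => simp [ordProd_empty]
  | insert a R ha ih =>
    have haR : a ∉ R := fun h => lt_irrefl _ (ha a h)
    have e1 : (insert a R).filter (· < a) = ∅ := by
      ext x
      simp only [Finset.mem_filter, Finset.mem_insert, Finset.notMem_empty, iff_false, not_and, not_lt]
      rintro (rfl | h)
      · exact le_rfl
      · exact (ha x h).le
    have e2 : (insert a R).filter (a < ·) = R := by
      ext x
      simp only [Finset.mem_filter, Finset.mem_insert]
      constructor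
      · rintro ⟨rfl | h, h'⟩
        · exact absurd h' (lt_irrefl _)
        · exact h
      · exact fun h => ⟨Or.inr h, ha x h⟩
    have e3 : ∀ l ∈ R, (insert a R).filter (· < l) = insert a (R.filter (· < l)) := fun l hl => by
      rw [Finset.filter_insert, if_pos (ha l hl)]
    have e4 : ∀ l ∈ R, (insert a R).filter (l < ·) = R.filter (l < ·) := fun l hl => by
      rw [Finset.filter_insert, if_neg (ha l hl).le.not_gt]
    rw [ordProd_insert _ ha, Finset.sum_insert haR, e1, e2, ordProd_empty, one_mul, mul_assoc, ih, mul_add,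
      ← mul_assoc, hq, add_mul, Finset.mul_sum, mul_assoc, add_assoc]
    congr 2
    refine Finset.sum_congr rfl fun l hl => ?_
    rw [e3 l hl, e4 l hl, ordProd_insert _ fun x hx => ha x (Finset.mem_filter.mp hx).1]
    noncomm_ring

/-- `ψ(v)` inserted at position `j` into `ψ(g)* ∏_{l ∈ R} q_l`. -/
def insertedValue {n : ℕ} (ψ : H →ₗ⋆[ℂ] 𝔄) (ω : 𝔄 →L[ℂ] ℂ) (q : Fin n → 𝔄) (g : H) (R : Finset (Fin n))
    (j : Fin n) (v : H) : ℂ :=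
  ω (star (ψ g) * ordProd q (R.filter (· < j)) * ψ v * ordProd q (R.filter (j < ·)))

theorem insertedValue_neg {n : ℕ} (q : Fin n → 𝔄) (g : H) (R : Finset (Fin n)) (j : Fin n) (v : H) :
    insertedValue ψ ω q g R j (-v) = -insertedValue ψ ω q g R j v := by
  simp [insertedValue]

/-- Split v = (v − Sv) + Sv. The first part is moved to the left, past the factors with l < j and
ψ(g)*, and from the front to the end by the KMS property, where it is cancelled by the second part,
moved to the right. Each factor passed leaves a field inserted at its own place. -/
theorem insertedValue_eq (hψ : IsCARAlgebra ψ) (hω : IsState ω) (hk : IsAlgKMS ψ S ω) {n : ℕ}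
    {q : Fin n → 𝔄} {A : Fin n → H →L[ℂ] H} (hq : ∀ l v, q l * ψ v = ψ v * q l + ψ (A l v)) (g : H)
    {R : Finset (Fin n)} {j : Fin n} (hj : j ∉ R) (v : H) :
    insertedValue ψ ω q g R j v = ⟪v - S v, g⟫_ℂ * ω (ordProd q R) +
      ∑ l ∈ R, (if l < j then insertedValue ψ ω q g (R.erase l) l (A l (v - S v)) else
        -insertedValue ψ ω q g (R.erase l) l (A l (S v))) := by
  set P := ordProd q (R.filter (· < j)) with hP
  set Q := ordProd q (R.filter (j < ·)) with hQ
  have hPQ : P * Q = ordProd q R := ordProd_split q hj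
  have e1 : insertedValue ψ ω q g R j v =
      ω (star (ψ g) * (P * ψ (v - S v)) * Q) + ω (star (ψ g) * P * (ψ (S v) * Q)) := by
    rw [← map_add, insertedValue, ← hP, ← hQ]
    congr 1
    rw [map_sub]
    noncomm_ring
  have e2 : star (ψ g) * (P * ψ (v - S v)) * Q = ⟪v - S v, g⟫_ℂ • (P * Q) -
      ψ (v - S v) * (star (ψ g) * P * Q) + ∑ l ∈ R.filter (· < j), star (ψ g) *
        (ordProd q ((R.filter (· < j)).filter (· < l)) * ψ (A l (v - S v)) *
          ordProd q ((R.filter (· < j)).filter (l < ·))) * Q := by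
    rw [hP, ordProd_mul_psi hq, mul_add, ← mul_assoc, hψ.star_mul_eq, add_mul, Finset.mul_sum,
      Finset.sum_mul]
    congr 1
    rw [sub_mul, sub_mul, smul_mul_assoc, smul_mul_assoc, one_mul]
    simp only [mul_assoc]
  have e3 : ψ (S v) * Q = Q * ψ (S v) - ∑ l ∈ R.filter (j < ·),
      ordProd q ((R.filter (j < ·)).filter (· < l)) * ψ (A l (S v)) *
          ordProd q ((R.filter (j < ·)).filter (l < ·)) := by
    rw [hQ, ordProd_mul_psi hq, add_sub_cancel_right]
  rw [e1, e2, e3, map_add, map_sub, hk.left hω, mul_sub, map_sub, Finset.mul_sum, map_sum, map_sum,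
    map_smul, hPQ, smul_eq_mul]
  have e4 : R = R.filter (· < j) ∪ R.filter (j < ·) := by
    ext x
    have : x ∈ R → x ≠ j := fun h e => hj (e ▸ h)
    simp only [Finset.mem_union, Finset.mem_filter]
    constructor
    · intro h
      rcases lt_or_gt_of_ne (this h) with h' | h'
      · exact Or.inl ⟨h, h'⟩
      · exact Or.inr ⟨h, h'⟩
    · rintro (h | h) <;> exact h.1
  have hdisj : Disjoint (R.filter (· < j)) (R.filter (j < ·)) := by
    rw [Finset.disjoint_left]
    intro x hx hx'
    exact lt_asymm (Finset.mem_filter.mp hx).2 (Finset.mem_filter.mp hx').2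
  have e5 : ∀ h : Fin n → ℂ, ∑ l ∈ R, h l = ∑ l ∈ R.filter (· < j), h l + ∑ l ∈ R.filter (j < ·), h l := by
    intro h
    conv_lhs => rw [e4]
    rw [Finset.sum_union hdisj]
  rw [e5]
  have e6 : ∑ l ∈ R.filter (· < j), ω (star (ψ g) *
        (ordProd q ((R.filter (· < j)).filter (· < l)) * ψ (A l (v - S v)) *
          ordProd q ((R.filter (· < j)).filter (l < ·))) * Q) =
      ∑ l ∈ R.filter (· < j), (if l < j then insertedValue ψ ω q g (R.erase l) l (A l (v - S v)) else
        -insertedValue ψ ω q g (R.erase l) l (A l (S v))) := by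
    refine Finset.sum_congr rfl fun l hl => ?_
    have hlj := (Finset.mem_filter.mp hl).2
    rw [if_pos hlj, insertedValue]
    have f1 : (R.filter (· < j)).filter (· < l) = (R.erase l).filter (· < l) := by
      ext x
      simp only [Finset.mem_filter, Finset.mem_erase]
      constructor
      · rintro ⟨⟨h1, h2⟩, h3⟩; exact ⟨⟨h3.ne, h1⟩, h3⟩
      · rintro ⟨⟨h1, h2⟩, h3⟩; exact ⟨⟨h2, h3.trans hlj⟩, h3⟩
    have f2 : ordProd q ((R.filter (· < j)).filter (l < ·)) * Q = ordProd q ((R.erase l).filter (l < ·)) := by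
      rw [hQ, ← ordProd_union]
      · congr 1
        ext x
        simp only [Finset.mem_filter, Finset.mem_erase, Finset.mem_union]
        constructor
        · rintro (⟨⟨h1, h2⟩, h3⟩ | ⟨h1, h2⟩)
          · exact ⟨⟨h3.ne', h1⟩, h3⟩
          · exact ⟨⟨(hlj.trans h2).ne', h1⟩, hlj.trans h2⟩
        · rintro ⟨⟨h1, h2⟩, h3⟩
          have : x ≠ j := fun e => hj (e ▸ h2)
          rcases lt_or_gt_of_ne this with h' | h'
          · exact Or.inl ⟨⟨h2, h'⟩, h3⟩
          · exact Or.inr ⟨h2, h'⟩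
      · intro a ha b hb
        exact (Finset.mem_filter.mp (Finset.mem_filter.mp ha).1).2.trans (Finset.mem_filter.mp hb).2
    rw [← f2, f1]
    simp only [mul_assoc]
  have e7 : ∑ l ∈ R.filter (j < ·), ω (star (ψ g) * P *
        (ordProd q ((R.filter (j < ·)).filter (· < l)) * ψ (A l (S v)) *
          ordProd q ((R.filter (j < ·)).filter (l < ·)))) =
      -∑ l ∈ R.filter (j < ·), (if l < j then insertedValue ψ ω q g (R.erase l) l (A l (v - S v)) else
        -insertedValue ψ ω q g (R.erase l) l (A l (S v))) := by
    rw [← Finset.sum_neg_distrib]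
    refine Finset.sum_congr rfl fun l hl => ?_
    have hlj := (Finset.mem_filter.mp hl).2
    rw [if_neg hlj.le.not_gt, insertedValue, neg_neg]
    have f1 : (R.filter (j < ·)).filter (l < ·) = (R.erase l).filter (l < ·) := by
      ext x
      simp only [Finset.mem_filter, Finset.mem_erase]
      constructor
      · rintro ⟨⟨h1, h2⟩, h3⟩; exact ⟨⟨h3.ne', h1⟩, h3⟩
      · rintro ⟨⟨h1, h2⟩, h3⟩; exact ⟨⟨h2, hlj.trans h3⟩, h3⟩
    have f2 : P * ordProd q ((R.filter (j < ·)).filter (· < l)) = ordProd q ((R.erase l).filter (· < l)) := by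
      rw [hP, ← ordProd_union]
      · congr 1
        ext x
        simp only [Finset.mem_filter, Finset.mem_erase, Finset.mem_union]
        constructor
        · rintro (⟨h1, h2⟩ | ⟨⟨h1, h2⟩, h3⟩)
          · exact ⟨⟨(h2.trans hlj).ne, h1⟩, h2.trans hlj⟩
          · exact ⟨⟨h3.ne, h1⟩, h3⟩
        · rintro ⟨⟨h1, h2⟩, h3⟩
          have : x ≠ j := fun e => hj (e ▸ h2)
          rcases lt_or_gt_of_ne this with h' | h'
          · exact Or.inl ⟨h2, h'⟩
          · exact Or.inr ⟨⟨h2, h'⟩, h3⟩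
      · intro a ha b hb
        exact (Finset.mem_filter.mp ha).2.trans (Finset.mem_filter.mp (Finset.mem_filter.mp hb).1).2
    rw [← f2, f1]
    simp only [mul_assoc]
  rw [e6, e7]
  have e8 : ω (star (ψ g) * P * Q * ψ (S v)) = ω (star (ψ g) * P * (Q * ψ (S v))) := by
    rw [mul_assoc (star (ψ g) * P)]
  rw [e8]
  ring

/-- The vectors obtained by following paths through the vertices in `T`, which start at `j` and end
at `j₀`. -/
def pathVec {n : ℕ} (k : Fin n → Fin n → H →L[ℂ] H) (B : Fin n → H →L[ℂ] H) (j₀ : Fin n) (g : H) :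
    ℕ → Finset (Fin n) → Fin n → H
  | 0, _, j => k j j₀ g
  | m + 1, T, j => -∑ l ∈ T, k j l (B l (pathVec k B j₀ g m (T.erase l) l))

/-- The path sums are expanded by the first vertex l after j. Symmetry of k and the adjoint pair A,
B move the first edge to the other side of the inner product. -/
theorem sum_pathVec {n : ℕ} {k : Fin n → Fin n → H →L[ℂ] H} {A B : Fin n → H →L[ℂ] H}
    (hk : ∀ i j v w, ⟪k i j v, w⟫_ℂ = ⟪v, k i j w⟫_ℂ) (hAB : ∀ l v w, ⟪A l v, w⟫_ℂ = ⟪v, B l w⟫_ℂ)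
    (j₀ : Fin n) (g : H) (w : Finset (Fin n) → ℂ) (R : Finset (Fin n)) (j : Fin n) (v : H) :
    ∑ T ∈ R.powerset, ⟪v, pathVec k B j₀ g T.card T j⟫_ℂ * w (R \ T) =
      ⟪v, k j j₀ g⟫_ℂ * w R - ∑ l ∈ R, ∑ T ∈ (R.erase l).powerset,
        ⟪A l (k j l v), pathVec k B j₀ g T.card T l⟫_ℂ * w (R.erase l \ T) := by
  have h1 : ∀ T ∈ R.powerset, ⟪v, pathVec k B j₀ g T.card T j⟫_ℂ * w (R \ T) =
      (if T = ∅ then ⟪v, k j j₀ g⟫_ℂ * w R else 0) - ∑ l ∈ T,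
        ⟪A l (k j l v), pathVec k B j₀ g (T.erase l).card (T.erase l) l⟫_ℂ *
          w (R.erase l \ T.erase l) := by
    intro T hT
    by_cases hT0 : T = ∅
    · simp [hT0, pathVec]
    · obtain ⟨m, hm⟩ : ∃ m, T.card = m + 1 :=
        Nat.exists_eq_succ_of_ne_zero (Finset.card_ne_zero_of_mem (Finset.nonempty_iff_ne_empty.mpr hT0).choose_spec)
      rw [if_neg hT0, hm, pathVec, inner_neg_right, inner_sum, zero_sub, neg_mul, Finset.sum_mul]
      congr 1
      refine Finset.sum_congr rfl fun l hl => ?_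
      have h2 : R.erase l \ T.erase l = R \ T := by
        ext x
        simp only [Finset.mem_sdiff, Finset.mem_erase]
        by_cases hx : x = l
        · subst hx; simp [hl]
        · simp [hx]
      rw [h2, Finset.card_erase_of_mem hl, hm, Nat.add_sub_cancel, hAB, hk]
  rw [Finset.sum_congr rfl h1, Finset.sum_sub_distrib, sum_powerset_choose R
    (fun l T => ⟪A l (k j l v), pathVec k B j₀ g T.card T l⟫_ℂ * w (R.erase l \ T))]
  congr 1
  rw [Finset.sum_ite_eq' R.powerset ∅]
  simp

/-- The time-ordered propagator at coinciding times. -/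
def staticKernel (S : H →L[ℂ] H) {n : ℕ} (i j : Fin n) : H →L[ℂ] H := if i ≤ j then S else -(1 - S)

/-- Both sides satisfy the same recursion in R: the two cases l < j and l ≥ j of moving left or
right are the two branches of the propagator. -/
theorem insertedValue_eq_sum (hψ : IsCARAlgebra ψ) (hS : IsSelfAdjoint S) (hω : IsState ω)
    (hk : IsAlgKMS ψ S ω) {n : ℕ} {q : Fin n → 𝔄} {A B : Fin n → H →L[ℂ] H}
    (hq : ∀ l v, q l * ψ v = ψ v * q l + ψ (A l v)) (hAB : ∀ l v w, ⟪A l v, w⟫_ℂ = ⟪v, B l w⟫_ℂ)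
    {j₀ : Fin n} (g : H) {R : Finset (Fin n)} (hR : ∀ l ∈ R, j₀ < l) {j : Fin n} (hj : j ∉ R)
    (hj₀ : j₀ < j) (v : H) :
    -insertedValue ψ ω q g R j v = ∑ T ∈ R.powerset,
      ⟪v, pathVec (staticKernel S) B j₀ g T.card T j⟫_ℂ * ω (ordProd q (R \ T)) := by
  have hsymm : ∀ x y : H, ⟪S x, y⟫_ℂ = ⟪x, S y⟫_ℂ := fun x y => by
    rw [← ContinuousLinearMap.adjoint_inner_right, hS.adjoint_eq]
  have hker : ∀ (i j : Fin n) v w, ⟪staticKernel S i j v, w⟫_ℂ = ⟪v, staticKernel S i j w⟫_ℂ := by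
    intro i j v w
    unfold staticKernel
    split_ifs
    · exact hsymm v w
    · simp [hsymm]
  induction hm : R.card generalizing R j v with
  | zero =>
    rw [Finset.card_eq_zero] at hm
    subst hm
    rw [insertedValue_eq hψ hω hk hq g hj]
    have : ¬ j ≤ j₀ := hj₀.not_ge
    simp [pathVec, staticKernel, this, ordProd_empty, hω.1, hsymm]
  | succ m ih =>
    rw [insertedValue_eq hψ hω hk hq g hj, sum_pathVec hker hAB j₀ g (fun R => ω (ordProd q R)), neg_add,
      ← Finset.sum_neg_distrib, sub_eq_add_neg (_ * ω (ordProd q R)), ← Finset.sum_neg_distrib]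
    congr 1
    · rw [staticKernel, if_neg hj₀.not_ge, ← neg_mul]
      congr 1
      simp [hsymm]
    · refine Finset.sum_congr rfl fun l hl => ?_
      rw [← ih (R := R.erase l) (fun x hx => hR x (Finset.mem_of_mem_erase hx)) (Finset.notMem_erase l R)
        (hR l hl) _ (by rw [Finset.card_erase_of_mem hl, hm]; rfl)]
      unfold staticKernel
      by_cases h : l < j
      · have e1 : (-(1 - S)) v = -(v - S v) := rfl
        rw [if_pos h, if_neg h.not_ge, e1, map_neg, insertedValue_neg, neg_neg]
      · have h' : j ≤ l := not_lt.mp h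
        rw [if_neg h, if_pos h']

/-- Anticommuting ψ(f) past ψ(g)* leaves a field inserted at j₀. The extra ⟨f, g⟩ changes ⟨f − Sf,
g⟩ into ⟨Sf, g⟩, the propagator at coinciding arguments. -/
theorem omega_pair_ordProd (hψ : IsCARAlgebra ψ) (hS : IsSelfAdjoint S) (hω : IsState ω)
    (hk : IsAlgKMS ψ S ω) {n : ℕ} {q : Fin n → 𝔄} {A B : Fin n → H →L[ℂ] H}
    (hq : ∀ l v, q l * ψ v = ψ v * q l + ψ (A l v)) (hAB : ∀ l v w, ⟪A l v, w⟫_ℂ = ⟪v, B l w⟫_ℂ)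
    {j₀ : Fin n} (f g : H) {R : Finset (Fin n)} (hR : ∀ l ∈ R, j₀ < l) :
    ω (ψ f * star (ψ g) * ordProd q R) = ∑ T ∈ R.powerset,
      ⟪f, pathVec (staticKernel S) B j₀ g T.card T j₀⟫_ℂ * ω (ordProd q (R \ T)) := by
  have hsymm : ∀ x y : H, ⟪S x, y⟫_ℂ = ⟪x, S y⟫_ℂ := fun x y => by
    rw [← ContinuousLinearMap.adjoint_inner_right, hS.adjoint_eq]
  have hker : ∀ (i j : Fin n) v w, ⟪staticKernel S i j v, w⟫_ℂ = ⟪v, staticKernel S i j w⟫_ℂ := by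
    intro i j v w
    unfold staticKernel
    split_ifs
    · exact hsymm v w
    · simp [hsymm]
  have hj : j₀ ∉ R := fun h => lt_irrefl _ (hR _ h)
  have e0 : R.filter (· < j₀) = ∅ := by
    ext x
    simp only [Finset.mem_filter, Finset.notMem_empty, iff_false, not_and, not_lt]
    exact fun h => (hR x h).le
  have e1 : R.filter (j₀ < ·) = R := Finset.filter_true_of_mem hR
  have e2 : ω (ψ f * star (ψ g) * ordProd q R) =
      ⟪f, g⟫_ℂ * ω (ordProd q R) - insertedValue ψ ω q g R j₀ f := by
    rw [insertedValue, e0, e1, ordProd_empty, mul_one, eq_sub_of_add_eq (hψ.anticomm_star f g), sub_mul,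
      map_sub, smul_mul_assoc, one_mul, map_smul, smul_eq_mul]
  rw [e2, insertedValue_eq hψ hω hk hq g hj, sum_pathVec hker hAB j₀ g (fun R => ω (ordProd q R)),
    ← sub_sub, ← sub_mul, ← inner_sub_left, sub_sub_cancel, hsymm]
  congr 1
  · simp [staticKernel]
  · refine Finset.sum_congr rfl fun l hl => ?_
    rw [← insertedValue_eq_sum hψ hS hω hk hq hAB (R := R.erase l) g
      (fun x hx => hR x (Finset.mem_of_mem_erase hx)) (Finset.notMem_erase l R) (hR l hl),
      if_neg (hR l hl).not_gt]
    simp [staticKernel, (hR l hl).le]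

end Quadratic

/-! ### Connected functions as sums over closed paths. -/

section Connected

variable {H : Type*} [NormedAddCommGroup H] [InnerProductSpace ℂ H] [CompleteSpace H]
variable {𝔄 : Type*} [CStarAlgebra 𝔄] {ψ : H →ₗ⋆[ℂ] 𝔄} {S : H →L[ℂ] H} {ω : 𝔄 →L[ℂ] ℂ}
variable {D : H →ₗ.[ℂ] H} {β : ℝ} {J : Type*} {n : ℕ}

/-- The connected function of `q_a` and the `q_l`, `l ∈ T`, for `a < T`. -/
def connAt (k : Fin n → Fin n → H →L[ℂ] H) (F : Fin n → Finset J) (x y : Fin n → J → H) (c : Fin n → ℂ)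
    (a : Fin n) (T : Finset (Fin n)) : ℂ :=
  ∑ p ∈ F a, ⟪x a p, pathVec k (fun l => oneBody (F l) (y l) (x l)) a (y a p) T.card T a⟫_ℂ +
    if T = ∅ then c a else 0

/-- The connected functions of quadratic elements, with propagator `k`. -/
def conn (k : Fin n → Fin n → H →L[ℂ] H) (F : Fin n → Finset J) (x y : Fin n → J → H) (c : Fin n → ℂ)
    (b : Finset (Fin n)) : ℂ :=
  if h : b.Nonempty then connAt k F x y c (b.min' h) (b.erase (b.min' h)) else 0

theorem conn_insert (k : Fin n → Fin n → H →L[ℂ] H) (F : Fin n → Finset J) (x y : Fin n → J → H)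
    (c : Fin n → ℂ) {a : Fin n} {T : Finset (Fin n)} (hT : ∀ l ∈ T, a < l) :
    conn k F x y c (insert a T) = connAt k F x y c a T := by
  have h : (insert a T).Nonempty := Finset.insert_nonempty a T
  have h1 : (insert a T).min' h = a := by
    refine le_antisymm (Finset.min'_le _ _ (Finset.mem_insert_self _ _)) (Finset.le_min' _ _ _ fun l hl => ?_)
    rcases Finset.mem_insert.mp hl with rfl | hl
    · exact le_rfl
    · exact (hT l hl).le
  rw [conn, dif_pos h, h1, Finset.erase_insert fun ha => lt_irrefl _ (hT a ha)]

/-- Let a be the first factor. Its closed paths pass through some set T of other factors, and the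
remaining factors appear as a correlation function of their own; this is the recursion of the sum
over partitions by the block {a} ∪ T. -/
theorem omega_ordProd_quad (hψ : IsCARAlgebra ψ) (hS : IsSelfAdjoint S) (hω : IsState ω)
    (hk : IsAlgKMS ψ S ω) (F : Fin n → Finset J) (x y : Fin n → J → H) (c : Fin n → ℂ)
    (R : Finset (Fin n)) :
    ω (ordProd (fun l => quad ψ (F l) (x l) (y l) (c l)) R) =
      ∑ P : Finpartition R, ∏ b ∈ P.parts, conn (staticKernel S) F x y c b := by
  induction hm : R.card using Nat.strong_induction_on generalizing R with
  | _ m ih =>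
    rcases R.eq_empty_or_nonempty with rfl | hne
    · rw [ordProd_empty, hω.1]
      have hu : ∀ P : Finpartition (∅ : Finset (Fin n)), P.parts = ∅ := fun P =>
        P.parts_eq_empty_iff.mpr rfl
      simp only [hu, Finset.prod_empty, Finset.sum_const, Finset.card_univ, nsmul_eq_mul, mul_one]
      have : Fintype.card (Finpartition (∅ : Finset (Fin n))) = 1 := by
        refine Fintype.card_eq_one_iff.mpr ⟨⊥, fun P => ?_⟩
        ext1
        rw [hu, hu]
      rw [this, Nat.cast_one]
    · set a := R.min' hne with ha
      have haR : a ∈ R := R.min'_mem hne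
      have hlt : ∀ l ∈ R.erase a, a < l := fun l hl => R.min'_lt_of_mem_erase_min' hne hl
      have hcard : (R.erase a).card < m := by
        rw [← hm]; exact Finset.card_erase_lt_of_mem haR
      rw [sum_finpartition _ haR]
      conv_lhs => rw [← Finset.insert_erase haR, ordProd_insert _ hlt, quad, add_mul, map_add,
        Finset.sum_mul, map_sum, smul_mul_assoc, one_mul, map_smul]
      have h1 : ∀ p ∈ F a, ω (ψ (x a p) * star (ψ (y a p)) *
          ordProd (fun l => quad ψ (F l) (x l) (y l) (c l)) (R.erase a)) =
          ∑ T ∈ (R.erase a).powerset, ⟪x a p, pathVec (staticKernel S) (fun l => oneBody (F l) (y l) (x l))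
            a (y a p) T.card T a⟫_ℂ * ω (ordProd (fun l => quad ψ (F l) (x l) (y l) (c l)) (R.erase a \ T)) :=
        fun p _ => omega_pair_ordProd hψ hS hω hk (fun l v => quad_mul hψ _ _ _ _ v)
          (fun l v w => oneBody_inner _ _ _ v w) _ _ hlt
      rw [Finset.sum_congr rfl h1, Finset.sum_comm]
      have h2 : ∀ T ∈ (R.erase a).powerset, conn (staticKernel S) F x y c (insert a T) *
          ∑ P : Finpartition (R.erase a \ T), ∏ b ∈ P.parts, conn (staticKernel S) F x y c b =
          ∑ p ∈ F a, ⟪x a p, pathVec (staticKernel S) (fun l => oneBody (F l) (y l) (x l))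
            a (y a p) T.card T a⟫_ℂ * ω (ordProd (fun l => quad ψ (F l) (x l) (y l) (c l)) (R.erase a \ T)) +
          if T = ∅ then c a * ω (ordProd (fun l => quad ψ (F l) (x l) (y l) (c l)) (R.erase a \ T)) else 0 := by
        intro T hT
        have hT := Finset.mem_powerset.mp hT
        rw [conn_insert _ _ _ _ _ fun l hl => hlt l (hT hl), connAt, ← ih _ ((Finset.card_le_card
          Finset.sdiff_subset).trans_lt hcard) _ rfl, add_mul, Finset.sum_mul, ite_mul, zero_mul]
      rw [Finset.sum_congr rfl h2, Finset.sum_add_distrib, Finset.sum_ite_eq' _ (∅ : Finset (Fin n))]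
      simp

/-- The time-ordered propagator at complex times. -/
def timeKernel (D : H →ₗ.[ℂ] H) (β : ℝ) (z : Fin n → ℂ) (i j : Fin n) : H →L[ℂ] H :=
  if i ≤ j then fermiOp D β (β + Complex.I * (z j - z i)) else -fermiOp D β (Complex.I * (z j - z i))

theorem unitaryGroup_comm_fermiOp (hD : IsSelfAdjoint D) (s t : ℝ) {z : ℂ} (hz : z.re ∈ Set.Icc 0 β) (v : H) :
    fermiOp D β z (unitaryGroup D t v) = unitaryGroup D s (fermiOp D β (z + Complex.I * (t - s)) v) := by
  have h1 : fermiOp D β z * unitaryGroup D t = unitaryGroup D s * fermiOp D β (z + Complex.I * (t - s)) := by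
    have hz' : (z + Complex.I * (t - s)).re ∈ Set.Icc 0 β := by simpa using hz
    rw [unitaryGroup_fermiOp hD s hz', unitaryGroup, fermiOp, fermiOp,
      ← opFun_mul hD ((expBdd_fermi β).bddCont hz) (bddCont_unitary t)]
    congr 1
    ext x
    rw [expFn, expFn, mul_right_comm, ← Complex.exp_add]
    ring_nf
  exact congrArg (fun A : H →L[ℂ] H => A v) h1

theorem staticKernel_unitaryGroup (hD : IsSelfAdjoint D) (hβ : 0 < β) (s : Fin n → ℝ) (i j : Fin n) (v : H) :
    staticKernel (fermiOp D β β) i j (unitaryGroup D (s j) v) =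
      unitaryGroup D (s i) (timeKernel D β (fun l => (s l : ℂ)) i j v) := by
  unfold staticKernel timeKernel
  split_ifs
  · exact unitaryGroup_comm_fermiOp hD _ _ (by simpa using hβ.le) v
  · rw [_root_.neg_apply, _root_.neg_apply, map_neg, _root_.sub_apply, one_apply_eq_self,
      sub_fermiOp_beta hD hβ.le, unitaryGroup_comm_fermiOp hD (s i) (s j) (by simpa using hβ.le) v, zero_add]

theorem oneBody_unitaryGroup (hD : IsSelfAdjoint D) (t : ℝ) (F : Finset J) (x y : J → H) (v : H) :
    oneBody F (fun p => unitaryGroup D t (x p)) (fun p => unitaryGroup D t (y p)) (unitaryGroup D t v) =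
      unitaryGroup D t (oneBody F x y v) := by
  rw [oneBody_apply, oneBody_apply, map_sum]
  simp only [unitaryGroup_inner hD, map_smul]

/-- The evolutions at the vertices are shifted into the propagators, which then depend on time
differences, and telescope along the path. -/
theorem pathVec_unitaryGroup (hD : IsSelfAdjoint D) (hβ : 0 < β) (s : Fin n → ℝ) (F : Fin n → Finset J)
    (x y : Fin n → J → H) (j₀ : Fin n) (g : H) (m : ℕ) (T : Finset (Fin n)) (j : Fin n) :
    pathVec (staticKernel (fermiOp D β β)) (fun l => oneBody (F l) (fun p => unitaryGroup D (s l) (y l p))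
      (fun p => unitaryGroup D (s l) (x l p))) j₀ (unitaryGroup D (s j₀) g) m T j =
    unitaryGroup D (s j) (pathVec (timeKernel D β (fun l => (s l : ℂ)))
      (fun l => oneBody (F l) (y l) (x l)) j₀ g m T j) := by
  induction m generalizing T j with
  | zero => exact staticKernel_unitaryGroup hD hβ s j j₀ g
  | succ m ih =>
    rw [pathVec, pathVec, map_neg, map_sum]
    congr 1
    refine Finset.sum_congr rfl fun l _ => ?_
    rw [ih, oneBody_unitaryGroup hD, staticKernel_unitaryGroup hD hβ]

theorem conn_unitaryGroup (hD : IsSelfAdjoint D) (hβ : 0 < β) (s : Fin n → ℝ) (F : Fin n → Finset J)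
    (x y : Fin n → J → H) (c : Fin n → ℂ) (b : Finset (Fin n)) :
    conn (staticKernel (fermiOp D β β)) F (fun l p => unitaryGroup D (s l) (x l p))
      (fun l p => unitaryGroup D (s l) (y l p)) c b =
    conn (timeKernel D β (fun l => (s l : ℂ))) F x y c b := by
  unfold conn connAt
  split_ifs with h1 h2 <;> first | rfl | skip
  all_goals
    congr 1
    refine Finset.sum_congr rfl fun p _ => ?_
    rw [pathVec_unitaryGroup hD hβ s F x y, unitaryGroup_inner hD]

theorem evolution_quad (hψ : IsCARAlgebra ψ) (hD : IsSelfAdjoint D) (t : ℝ) (F : Finset J) (x y : J → H)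
    (c : ℂ) : evolution ψ D t (quad ψ F x y c) =
      quad ψ F (fun p => unitaryGroup D t (x p)) (fun p => unitaryGroup D t (y p)) c := by
  simp only [quad, map_add, map_sum, map_mul, evolution_star hψ hD, evolution_apply hψ hD, map_smul, map_one]

/-- Wick's theorem for quadratic elements at real times. -/
theorem omega_evolution_quad (hψ : IsCARAlgebra ψ) (hD : IsSelfAdjoint D) (hβ : 0 < β) (hω : IsState ω)
    (hk : IsAlgKMS ψ (fermiOp D β β) ω) (F : Fin n → Finset J) (x y : Fin n → J → H) (c : Fin n → ℂ)
    (s : Fin n → ℝ) (R : Finset (Fin n)) :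
    ω (ordProd (fun l => evolution ψ D (s l) (quad ψ (F l) (x l) (y l) (c l))) R) =
      ∑ P : Finpartition R, ∏ b ∈ P.parts, conn (timeKernel D β (fun l => (s l : ℂ))) F x y c b := by
  simp only [evolution_quad hψ hD]
  rw [omega_ordProd_quad hψ (fermiOp_isSelfAdjoint hD ⟨hβ.le, le_rfl⟩) hω hk]
  simp only [conn_unitaryGroup hD hβ]

/-- Only the times in `T` and those of the end points matter. -/
theorem pathVec_timeKernel_congr {z z' : Fin n → ℂ} (B : Fin n → H →L[ℂ] H) {j₀ : Fin n} (g : H) (m : ℕ)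
    {T : Finset (Fin n)} (hT : ∀ l ∈ T, z l = z' l) (h0 : z j₀ = z' j₀) {j : Fin n} (hj : z j = z' j) :
    pathVec (timeKernel D β z) B j₀ g m T j = pathVec (timeKernel D β z') B j₀ g m T j := by
  have hk : ∀ i l, z i = z' i → z l = z' l → timeKernel D β z i l = timeKernel D β z' i l := by
    intro i l h1 h2
    rw [timeKernel, timeKernel, h1, h2]
  induction m generalizing T j with
  | zero => rw [pathVec, pathVec, hk _ _ hj h0]
  | succ m ih =>
    rw [pathVec, pathVec]
    congr 1
    refine Finset.sum_congr rfl fun l hl => ?_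
    rw [ih (fun x hx => hT x (Finset.mem_of_mem_erase hx)) (hT l hl), hk _ _ hj (hT l hl)]

theorem conn_timeKernel_congr {z z' : Fin n → ℂ} (F : Fin n → Finset J) (x y : Fin n → J → H)
    (c : Fin n → ℂ) {b : Finset (Fin n)} (h : ∀ l ∈ b, z l = z' l) :
    conn (timeKernel D β z) F x y c b = conn (timeKernel D β z') F x y c b := by
  unfold conn connAt
  split_ifs with h1 h2 <;> first | rfl | skip
  all_goals
    congr 1
    refine Finset.sum_congr rfl fun p _ => ?_
    rw [pathVec_timeKernel_congr _ _ _ (fun l hl => h l (Finset.mem_of_mem_erase hl))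
      (h _ (b.min'_mem h1)) (h _ (b.min'_mem h1))]

end Connected

/-! ### Analytic continuation to the tube. -/

section Tube

/-- The closed tube for the times with index in `S`. -/
def closedTube {n : ℕ} (β : ℝ) (S : Finset (Fin n)) : Set (Fin n → ℂ) :=
  {z | ∀ i ∈ S, ∀ j ∈ S, i ≤ j → (z i).im ≤ (z j).im ∧ (z j).im ≤ (z i).im + β}

/-- The open tube for the times with index in `S`. -/
def openTube {n : ℕ} (β : ℝ) (S : Finset (Fin n)) : Set (Fin n → ℂ) :=
  {z | ∀ i ∈ S, ∀ j ∈ S, i < j → (z i).im < (z j).im ∧ (z j).im < (z i).im + β}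

/-- Bounded continuous functions on the closed tube which are holomorphic in its interior. -/
def TubeHolo {n : ℕ} (β : ℝ) (S : Finset (Fin n)) {E : Type*} [NormedAddCommGroup E] [NormedSpace ℂ E]
    (X : (Fin n → ℂ) → E) : Prop :=
  ContinuousOn X (closedTube β S) ∧ DifferentiableOn ℂ X (openTube β S) ∧
    ∃ C, ∀ z ∈ closedTube β S, ‖X z‖ ≤ C

variable {n : ℕ} {β : ℝ} {S : Finset (Fin n)} {E : Type*} [NormedAddCommGroup E] [NormedSpace ℂ E]

theorem tubeHolo_const (v : E) : TubeHolo β S (fun _ => v) :=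
  ⟨continuousOn_const, differentiableOn_const _, ‖v‖, fun _ _ => le_rfl⟩

theorem TubeHolo.add {X Y : (Fin n → ℂ) → E} (hX : TubeHolo β S X) (hY : TubeHolo β S Y) :
    TubeHolo β S (fun z => X z + Y z) := by
  obtain ⟨h1, h2, C, h3⟩ := hX
  obtain ⟨h1', h2', C', h3'⟩ := hY
  exact ⟨h1.add h1', h2.add h2', C + C', fun z hz =>
    (norm_add_le _ _).trans (add_le_add (h3 z hz) (h3' z hz))⟩

theorem TubeHolo.sum {ι : Type*} (s : Finset ι) {X : ι → (Fin n → ℂ) → E}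
    (hX : ∀ i ∈ s, TubeHolo β S (X i)) : TubeHolo β S (fun z => ∑ i ∈ s, X i z) := by
  classical
  induction s using Finset.induction_on with
  | empty => simpa using tubeHolo_const (0 : E)
  | insert i s hi ih =>
    simp only [Finset.sum_insert hi]
    exact (hX i (Finset.mem_insert_self _ _)).add (ih fun j hj => hX j (Finset.mem_insert_of_mem hj))

theorem TubeHolo.mul {X Y : (Fin n → ℂ) → ℂ} (hX : TubeHolo β S X) (hY : TubeHolo β S Y) :
    TubeHolo β S (fun z => X z * Y z) := by
  obtain ⟨h1, h2, C, h3⟩ := hX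
  obtain ⟨h1', h2', C', h3'⟩ := hY
  exact ⟨h1.mul h1', h2.mul h2', C * C', fun z hz => (norm_mul_le _ _).trans
    (mul_le_mul (h3 z hz) (h3' z hz) (norm_nonneg _) ((norm_nonneg _).trans (h3 z hz)))⟩

theorem TubeHolo.prod {ι : Type*} (s : Finset ι) {X : ι → (Fin n → ℂ) → ℂ}
    (hX : ∀ i ∈ s, TubeHolo β S (X i)) : TubeHolo β S (fun z => ∏ i ∈ s, X i z) := by
  classical
  induction s using Finset.induction_on with
  | empty => simpa using tubeHolo_const (1 : ℂ)
  | insert i s hi ih =>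
    simp only [Finset.prod_insert hi]
    exact (hX i (Finset.mem_insert_self _ _)).mul (ih fun j hj => hX j (Finset.mem_insert_of_mem hj))

theorem TubeHolo.clm {G : Type*} [NormedAddCommGroup G] [NormedSpace ℂ G] {X : (Fin n → ℂ) → E}
    (hX : TubeHolo β S X) (L : E →L[ℂ] G) : TubeHolo β S (fun z => L (X z)) := by
  obtain ⟨h1, h2, C, h3⟩ := hX
  exact ⟨L.continuous.comp_continuousOn h1, L.differentiable.comp_differentiableOn h2, ‖L‖ * C, fun z hz =>
    (L.le_opNorm _).trans (by gcongr; exact h3 z hz)⟩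

variable {H : Type*} [NormedAddCommGroup H] [InnerProductSpace ℂ H] [CompleteSpace H]
variable {D : H →ₗ.[ℂ] H} {J : Type*}

/-- At the edges of the strip the operators are only strongly continuous; together with the bound 1
this suffices when they act on vector-valued functions. -/
theorem TubeHolo.fermiOp {X : (Fin n → ℂ) → H} (hD : IsSelfAdjoint D) (hX : TubeHolo β S X)
    {w : (Fin n → ℂ) → ℂ} (hwd : Differentiable ℂ w) (hw : ∀ z ∈ closedTube β S, (w z).re ∈ Set.Icc 0 β)
    (hw' : ∀ z ∈ openTube β S, (w z).re ∈ Set.Ioo 0 β) :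
    TubeHolo β S (fun z => FermiKMS.fermiOp D β (w z) (X z)) := by
  obtain ⟨h1, h2, C, h3⟩ := hX
  refine ⟨?_, fun z hz => ?_, C, fun z hz => ?_⟩
  · refine continuousOn_clm_apply (A := fun z => FermiKMS.fermiOp D β (w z)) (h := X) (C := 1) (fun v => ?_)
      (fun z hz => norm_fermiOp_le hD (hw z hz)) h1
    exact (continuousOn_fermiOp_apply hD v).comp hwd.continuous.continuousOn hw
  · have e1 : DifferentiableAt ℂ (fun z => FermiKMS.fermiOp D β (w z)) z :=
      DifferentiableAt.comp (g := FermiKMS.fermiOp D β) z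
        (hasDerivAt_fermiOp hD (hw' z hz)).differentiableAt (hwd z)
    exact e1.differentiableWithinAt.clm_apply (h2 z hz)
  · refine ((FermiKMS.fermiOp D β (w z)).le_opNorm _).trans ?_
    exact (mul_le_of_le_one_left (norm_nonneg _) (norm_fermiOp_le hD (hw z hz))).trans (h3 z hz)

theorem TubeHolo.timeKernel {X : (Fin n → ℂ) → H} (hD : IsSelfAdjoint D) (hX : TubeHolo β S X)
    {i j : Fin n} (hi : i ∈ S) (hj : j ∈ S) :
    TubeHolo β S (fun z => FermiKMS.timeKernel D β z i j (X z)) := by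
  unfold FermiKMS.timeKernel
  split_ifs with hij
  -- For equal indices the exponent is constantly β, on the edge of the strip, and the operator does
  -- not depend on z.
  · rcases hij.eq_or_lt with rfl | hij
    · simp only [sub_self, mul_zero, add_zero]
      exact hX.clm _
    · refine hX.fermiOp hD (by fun_prop) (fun z hz => ?_) (fun z hz => ?_)
      · have := hz i hi j hj hij.le
        constructor <;> simp <;> linarith
      · have := hz i hi j hj hij
        constructor <;> simp <;> linarith
  · have hij := not_le.mp hij
    have h1 := hX.fermiOp (w := fun z => Complex.I * (z j - z i)) hD (by fun_prop) (fun z hz => by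
        have := hz j hj i hi hij.le
        constructor <;> simp <;> linarith) (fun z hz => by
        have := hz j hj i hi hij
        constructor <;> simp <;> linarith)
    exact h1.clm (-ContinuousLinearMap.id ℂ H)

theorem tubeHolo_pathVec (hD : IsSelfAdjoint D) (B : Fin n → H →L[ℂ] H) {j₀ : Fin n}
    (h0 : j₀ ∈ S) (g : H) (m : ℕ) {T : Finset (Fin n)} (hT : T ⊆ S) {j : Fin n} (hj : j ∈ S) :
    TubeHolo β S (fun z => pathVec (FermiKMS.timeKernel D β z) B j₀ g m T j) := by
  induction m generalizing T j with
  | zero => exact (tubeHolo_const g).timeKernel hD hj h0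
  | succ m ih =>
    simp only [pathVec]
    refine TubeHolo.clm (X := fun z => ∑ l ∈ T, FermiKMS.timeKernel D β z j l
      (B l (pathVec (FermiKMS.timeKernel D β z) B j₀ g m (T.erase l) l))) ?_ (-ContinuousLinearMap.id ℂ H)
    exact TubeHolo.sum _ fun l hl => (((ih ((Finset.erase_subset _ _).trans hT) (hT hl)).clm (B l)).timeKernel
      hD hj (hT hl))

theorem tubeHolo_conn (hD : IsSelfAdjoint D) (F : Fin n → Finset J) (x y : Fin n → J → H)
    (c : Fin n → ℂ) {b : Finset (Fin n)} (hb : b ⊆ S) :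
    TubeHolo β S (fun z => conn (FermiKMS.timeKernel D β z) F x y c b) := by
  unfold conn
  split_ifs with h
  · unfold connAt
    refine (TubeHolo.sum _ fun p _ => ?_).add (tubeHolo_const _)
    exact (tubeHolo_pathVec hD _ (hb (b.min'_mem h)) _ _ ((Finset.erase_subset _ _).trans hb)
      (hb (b.min'_mem h))).clm (innerSL ℂ (x (b.min' h) p))
  · exact tubeHolo_const _

end Tube

/-! ### Connected functions at imaginary times. -/

section ImaginaryTimes

variable {H : Type*} [NormedAddCommGroup H] [InnerProductSpace ℂ H] [CompleteSpace H]
variable {𝔄 : Type*} [CStarAlgebra 𝔄] {ψ : H →ₗ⋆[ℂ] 𝔄} {ω : 𝔄 →L[ℂ] ℂ}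
variable {D : H →ₗ.[ℂ] H} {β : ℝ} {J : Type*} {n : ℕ}

/-- Times for the indices in `S`, extended by zero. -/
def extendTimes {α : Type*} [Zero α] (S : Finset (Fin n)) (z : Fin S.card → α) (i : Fin n) : α :=
  if h : i ∈ S then z ((S.orderIsoOfFin rfl).symm ⟨i, h⟩) else 0

theorem extendTimes_apply {α : Type*} [Zero α] (S : Finset (Fin n)) (z : Fin S.card → α) (i : Fin S.card) :
    extendTimes S z (S.orderEmbOfFin rfl i) = z i := by
  rw [extendTimes, dif_pos (S.orderEmbOfFin_mem rfl i)]
  congr 1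
  exact (S.orderIsoOfFin rfl).symm_apply_apply i

theorem extendTimes_mem {α : Type*} [Zero α] {S : Finset (Fin n)} (z : Fin S.card → α) {i : Fin n}
    (hi : i ∈ S) : extendTimes S z i = z ((S.orderIsoOfFin rfl).symm ⟨i, hi⟩) := dif_pos hi

theorem differentiable_extendTimes (S : Finset (Fin n)) :
    Differentiable ℂ (fun z : Fin S.card → ℂ => extendTimes S z) := by
  rw [differentiable_pi]
  intro i
  unfold extendTimes
  split_ifs
  · fun_prop
  · fun_prop

/-- The connected functions of quadratic elements at imaginary times. -/
theorem hasConnectedValue_quad (hψ : IsCARAlgebra ψ) (hD : IsSelfAdjoint D) (hβ : 0 < β) (hω : IsState ω)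
    (hk : IsAlgKMS ψ (fermiOp D β β) ω) (F : Fin n → Finset J) (x y : Fin n → J → H) (c : Fin n → ℂ)
    (u : Fin n → ℝ) :
    HasConnectedValue ω (evolution ψ D) β (fun l => quad ψ (F l) (x l) (y l) (c l)) u
      (conn (timeKernel D β (fun l => Complex.I * u l)) F x y c Finset.univ) := by
  refine ⟨fun S => ∑ P : Finpartition S, ∏ b ∈ P.parts,
    conn (timeKernel D β (fun l => Complex.I * u l)) F x y c b,
    conn (timeKernel D β (fun l => Complex.I * u l)) F x y c, fun S => ?_, fun S => rfl, rfl⟩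
  obtain ⟨h1, h2, C, h3⟩ : TubeHolo β S (fun z => ∑ P : Finpartition S, ∏ b ∈ P.parts,
      conn (timeKernel D β z) F x y c b) :=
    TubeHolo.sum _ fun P _ => TubeHolo.prod _ fun b hb => tubeHolo_conn hD F x y c (P.subset hb)
  have hclosed : ∀ z : Fin S.card → ℂ,
      (∀ i j, i ≤ j → (z i).im ≤ (z j).im ∧ (z j).im ≤ (z i).im + β) → extendTimes S z ∈ closedTube β S := by
    intro z hz i hi j hj hij
    rw [extendTimes_mem z hi, extendTimes_mem z hj]
    exact hz _ _ ((S.orderIsoOfFin rfl).symm.monotone hij)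
  have hcongr : ∀ z z' : Fin n → ℂ, (∀ l ∈ S, z l = z' l) →
      ∑ P : Finpartition S, ∏ b ∈ P.parts, conn (timeKernel D β z) F x y c b =
      ∑ P : Finpartition S, ∏ b ∈ P.parts, conn (timeKernel D β z') F x y c b := by
    intro z z' h
    refine Finset.sum_congr rfl fun P _ => Finset.prod_congr rfl fun b hb => ?_
    exact conn_timeKernel_congr F x y c fun l hl => h l (P.subset hb hl)
  -- The continuation is the partition sum with complex times; the value 0 given to times outside S
  -- never enters.
  refine ⟨fun z => ∑ P : Finpartition S, ∏ b ∈ P.parts, conn (timeKernel D β (extendTimes S z)) F x y c b,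
    ?_, ?_, ⟨C, fun z hz => h3 _ (hclosed z hz)⟩, fun s => ?_, ?_⟩
  · exact h1.comp (differentiable_extendTimes S).continuous.continuousOn hclosed
  · refine h2.comp (differentiable_extendTimes S).differentiableOn ?_
    intro z hz i hi j hj hij
    rw [extendTimes_mem z hi, extendTimes_mem z hj]
    exact hz _ _ ((S.orderIsoOfFin rfl).symm.strictMono hij)
  · have e1 := omega_evolution_quad hψ hD hβ hω hk F x y c (extendTimes S s) S
    rw [← ordProd_eq_ofFn] at e1
    simp only [extendTimes_apply] at e1
    rw [e1]
    refine hcongr _ _ fun l hl => ?_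
    rw [extendTimes_mem _ hl, extendTimes_mem _ hl]
  · refine hcongr _ _ fun l hl => ?_
    rw [extendTimes_mem _ hl]
    have : S.orderEmbOfFin rfl ((S.orderIsoOfFin rfl).symm ⟨l, hl⟩) = l :=
      congrArg Subtype.val ((S.orderIsoOfFin rfl).apply_symm_apply ⟨l, hl⟩)
    beta_reduce
    rw [this]

end ImaginaryTimes

/-! ### Paths as orderings of the vertices. -/

section Perm

variable {H : Type*} [NormedAddCommGroup H] [InnerProductSpace ℂ H] [CompleteSpace H]
variable {D : H →ₗ.[ℂ] H} {β : ℝ}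

theorem timeKernel_imaginary (hD : IsSelfAdjoint D) {N : ℕ} {u : Fin N → ℝ} (hu : StrictMono u)
    (hu' : ∀ i, u i ∈ Set.Ico 0 β) (i j : Fin N) :
    timeKernel D β (fun l => Complex.I * u l) i j = kernelOp D β (u i - u j) := by
  have h : Complex.I * (Complex.I * u j - Complex.I * u i) = ((u i - u j : ℝ) : ℂ) := by
    push_cast
    linear_combination (u j - u i : ℂ) * Complex.I_mul_I
  rw [timeKernel, h]
  split_ifs with hij
  · rw [kernelOp_of_nonpos D β (sub_nonpos.mpr (hu.monotone hij))]
  · rw [kernelOp_of_pos hD (sub_pos.mpr (hu (not_le.mp hij)))]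
    linarith [(hu' i).2, (hu' j).1]

theorem sum_injective_cons {N m : ℕ} {M : Type*} [AddCommMonoid M] (T : Finset (Fin N))
    (G : (Fin (m + 1) → Fin N) → M) :
    ∑ e : Fin (m + 1) → Fin N, (if Function.Injective e ∧ ∀ i, e i ∈ T then G e else 0) =
      ∑ l ∈ T, ∑ e : Fin m → Fin N,
        if Function.Injective e ∧ ∀ i, e i ∈ T.erase l then G (Fin.cons l e) else 0 := by
  rw [← (Fin.consEquiv fun _ => Fin N).sum_comp, Fintype.sum_prod_type,
    ← Finset.sum_subset (Finset.subset_univ T)]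
  · refine Finset.sum_congr rfl fun l hl => Finset.sum_congr rfl fun e _ => ?_
    have h : (Function.Injective (Fin.cons l e : Fin (m + 1) → Fin N) ∧
        ∀ i, (Fin.cons l e : Fin (m + 1) → Fin N) i ∈ T) ↔
        (Function.Injective e ∧ ∀ i, e i ∈ T.erase l) := by
      rw [Fin.cons_injective_iff, Fin.forall_fin_succ]
      simp only [Fin.cons_zero, Fin.cons_succ, Finset.mem_erase, Set.mem_range, not_exists]
      grind
    exact if_congr h rfl rfl
  · intro l _ hl
    refine Finset.sum_eq_zero fun e _ => if_neg fun h => hl ?_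
    simpa using h.2 0

/-- A path is an injective sequence of vertices, and the sign of each step cancels that of B = −A.
The case m = 0, j = 0 must be excluded: there the path has the equal-time propagator X_D(β), the
chain −X_D(0). -/
theorem pathVec_eq_sum_chain (hD : IsSelfAdjoint D) {N : ℕ} {u : Fin (N + 1) → ℝ} (hu : StrictMono u)
    (hu' : ∀ i, u i ∈ Set.Ico 0 β) (h0 : u 0 = 0) (A : H →L[ℂ] H)
    {B : Fin (N + 1) → H →L[ℂ] H} (hB : ∀ l, l ≠ 0 → B l = -A) (g : H) (m : ℕ)
    (T : Finset (Fin (N + 1))) (hT : 0 ∉ T) (j : Fin (N + 1)) (hj : m = 0 → j ≠ 0) :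
    pathVec (timeKernel D β (fun l => Complex.I * u l)) B 0 g m T j =
      ∑ e : Fin m → Fin (N + 1), if Function.Injective e ∧ ∀ i, e i ∈ T then
        chain D A β m (u j) (u ∘ e) g else 0 := by
  induction m generalizing T j with
  | zero =>
    have hj0 : 0 < u j := by
      have := hu (Fin.pos_iff_ne_zero.mpr (hj rfl))
      rwa [h0] at this
    rw [Fintype.sum_unique, if_pos ⟨Function.injective_of_subsingleton _, fun i => i.elim0⟩, pathVec,
      timeKernel_imaginary hD hu hu', chain, h0, sub_zero, kernelOp_of_pos hD hj0 (hu' j).2.le,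
      opFun_fermiPlus hD ⟨(hu' j).1, (hu' j).2.le⟩]
  | succ m ih =>
    rw [pathVec, sum_injective_cons, ← Finset.sum_neg_distrib]
    refine Finset.sum_congr rfl fun l hl => ?_
    have hl0 : l ≠ 0 := fun h => hT (h ▸ hl)
    rw [ih (T.erase l) (fun h => hT (Finset.mem_of_mem_erase h)) l fun _ => hl0, hB l hl0,
      timeKernel_imaginary hD hu hu', _root_.neg_apply, map_neg, neg_neg, map_sum, map_sum]
    refine Finset.sum_congr rfl fun e _ => ?_
    split_ifs
    · rfl
    · simp

theorem sum_injective_eq_sum_perm {n : ℕ} {M : Type*} [AddCommMonoid M]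
    (G : (Fin n → Fin (n + 1)) → M) :
    ∑ e : Fin n → Fin (n + 1),
      (if Function.Injective e ∧ ∀ i, e i ∈ (Finset.univ.erase 0 : Finset (Fin (n + 1))) then G e else 0) =
      ∑ σ : Equiv.Perm (Fin n), G (Fin.succ ∘ σ) := by
  symm
  refine Fintype.sum_of_injective (fun σ : Equiv.Perm (Fin n) => Fin.succ ∘ σ) ?_ _ _ ?_ ?_
  · intro σ τ h
    ext i
    have := congrFun h i
    simpa [Fin.ext_iff] using this
  · intro e he
    refine if_neg fun ⟨h1, h2⟩ => he ?_
    have h3 : ∀ i, e i ≠ 0 := fun i => (Finset.mem_erase.mp (h2 i)).1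
    have h4 : Function.Injective fun i => (e i).pred (h3 i) := fun i j hij => h1 (Fin.pred_inj.mp hij)
    refine ⟨Equiv.ofBijective _ (Finite.injective_iff_bijective.mp h4), ?_⟩
    ext i
    simp
  · intro σ
    rw [if_pos]
    exact ⟨(Fin.succ_injective n).comp σ.injective, fun i => by simp [Fin.succ_ne_zero]⟩

end Perm

/-! ### Finite truncations of the interaction. -/

section Interaction

variable {H : Type*} [NormedAddCommGroup H] [InnerProductSpace ℂ H] [CompleteSpace H]
variable {𝔄 : Type*} [CStarAlgebra 𝔄] {ψ : H →ₗ⋆[ℂ] 𝔄} {ω : 𝔄 →L[ℂ] ℂ}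
variable {D : H →ₗ.[ℂ] H} {β : ℝ} {ι : Type*}

/-- The partial sums `∑_{i ∈ k} ⟨b_i, v⟩ b_i` of the expansion in an orthonormal basis. -/
def basisProj (b : HilbertBasis ι ℂ H) (k : Finset ι) : H →L[ℂ] H :=
  ∑ i ∈ k, (innerSL ℂ (b i)).smulRight (b i)

theorem basisProj_apply (b : HilbertBasis ι ℂ H) (k : Finset ι) (v : H) :
    basisProj b k v = ∑ i ∈ k, ⟪b i, v⟫_ℂ • b i := by
  simp [basisProj]

theorem norm_basisProj_apply_le (b : HilbertBasis ι ℂ H) (k : Finset ι) (v : H) :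
    ‖basisProj b k v‖ ≤ ‖v‖ := by
  have h : ‖basisProj b k v‖ ^ 2 = ∑ i ∈ k, ‖⟪b i, v⟫_ℂ‖ ^ 2 := by
    have h1 := b.orthonormal.inner_sum (fun i => ⟪b i, v⟫_ℂ) (fun i => ⟪b i, v⟫_ℂ) k
    rw [← basisProj_apply, inner_self_eq_norm_sq_to_K] at h1
    have h2 : ((‖basisProj b k v‖ ^ 2 : ℝ) : ℂ) = ((∑ i ∈ k, ‖⟪b i, v⟫_ℂ‖ ^ 2 : ℝ) : ℂ) := by
      push_cast
      rw [show ((‖basisProj b k v‖ : ℝ) : ℂ) ^ 2 = _ from h1]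
      exact Finset.sum_congr rfl fun i _ => Complex.conj_mul' _
    exact_mod_cast h2
  have h3 := b.orthonormal.sum_inner_products_le v (s := k)
  rw [← h] at h3
  exact le_of_sq_le_sq h3 (norm_nonneg v)

theorem tendsto_basisProj (b : HilbertBasis ι ℂ H) (v : H) :
    Tendsto (fun k => basisProj b k v) atTop (𝓝 v) := by
  have h := b.hasSum_repr v
  simp only [b.repr_apply_apply] at h
  simp only [basisProj_apply]
  exact h

/-- The connected functions of `ψ(f) ψ(g)*` and of copies of the quadratic interaction. -/
def arakiTerm (D : H →ₗ.[ℂ] H) (A : H →L[ℂ] H) (β : ℝ) (f g : H) : (n : ℕ) → (Fin n → ℝ) → ℂ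
  | 0, _ => ⟪f, fermiOp D β β g⟫_ℂ
  | m + 1, u => ∑ σ : Equiv.Perm (Fin (m + 1)), ⟪f, chain D A β (m + 1) 0 (u ∘ σ) g⟫_ℂ

/-- The truncated interaction has the one-particle operator 𝒦P_k, with P_k the projection onto
finitely many basis vectors. The constants c_i enter only connected functions of a single factor and
drop out. -/
theorem hasConnectedValue_interaction (hψ : IsCARAlgebra ψ) (hD : IsSelfAdjoint D) (hβ : 0 < β)
    (hω : IsState ω) (hk : IsAlgKMS ψ (fermiOp D β β) ω) (𝒦 : H →L[ℂ] H) (b : HilbertBasis ι ℂ H)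
    (c : ι → ℝ) (k : Finset ι) (f g : H) (n : ℕ) {u : Fin n → ℝ} (hu : u ∈ openSimplex n β) :
    HasConnectedValue ω (evolution ψ D) β
      (Fin.cons (ψ f * star (ψ g)) fun _ => interaction ψ 𝒦 b c k : Fin (n + 1) → 𝔄)
      (Fin.cons 0 u : Fin (n + 1) → ℝ) (arakiTerm D (𝒦 * basisProj b k) β f g n u) := by
  -- The label `none` stands for the observable at vertex 0 and `some i` for the i-th term of the
  -- interaction; the overall sign of the interaction is put into x.
  let F : Fin (n + 1) → Finset (Option ι) := Fin.cons {none} fun _ => k.map Function.Embedding.some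
  let x : Fin (n + 1) → Option ι → H := Fin.cons (fun _ => f) fun _ o => o.elim 0 fun i => -b i
  let y : Fin (n + 1) → Option ι → H := Fin.cons (fun _ => g) fun _ o => o.elim 0 fun i => 𝒦 (b i)
  let c' : Fin (n + 1) → ℂ := Fin.cons 0 fun _ => -∑ i ∈ k, (c i : ℂ)
  let u' : Fin (n + 1) → ℝ := Fin.cons 0 u
  have hquad : (fun l => quad ψ (F l) (x l) (y l) (c' l)) =
      (Fin.cons (ψ f * star (ψ g)) fun _ => interaction ψ 𝒦 b c k : Fin (n + 1) → 𝔄) := by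
    funext l
    refine Fin.cases ?_ (fun l => ?_) l
    · simp [quad, F, x, y, c']
    · simp [quad, F, x, y, c', interaction, Finset.sum_add_distrib, Algebra.algebraMap_eq_smul_one,
        Finset.sum_smul, add_comm]
  have hmono : StrictMono u' := by
    intro i j
    refine Fin.cases ?_ (fun i => ?_) i <;> refine Fin.cases ?_ (fun j => ?_) j
    · exact fun h => (lt_irrefl _ h).elim
    · exact fun _ => (hu.2 j).1
    · exact fun h => (Fin.not_lt_zero _ h).elim
    · exact fun h => hu.1 (Fin.succ_lt_succ_iff.mp h)
  have hmem : ∀ i, u' i ∈ Set.Ico 0 β := by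
    refine Fin.cases ⟨le_rfl, hβ⟩ fun i => ⟨(hu.2 i).1.le, (hu.2 i).2⟩
  have hone : ∀ l, l ≠ 0 → oneBody (F l) (y l) (x l) = -(𝒦 * basisProj b k) := by
    refine Fin.cases (fun h => (h rfl).elim) fun l _ => ?_
    ext v
    simp [oneBody_apply, F, x, y, basisProj_apply, mul_apply_eq_comp]
  have h := hasConnectedValue_quad hψ hD hβ hω hk F x y c' u'
  rw [hquad] at h
  convert h using 1
  have huniv : (Finset.univ : Finset (Fin (n + 1))) = insert 0 (Finset.univ.erase 0) := by
    simp
  rw [huniv, conn_insert _ _ _ _ _ fun l hl => Fin.pos_iff_ne_zero.mpr (Finset.ne_of_mem_erase hl), connAt]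
  have hc : (if (Finset.univ.erase 0 : Finset (Fin (n + 1))) = ∅ then c' 0 else 0) = 0 := by
    simp [c']
  have hcard : (Finset.univ.erase 0 : Finset (Fin (n + 1))).card = n := by simp
  rw [hc, add_zero, hcard]
  have hF : F 0 = {none} := rfl
  rw [hF, Finset.sum_singleton]
  change _ = ⟪f, pathVec _ _ 0 g n _ 0⟫_ℂ
  cases n with
  | zero =>
    rw [arakiTerm, pathVec, timeKernel_imaginary hD hmono hmem, sub_self, kernelOp_of_nonpos D β le_rfl]
    simp
  | succ m =>
    rw [pathVec_eq_sum_chain hD hmono hmem rfl (𝒦 * basisProj b k) hone g (m + 1) _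
      (Finset.notMem_erase _ _) 0 (by simp), sum_injective_eq_sum_perm, arakiTerm, inner_sum]
    rfl

end Interaction

/-! ### From the simplex to the cube. -/

section Simplex

theorem openSimplex_subset_openCube (n : ℕ) (r : ℝ) : openSimplex n r ⊆ openCube n r :=
  fun _ hu => hu.2

theorem measurableSet_openSimplex (n : ℕ) (r : ℝ) : MeasurableSet (openSimplex n r) := by
  have h : openSimplex n r = (⋂ i : Fin n, ⋂ j : Fin n, ⋂ _ : i < j, {u | u i < u j}) ∩ openCube n r := by
    ext u
    simp [openSimplex, openCube, StrictMono]
  rw [h]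
  refine MeasurableSet.inter ?_ (measurableSet_openCube n r)
  exact MeasurableSet.iInter fun i => MeasurableSet.iInter fun j => MeasurableSet.iInter fun _ =>
    measurableSet_lt (measurable_pi_apply i) (measurable_pi_apply j)

/-- Permutation of the coordinates. -/
def permEquiv {n : ℕ} (σ : Equiv.Perm (Fin n)) : (Fin n → ℝ) ≃ᵐ (Fin n → ℝ) :=
  MeasurableEquiv.arrowCongr' σ.symm (MeasurableEquiv.refl ℝ)

theorem permEquiv_apply {n : ℕ} (σ : Equiv.Perm (Fin n)) (u : Fin n → ℝ) : permEquiv σ u = u ∘ σ := rfl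

theorem measurePreserving_permEquiv {n : ℕ} (σ : Equiv.Perm (Fin n)) :
    MeasurePreserving (permEquiv σ) :=
  volume_preserving_arrowCongr' σ.symm (MeasurableEquiv.refl ℝ) (MeasurePreserving.id _)

theorem comp_mem_openCube {n : ℕ} {r : ℝ} (σ : Equiv.Perm (Fin n)) {u : Fin n → ℝ} :
    u ∘ σ ∈ openCube n r ↔ u ∈ openCube n r :=
  ⟨fun h i => by simpa using h (σ.symm i), fun h i => h (σ i)⟩

variable {E : Type*} [NormedAddCommGroup E] [NormedSpace ℝ E]

theorem integrableOn_comp_perm {n : ℕ} {r : ℝ} {F : (Fin n → ℝ) → E} (hF : IntegrableOn F (openCube n r))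
    (σ : Equiv.Perm (Fin n)) : IntegrableOn (fun u => F (u ∘ σ)) (openCube n r) := by
  have h := ((measurePreserving_permEquiv σ).integrableOn_comp_preimage
    (permEquiv σ).measurableEmbedding (s := openCube n r) (f := F)).mpr hF
  have h2 : permEquiv σ ⁻¹' openCube n r = openCube n r := by
    ext u
    exact comp_mem_openCube σ
  rwa [h2] at h

/-- The images of the simplex under coordinate permutations are disjoint and fill the cube up to
points with coinciding coordinates. -/
theorem integral_openSimplex_sum_perm {n : ℕ} {r : ℝ} {F : (Fin n → ℝ) → E}
    (hF : IntegrableOn F (openCube n r)) :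
    ∫ u in openSimplex n r, ∑ σ : Equiv.Perm (Fin n), F (u ∘ σ) = ∫ u in openCube n r, F u := by
  have h1 (σ : Equiv.Perm (Fin n)) : ∫ u in openSimplex n r, F (u ∘ σ) =
      ∫ v in permEquiv σ.symm ⁻¹' openSimplex n r, F v := by
    rw [← (measurePreserving_permEquiv σ).setIntegral_preimage_emb (permEquiv σ).measurableEmbedding F]
    congr 2
    ext u
    simp [permEquiv_apply, Function.comp_assoc]
  rw [integral_finsetSum _ fun σ _ => (integrableOn_comp_perm hF σ).mono_set (openSimplex_subset_openCube n r)]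
  simp only [h1]
  rw [← integral_iUnion_fintype]
  · refine setIntegral_congr_set ?_
    filter_upwards [ae_injective n] with u hu
    refine propext ⟨fun h => ?_, fun h => ?_⟩
    · obtain ⟨σ, hσ⟩ := Set.mem_iUnion.mp h
      exact (comp_mem_openCube σ.symm).mp hσ.2
    · refine Set.mem_iUnion.mpr ⟨(Tuple.sort u).symm, ?_⟩
      refine ⟨(Tuple.monotone_sort u).strictMono_of_injective (hu.comp (Tuple.sort u).injective), ?_⟩
      exact (comp_mem_openCube (Tuple.sort u)).mpr h
  · exact fun σ => (permEquiv σ.symm).measurable (measurableSet_openSimplex n r)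
  · intro σ τ hστ
    refine Set.disjoint_left.mpr fun v hv hv' => hστ ?_
    have h := Tuple.unique_monotone hv.1.monotone hv'.1.monotone
    have hinj : Function.Injective v := by
      have := hv.1.injective.comp σ.injective
      simpa [permEquiv_apply] using this
    ext i
    have h3 := hinj (congrFun h (σ i))
    simp at h3
    rw [Equiv.eq_symm_apply] at h3
    simp [h3]
  · intro σ
    refine hF.mono_set fun v hv => (comp_mem_openCube σ.symm).mp hv.2

end Simplex

/-! ### Summation of Araki's expansion. -/

section ArakiExpansion

variable {H : Type*} [NormedAddCommGroup H] [InnerProductSpace ℂ H] [CompleteSpace H]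
variable {𝔄 : Type*} [CStarAlgebra 𝔄] {ψ : H →ₗ⋆[ℂ] 𝔄} {ω : 𝔄 →L[ℂ] ℂ}
variable {D : H →ₗ.[ℂ] H} {𝒦 : H →L[ℂ] H} {β : ℝ} {ι : Type*}

theorem tendsto_basisProj_of_tendsto (b : HilbertBasis ι ℂ H) {w : Finset ι → H} {v : H}
    (h : Tendsto w atTop (𝓝 v)) : Tendsto (fun k => basisProj b k (w k)) atTop (𝓝 v) := by
  have h1 : Tendsto (fun k => basisProj b k (w k - v)) atTop (𝓝 0) := by
    refine squeeze_zero_norm (fun k => norm_basisProj_apply_le b k _) ?_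
    exact tendsto_iff_norm_sub_tendsto_zero.mp h
  have h2 := h1.add (tendsto_basisProj b v)
  simpa using h2

/-- The projections P_k converge strongly with norms at most 1, so the limit can be taken factor by
factor from the right. -/
theorem tendsto_chain (D : H →ₗ.[ℂ] H) (𝒦 : H →L[ℂ] H) (β : ℝ) (b : HilbertBasis ι ℂ H) (g : H) (m : ℕ)
    (s : ℝ) (u : Fin m → ℝ) :
    Tendsto (fun k => chain D (𝒦 * basisProj b k) β m s u g) atTop (𝓝 (chain D 𝒦 β m s u g)) := by
  induction m generalizing s with
  | zero => exact tendsto_const_nhds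
  | succ m ih =>
    have h := tendsto_basisProj_of_tendsto b (ih (u 0) (Fin.tail u))
    exact ((kernelOp D β (s - u 0)).continuous.tendsto _).comp ((𝒦.continuous.tendsto _).comp h)

theorem tendsto_arakiTerm (D : H →ₗ.[ℂ] H) (𝒦 : H →L[ℂ] H) (β : ℝ) (b : HilbertBasis ι ℂ H) (f g : H)
    (n : ℕ) (u : Fin n → ℝ) :
    Tendsto (fun k => arakiTerm D (𝒦 * basisProj b k) β f g n u) atTop
      (𝓝 (arakiTerm D 𝒦 β f g n u)) := by
  cases n with
  | zero => exact tendsto_const_nhds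
  | succ m =>
    exact tendsto_finsetSum _ fun σ _ =>
      tendsto_const_nhds.inner (tendsto_chain D 𝒦 β b g (m + 1) 0 (u ∘ σ))

/-- The matrix element `A ↦ ⟨f, A g⟩`. -/
def matrixElement (f g : H) : (H →L[ℂ] H) →L[ℂ] ℂ :=
  (innerSL ℂ f).comp (ContinuousLinearMap.apply ℂ H g)

theorem matrixElement_apply (f g : H) (A : H →L[ℂ] H) : matrixElement f g A = ⟪f, A g⟫_ℂ := rfl

theorem integrableOn_arakiTerm (hD : IsSelfAdjoint D) (hβ : 0 < β) (f g : H) (n : ℕ) :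
    IntegrableOn (arakiTerm D 𝒦 β f g n) (openSimplex n β) := by
  refine IntegrableOn.mono_set ?_ (openSimplex_subset_openCube n β)
  cases n with
  | zero => exact integrableOn_const (volume_openCube_lt_top 0 β).ne
  | succ m =>
    refine integrable_finsetSum _ fun σ _ => ?_
    exact integrableOn_comp_perm (F := fun u => matrixElement f g (chain D 𝒦 β (m + 1) 0 u))
      ((matrixElement f g).integrable_comp (integrableOn_chain hD (m + 1) ⟨le_rfl, hβ⟩)) σ

theorem integral_arakiTerm_succ (hD : IsSelfAdjoint D) (hβ : 0 < β) (f g : H) (m : ℕ) :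
    (-1 : ℂ) ^ (m + 1) * ∫ u in openSimplex (m + 1) β, arakiTerm D 𝒦 β f g (m + 1) u =
      ⟪f, seriesTerm D 𝒦 β β m g⟫_ℂ := by
  have hint := integrableOn_chain (𝒦 := 𝒦) hD (m + 1) ⟨le_rfl, hβ⟩
  have h := integral_openSimplex_sum_perm
    (F := fun u => matrixElement f g (chain D 𝒦 β (m + 1) 0 u)) ((matrixElement f g).integrable_comp hint)
  have h2 : ∫ u in openCube (m + 1) β, chain D 𝒦 β (m + 1) 0 u =
      ∫ u in openCube (m + 1) β, seriesIntegrand D 𝒦 β m u :=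
    setIntegral_congr_fun (measurableSet_openCube _ _) fun u hu =>
      (seriesIntegrand_eq_chain D 𝒦 m (hu 0).1.le).symm
  rw [(matrixElement f g).integral_comp_comm hint, h2] at h
  rw [← matrixElement_apply, seriesTerm, map_smul, smul_eq_mul, ← h]
  rfl

theorem integral_arakiTerm_zero (f g : H) :
    ∫ u in openSimplex 0 β, arakiTerm D 𝒦 β f g 0 u = ⟪f, fermiOp D β β g⟫_ℂ := by
  have h : openSimplex 0 β = openCube 0 β := by
    ext u
    simp [openSimplex, openCube, Subsingleton.strictMono]
  rw [h]
  simp [arakiTerm, Measure.real, volume_openCube]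

theorem hasArakiValue_interaction (hψ : IsCARAlgebra ψ) (hD : IsSelfAdjoint D) (hβ : 0 < β)
    (h𝒦β : ‖𝒦‖ < β⁻¹) (hω : IsState ω) (hk : IsAlgKMS ψ (fermiOp D β β) ω) (b : HilbertBasis ι ℂ H)
    (c : ι → ℝ) (f g : H) :
    HasArakiValue ω (evolution ψ D) β (interaction ψ 𝒦 b c) atTop (ψ f * star (ψ g))
      ⟪f, T D 𝒦 β β g⟫_ℂ := by
  refine ⟨fun k => arakiTerm D (𝒦 * basisProj b k) β f g, arakiTerm D 𝒦 β f g,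
    fun k n u hu => hasConnectedValue_interaction hψ hD hβ hω hk 𝒦 b c k f g n hu,
    fun n u _ => tendsto_arakiTerm D 𝒦 β b f g n u, integrableOn_arakiTerm hD hβ f g, ?_⟩
  have hsum := (series_converges hD hβ h𝒦β (r := β) ⟨hβ.le, le_rfl⟩).2.2.2.mapL (matrixElement f g)
  -- The term n = 0 is the free expectation value ⟨f, Sg⟩; the term n = m + 1 is the matrix element
  -- of the m-th series term.
  refine (hasSum_nat_add_iff' 1).mp ?_
  convert hsum using 1
  · rfl
  · funext m
    exact integral_arakiTerm_succ hD hβ f g m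
  · rw [Finset.sum_range_one, integral_arakiTerm_zero, pow_zero, one_mul, map_sub, ← fermiOp_beta]
    rfl

theorem IsQuasifree.apply_pair {S : H →L[ℂ] H} (h : IsQuasifree ψ S ω) (f g : H) :
    ω (ψ f * star (ψ g)) = ⟪f, S g⟫_ℂ := by
  simpa using h.1 1 (fun _ => f) (fun _ => g)

end ArakiExpansion

end FermiKMS

end

theorem mainTheorem1
    {H : Type*} [NormedAddCommGroup H] [InnerProductSpace ℂ H] [CompleteSpace H]
    (D : H →ₗ.[ℂ] H) (hD : IsSelfAdjoint D)
    (𝒦 : H →L[ℂ] H) (h𝒦 : IsSelfAdjoint 𝒦)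
    (β : ℝ) (hβ : 0 < β) (h𝒦β : ‖𝒦‖ < β⁻¹)
    {𝔄 : Type*} [CStarAlgebra 𝔄] (ψ : H →ₗ⋆[ℂ] 𝔄) (hψ : FermiKMS.IsCARAlgebra ψ)
    {ι : Type*} (b : HilbertBasis ι ℂ H) (c : ι → ℝ) :
    -- the series defining `T(r)` converges absolutely in operator norm
    (∀ r ∈ Set.Icc 0 β,
      (∀ m : ℕ, IntegrableOn (FermiKMS.seriesIntegrand D 𝒦 β m) (FermiKMS.openCube (m + 1) r)) ∧
      Summable (fun m : ℕ =>
        ∫ u in FermiKMS.openCube (m + 1) r, ‖FermiKMS.seriesIntegrand D 𝒦 β m u‖) ∧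
      Summable (fun m : ℕ => ‖FermiKMS.seriesTerm D 𝒦 β r m‖) ∧
      HasSum (FermiKMS.seriesTerm D 𝒦 β r)
        (FermiKMS.T D 𝒦 β r - FermiKMS.opFun D (fun x => ((1 / (1 + Real.exp (-β * x)) : ℝ) : ℂ)))) ∧
    -- `T(β) = (1 + e^{-β(D + 𝒦)})⁻¹`
    FermiKMS.T D 𝒦 β β =
      FermiKMS.opFun (FermiKMS.perturbed D 𝒦)
        (fun x => ((1 / (1 + Real.exp (-β * x)) : ℝ) : ℂ)) ∧
    -- the free and the interacting time evolution on the CAR algebra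
    (∀ (t : ℝ) (f : H),
      FermiKMS.evolution ψ D t (ψ f) = ψ (FermiKMS.unitaryGroup D t f) ∧
      FermiKMS.evolution ψ (FermiKMS.perturbed D 𝒦) t (ψ f) =
        ψ (FermiKMS.unitaryGroup (FermiKMS.perturbed D 𝒦) t f)) ∧
    -- their unique KMS states `ωβ` and `ωK`; `ωK` is quasifree with two-point function `T(β)`, which
    -- is the two-point function of Araki's perturbation of `ωβ`
    ∃ ωβ ωK : 𝔄 →L[ℂ] ℂ,
      (∀ ω, FermiKMS.IsKMSState (FermiKMS.evolution ψ D) β ω ↔ ω = ωβ) ∧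
      (∀ ω, FermiKMS.IsKMSState (FermiKMS.evolution ψ (FermiKMS.perturbed D 𝒦)) β ω ↔ ω = ωK) ∧
      FermiKMS.IsQuasifree ψ (FermiKMS.T D 𝒦 β β) ωK ∧
      ∀ f g : H,
        ωK (ψ f * star (ψ g)) = ⟪f, FermiKMS.T D 𝒦 β β g⟫_ℂ ∧
        FermiKMS.HasArakiValue ωβ (FermiKMS.evolution ψ D) β
          (FermiKMS.interaction ψ 𝒦 b c) atTop (ψ f * star (ψ g))
          ⟪f, FermiKMS.T D 𝒦 β β g⟫_ℂ := by
  have hA := FermiKMS.perturbed_isSelfAdjoint hD h𝒦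
  have hT := FermiKMS.T_beta_eq hD h𝒦 hβ h𝒦β
  obtain ⟨ωβ, hωβ, hstate, hkms, -⟩ := FermiKMS.exists_kmsState hψ hD hβ
  obtain ⟨ωK, hωK, -, -, hquasi⟩ := FermiKMS.exists_kmsState hψ hA hβ
  rw [← hT] at hquasi
  exact ⟨fun r hr => FermiKMS.series_converges hD hβ h𝒦β hr, hT.trans (FermiKMS.fermiOp_beta _ β),
    fun t f => ⟨FermiKMS.evolution_apply hψ hD t f, FermiKMS.evolution_apply hψ hA t f⟩,
    ωβ, ωK, hωβ, hωK, hquasi, fun f g => ⟨hquasi.apply_pair f g,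
      FermiKMS.hasArakiValue_interaction hψ hD hβ h𝒦β hstate hkms b c f g⟩⟩
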